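/- A planar convex billiard table is a compact convex set $T\subset\mathbb R^2$ with non-empty interior. An outward support vector of $T$ at $q\in\partial T$ is a vector $\nu$ with $\langle x-q,\nu\rangle\le 0$ for all $x\in T$; the point $q$ is smooth if there is exactly one such $\nu$ of length $1$. A generalised billiard orbit on $T$ is a sequence $(q_i)_{i\in\mathbb Z}$ in $\partial T$ with $q_i\ne q_{i+1}$ such that for every $i$ the vector $$\nu_i=\frac{q_i-q_{i-1}}{\|q_i-q_{i-1}\|}+\frac{q_i-q_{i+1}}{\|q_i-q_{i+1}\|}$$ is an outward support vector of $T$ at $q_i$. It is closed if $q_{i+m}=q_i$ for all $i$ and some $m\ge2$; if $m\geq 2$ is the smallest such number, it is an $m$-bounce orbit, and its length is $\sum_{i=0}^{m-1}\|q_{i+1}-q_i\|$. An orbit is regular if all the points $q_i$ are smooth, and singular otherwise. Closed orbits with the same trace $\bigcup_i[q_i,q_{i+1}]$ are identified. Let $\mathcal P_{\min}(T)$ be the set of generalised closed billiard orbits on $T$ of minimal length, $\mathcal P_{3,\mathrm{reg}}(T)$ the set of regular $3$-bounce orbits, and $\operatorname{width}(T)$ the thickness of the thinnest band between two parallel lines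 that contains $T$. **Proposition.** For $n\ge3$ let $R_n$ be the regular $n$-gon inscribed in the unit circle. (i) If $n=3$, then $\mathcal P_{\min}(R_3)$ consists of exactly one orbit, the Fagnano orbit, which is the $3$-bounce orbit through the feet of the three altitudes. Its length is $\frac{3\sqrt3}{2}$. (ii) If $n\ge5$ is odd, then $\mathcal P_{\min}(R_n)$ consists of exactly $n$ orbits, namely the singular $2$-bounce orbits that run between a vertex of $R_n$ and the midpoint of the edge opposite to it. Their length is $2\left(1+\cos\frac\pi n\right)=2\operatorname{width}(R_n)$. (iii) If $n$ is even, then $\mathcal P_{\min}(R_n)$ consists of $\frac n2$ bands of $2$-bounce orbits (no orbit belongs to two of them), one for each pair of opposite (parallel) edges; the band of such a pair consists of all segments that join a point of one of the two closed edges to a point of the other and are orthogonal to both. Their length (as closed orbits) is $4\cos\frac\pi n=2\operatorname{width}(R_n)$. (iv) If $n=3k$, then $\mathcal P_{3,\mathrm{reg}}(R_n)$ consists of exactly $k$ orbits, namely the equilateral triangles whose vertices are the midpoints of three edges with indices $j,\,j+k,\,j+2k$ (the edges being numbered cyclically). Their length is $3\sqrt3\cos\frac\pi n$, which is larger than $2\operatorname{width}(R_n)$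 if $k\ge2$. If $n$ is not divisible by $3$, then $\mathcal P_{3,\mathrm{reg}}(R_n)$ is empty. -/

import Mathlib

noncomputable section

namespace Billiard

section Tables

variable {E : Type*} [NormedAddCommGroup E] [InnerProductSpace ℝ E]

/-- `ν` is an outward support vector of `T` at `q`. -/
def IsOutwardSupport (T : Set E) (q ν : E) : Prop :=
  ∀ x ∈ T, inner ℝ (x - q) ν ≤ 0

/-- `q` is a smooth boundary point of `T`: the outward support vector of `T` at `q`,
normalised to length one, is unique. -/
def IsSmoothPoint (T : Set E) (q : E) : Prop :=
  q ∈ frontier T ∧ ∃! ν : E, ‖ν‖ = 1 ∧ IsOutwardSupport T q ν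

/-- The vector `(q i - q (i-1)) / ‖q i - q (i-1)‖ + (q i - q (i+1)) / ‖q i - q (i+1)‖`. -/
def bounceVector (q : ℤ → E) (i : ℤ) : E :=
  ‖q i - q (i - 1)‖⁻¹ • (q i - q (i - 1)) + ‖q i - q (i + 1)‖⁻¹ • (q i - q (i + 1))

/-- Generalised billiard orbits on `T`, as sequences of bounce points. Consecutive bounce points
are distinct, so that the bounce vectors make sense. -/
def IsGeneralisedOrbit (T : Set E) (q : ℤ → E) : Prop :=
  ∀ i, q i ∈ frontier T ∧ q i ≠ q (i + 1) ∧ IsOutwardSupport T (q i) (bounceVector q i)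

/-- The numbers `n ≥ 2` with `q (i + n) = q i` for all `i`. -/
def periods (q : ℤ → E) : Set ℕ :=
  {n | 2 ≤ n ∧ ∀ i : ℤ, q (i + n) = q i}

/-- The number of bounces of a closed orbit: its smallest period. -/
def bounceNumber (q : ℤ → E) : ℕ := sInf (periods q)

/-- The generalised closed billiard orbits on `T`. -/
def closedOrbits (T : Set E) : Set (ℤ → E) :=
  {q | IsGeneralisedOrbit T q ∧ (periods q).Nonempty}

/-- The `n`-bounce orbits on `T`. -/
def bounceOrbits (T : Set E) (n : ℕ) : Set (ℤ → E) :=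
  {q | q ∈ closedOrbits T ∧ bounceNumber q = n}

/-- A regular orbit: all bounce points are smooth. -/
def IsRegularOrbit (T : Set E) (q : ℤ → E) : Prop := ∀ i, IsSmoothPoint T (q i)

/-- The regular `n`-bounce orbits on `T`. -/
def regularBounceOrbits (T : Set E) (n : ℕ) : Set (ℤ → E) :=
  {q | q ∈ bounceOrbits T n ∧ IsRegularOrbit T q}

/-- The length of a closed orbit. -/
def orbitLength (q : ℤ → E) : ℝ :=
  ∑ i ∈ Finset.range (bounceNumber q), ‖q ((i : ℤ) + 1) - q (i : ℤ)‖

/-- The generalised closed billiard orbits on `T` of minimal length. -/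
def minOrbits (T : Set E) : Set (ℤ → E) :=
  {q | q ∈ closedOrbits T ∧ ∀ q' ∈ closedOrbits T, orbitLength q ≤ orbitLength q'}

/-- The trace of an orbit. Closed orbits with the same trace are identified, so a set `S` of
closed orbits is understood as the set `trace '' S` of its traces. -/
def trace (q : ℤ → E) : Set E := ⋃ i : ℤ, segment ℝ (q i) (q (i + 1))

/-- The width of `T`: the thickness of the thinnest band containing `T`. -/
def width (T : Set E) : ℝ :=
  sInf {w : ℝ | 0 ≤ w ∧ ∃ u : E, ‖u‖ = 1 ∧
    ∃ a : ℝ, ∀ x ∈ T, a ≤ inner ℝ u x ∧ inner ℝ u x ≤ a + w}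

/-- The sequence `…, x, y, x, y, …`. -/
def twoBounce (x y : E) : ℤ → E := fun i => if i % 2 = 0 then x else y

/-- The sequence `…, x, y, z, x, y, z, …`. -/
def threeBounce (x y z : E) : ℤ → E :=
  fun i => if i % 3 = 0 then x else if i % 3 = 1 then y else z

/-- The foot of the altitude from `a` to the line through `b` and `c`. -/
def altitudeFoot (a b c : E) : E :=
  EuclideanGeometry.orthogonalProjection (affineSpan ℝ {b, c}) a

/-- The Fagnano orbit of the triangle `a b c`: it bounces at the feet of the three altitudes. -/
def fagnanoOrbit (a b c : E) : ℤ → E :=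
  threeBounce (altitudeFoot a b c) (altitudeFoot b c a) (altitudeFoot c a b)

end Tables

/-- The vertices of the regular `n`-gon inscribed in the unit circle, counterclockwise. The
Euclidean plane is `ℂ`, with its real inner product. -/
def vertex (n j : ℕ) : ℂ := Complex.exp (2 * Real.pi * Complex.I * j / n)

/-- The regular `n`-gon inscribed in the unit circle. -/
def regularPolygon (n : ℕ) : Set ℂ := convexHull ℝ (Set.range (vertex n))

/-- The `j`-th (closed) edge. -/
def edge (n j : ℕ) : Set ℂ := segment ℝ (vertex n j) (vertex n (j + 1))

/-- The midpoint of the `j`-th edge. -/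
def edgeMidpoint (n j : ℕ) : ℂ := midpoint ℝ (vertex n j) (vertex n (j + 1))

/-- For odd `n`: the 2-bounce orbit from the `j`-th vertex to the midpoint of the opposite edge. -/
def vertexOrbit (n j : ℕ) : ℤ → ℂ := twoBounce (vertex n j) (edgeMidpoint n (j + (n - 1) / 2))

/-- For even `n`: the band of 2-bounce orbits running between the `j`-th edge and the opposite,
parallel, edge along segments orthogonal to these two edges. -/
def band (n j : ℕ) : Set (ℤ → ℂ) :=
  {q | ∃ x ∈ edge n j, ∃ y ∈ edge n (j + n / 2),
    inner ℝ (y - x) (vertex n (j + 1) - vertex n j) = 0 ∧ q = twoBounce x y}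

/-- For `n = 3 * k`: the 3-bounce orbit through the midpoints of the edges
`j`, `j + k`, `j + 2 * k`. -/
def midpointOrbit (n k j : ℕ) : ℤ → ℂ :=
  threeBounce (edgeMidpoint n j) (edgeMidpoint n (j + k)) (edgeMidpoint n (j + 2 * k))

end Billiard

end

/-!
The proof rests on two facts about a closed generalised orbit `q` on the regular polygon, which is
the intersection of the half-planes `inner ℝ (edgeNormal n j) x ≤ apothem n`
(`mem_regularPolygon_iff`).

*The bounce points cannot be translated into the interior.* The bounce vectors are differences of
consecutive unit directions, so they add up to zero over a period, and each of them is an outward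
support vector. A translation that moves all bounce points into the interior would have a negative
inner product with each non-zero bounce vector, contrary to their sum being zero. Hence zero is a
convex combination of the normals of the edges met by the orbit
(`zero_mem_convexHull_touchedNormals`), and Carathéodory's theorem yields two opposite edges, or
three edges whose normals positively span the plane, that are all met
(`exists_touched_pair_or_triple`). The orbit is at least as long as the possibly degenerate triangle
spanned by two or three such bounce points, and in case of equality has the same trace
(`perimeter_le_orbitLength`).

*The perimeter of a triangle with vertices on given edge lines is bounded below by linear
functionals.* If `u`, `v`, `w` are in the unit ball, then the sum of the inner products of the three
sides with `u`, `v`, `w` is at most the perimeter (`inner_add_inner_add_inner_le_perimeter`), and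
for suitable `u`, `v`, `w` it depends only on the edges. For opposite edges this gives the bound
`4 * apothem n` (`perimeter_pair_bound`). If the triangle formed by the three edge lines is not
acute, it gives twice the altitude onto the longest side (`perimeter_nonacute_bound`). In the acute
case it gives the perimeter of the orthic triangle (`perimeter_altitude_bound`), which is larger than
`2 * (1 + apothem n)` if `n ≥ 4` (`lt_perimeter_of_acute`) and equal to `3 * √3 / 2` if `n = 3`. The
equality cases determine the minimal orbits: bands for even `n` (`orbitLength_bound_of_even`),
vertex orbits for odd `n ≥ 5` (`orbitLength_bound_of_odd`), and the Fagnano orbit for `n = 3`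
(`orbitLength_bound_triangle`).

For a regular orbit with three bounce points on the edges `a`, `b`, `c`, the reflection law says
that the product of the incoming and the outgoing unit direction, as complex numbers, is minus the
square of the edge normal (`IsRegularTriangle.mul_eq`). The three equations determine the directions
of the sides up to sign, hence also the signed distance `t` of a bounce point from the midpoint of
its edge: `t * cos (π * (b - a) / n) = apothem n * sin (π * (a + b - 2 * c) / n)`. As `|t|` is
smaller than half the side length, `n` divides `a + b - 2 * c` (`IsRegularTriangle.dvd`). By
symmetry the three edges are equally spaced, so `3 ∣ n`, and the bounce points are the midpoints of
the edges.

The width is computed directly. The two supporting lines orthogonal to a given direction are at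
least the claimed distance apart: for even `n` because the polygon contains the disc of radius
`apothem n`, for odd `n` because the differences of almost opposite vertices point in `2 * n`
equally spaced directions (`exists_vertices_of_odd`).
-/

namespace Billiard

/-! ### Unit vectors at multiples of `π / n` -/

/-- The unit vector at angle `π * t / n`. The vertices of the regular `n`-gon are the vectors
`dir n (2 * j)`, its outward edge normals the vectors `dir n (2 * j + 1)`. -/
noncomputable def dir (n : ℕ) (t : ℝ) : ℂ := Complex.exp ((Real.pi * t / n : ℝ) * Complex.I)

/-- The outward unit normal of the `j`-th edge; the index is an integer taken modulo `n`. -/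
noncomputable def edgeNormal (n : ℕ) (j : ℤ) : ℂ := dir n (2 * j + 1)

/-- The inradius of the regular `n`-gon. -/
noncomputable def apothem (n : ℕ) : ℝ := Real.cos (Real.pi / n)

/-- Half of the side length of the regular `n`-gon. -/
noncomputable def halfSide (n : ℕ) : ℝ := Real.sin (Real.pi / n)

theorem dir_re (n : ℕ) (t : ℝ) : (dir n t).re = Real.cos (Real.pi * t / n) :=
  Complex.exp_ofReal_mul_I_re _

theorem dir_im (n : ℕ) (t : ℝ) : (dir n t).im = Real.sin (Real.pi * t / n) :=
  Complex.exp_ofReal_mul_I_im _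

theorem norm_dir (n : ℕ) (t : ℝ) : ‖dir n t‖ = 1 := Complex.norm_exp_ofReal_mul_I _

theorem dir_ne_zero (n : ℕ) (t : ℝ) : dir n t ≠ 0 := Complex.exp_ne_zero _

theorem dir_add (n : ℕ) (s t : ℝ) : dir n (s + t) = dir n s * dir n t := by
  rw [dir, dir, dir, ← Complex.exp_add]
  congr 1
  push_cast
  ring

theorem inner_eq (z w : ℂ) : inner ℝ z w = z.re * w.re + z.im * w.im := by
  simp [Complex.inner]
  ring

theorem inner_dir (n : ℕ) (s t : ℝ) :
    inner ℝ (dir n s) (dir n t) = Real.cos (Real.pi * (s - t) / n) := by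
  rw [inner_eq, dir_re, dir_re, dir_im, dir_im, ← Real.cos_sub]
  congr 1
  ring

theorem dir_add_period {n : ℕ} (hn : n ≠ 0) (t : ℝ) : dir n (t + n) = -dir n t := by
  have h : Real.pi * (t + n) / n = Real.pi * t / n + Real.pi := by
    have : (n : ℝ) ≠ 0 := by exact_mod_cast hn
    field_simp
  apply Complex.ext
  · rw [dir_re, h, Real.cos_add_pi]; simp [dir_re]
  · rw [dir_im, h, Real.sin_add_pi]; simp [dir_im]

theorem dir_add_two_mul_period {n : ℕ} (hn : n ≠ 0) (t : ℝ) (k : ℤ) :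
    dir n (t + 2 * n * k) = dir n t := by
  have h : Real.pi * (t + 2 * n * k) / n = Real.pi * t / n + k * (2 * Real.pi) := by
    have : (n : ℝ) ≠ 0 := by exact_mod_cast hn
    field_simp
  apply Complex.ext
  · rw [dir_re, h, Real.cos_add_int_mul_two_pi, dir_re]
  · rw [dir_im, h, Real.sin_add_int_mul_two_pi, dir_im]

theorem norm_edgeNormal (n : ℕ) (j : ℤ) : ‖edgeNormal n j‖ = 1 := norm_dir _ _

theorem inner_edgeNormal_self (n : ℕ) (j : ℤ) :
    inner ℝ (edgeNormal n j) (edgeNormal n j) = 1 := by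
  rw [real_inner_self_eq_norm_sq, norm_edgeNormal, one_pow]

theorem inner_edgeNormal (n : ℕ) (i j : ℤ) :
    inner ℝ (edgeNormal n i) (edgeNormal n j) = Real.cos (2 * Real.pi * (i - j) / n) := by
  rw [edgeNormal, edgeNormal, inner_dir]
  congr 1
  ring

theorem edgeNormal_add_mul {n : ℕ} (hn : n ≠ 0) (j k : ℤ) :
    edgeNormal n (j + n * k) = edgeNormal n j := by
  rw [edgeNormal, edgeNormal, ← dir_add_two_mul_period hn (2 * j + 1) k]
  congr 1
  push_cast
  ring

theorem edgeNormal_emod {n : ℕ} (hn : n ≠ 0) (j : ℤ) :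
    edgeNormal n (j % n) = edgeNormal n j := by
  rw [← edgeNormal_add_mul hn (j % n) (j / n), Int.emod_add_mul_ediv]

theorem edgeNormal_eq_of_dvd {n : ℕ} (hn : n ≠ 0) {i j : ℤ} (h : (n : ℤ) ∣ i - j) :
    edgeNormal n i = edgeNormal n j := by
  obtain ⟨k, hk⟩ := h
  rw [← edgeNormal_add_mul hn j k, ← hk, add_sub_cancel]

/-! ### Trigonometric estimates -/

/-- Among the numbers `|sin (π * m / n)|`, the smallest non-zero one is attained at `m = 1`. -/
theorem halfSide_le_abs_sin {n : ℕ} (hn : n ≠ 0) {m : ℤ} (hm : ¬ (n : ℤ) ∣ m) :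
    halfSide n ≤ |Real.sin (Real.pi * m / n)| := by
  have hn0 : (0 : ℝ) < n := by positivity
  obtain ⟨k, q, hk1, hk2, rfl⟩ : ∃ k q : ℤ, 1 ≤ k ∧ k ≤ n - 1 ∧ m = k + n * q := by
    refine ⟨m % n, m / n, ?_, ?_, (Int.emod_add_mul_ediv m n).symm⟩
    · have h1 : m % n ≠ 0 := fun h => hm (Int.dvd_of_emod_eq_zero h)
      have h2 := Int.emod_nonneg m (b := n) (by exact_mod_cast hn)
      omega
    · have := Int.emod_lt_of_pos m (b := n) (by exact_mod_cast hn0)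
      omega
  have h1 : Real.pi * ((k + n * q : ℤ) : ℝ) / n = Real.pi * k / n + q * Real.pi := by
    push_cast
    field_simp
  rw [h1, Real.sin_add_int_mul_pi, abs_mul, abs_zpow, abs_neg, abs_one, one_zpow, one_mul]
  refine le_trans ?_ (le_abs_self _)
  have hk1' : (1 : ℝ) ≤ k := by exact_mod_cast hk1
  have hk2' : (k : ℝ) ≤ n - 1 := by exact_mod_cast hk2
  have hpi := Real.pi_pos
  have hlow : Real.pi / n ≤ Real.pi * k / n := by
    gcongr
    nlinarith
  have hpn : 0 < Real.pi / n := by positivity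
  have hup : Real.pi * k / n ≤ Real.pi - Real.pi / n := by
    rw [div_le_iff₀ hn0, sub_mul, div_mul_cancel₀ _ hn0.ne']
    nlinarith
  rw [halfSide]
  rcases le_total (Real.pi * k / n) (Real.pi / 2) with h | h
  · exact Real.sin_le_sin_of_le_of_le_pi_div_two (by linarith) h hlow
  · rw [← Real.sin_pi_sub (Real.pi * k / n)]
    exact Real.sin_le_sin_of_le_of_le_pi_div_two (by linarith) (by linarith) (by linarith)

theorem halfSide_pos {n : ℕ} (hn : 3 ≤ n) : 0 < halfSide n := by
  have h3 : (3 : ℝ) ≤ n := by exact_mod_cast hn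
  apply Real.sin_pos_of_pos_of_lt_pi (by positivity)
  rw [div_lt_iff₀ (by positivity)]
  nlinarith [Real.pi_pos]

theorem apothem_pos {n : ℕ} (hn : 3 ≤ n) : 0 < apothem n := by
  have h3 : (3 : ℝ) ≤ n := by exact_mod_cast hn
  have hp : 0 < Real.pi / n := by positivity
  apply Real.cos_pos_of_mem_Ioo ⟨by linarith [Real.pi_pos], ?_⟩
  rw [div_lt_div_iff₀ (by positivity) (by positivity)]
  nlinarith [Real.pi_pos]

theorem apothem_sq_add (n : ℕ) : apothem n ^ 2 + halfSide n ^ 2 = 1 :=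
  Real.cos_sq_add_sin_sq _

theorem apothem_lt_one {n : ℕ} (hn : 3 ≤ n) : apothem n < 1 := by
  nlinarith [apothem_sq_add n, halfSide_pos hn, apothem_pos hn]

theorem abs_cos_le_apothem {n : ℕ} (hn : 3 ≤ n) {m : ℤ} (hm : ¬ (n : ℤ) ∣ m) :
    |Real.cos (Real.pi * m / n)| ≤ apothem n := by
  apply abs_le_of_sq_le_sq _ (apothem_pos hn).le
  have h1 := halfSide_le_abs_sin (by omega) hm
  have h2 := Real.cos_sq_add_sin_sq (Real.pi * m / n)
  have h3 := pow_le_pow_left₀ (halfSide_pos hn).le h1 2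
  rw [sq_abs] at h3
  linarith [apothem_sq_add n]

theorem cos_odd_le_apothem {n : ℕ} (hn : 3 ≤ n) {m : ℤ} (hm : Odd m) :
    Real.cos (Real.pi * m / n) ≤ apothem n := by
  by_cases h : (n : ℤ) ∣ m
  · obtain ⟨k, rfl⟩ := h
    obtain ⟨l, rfl⟩ := (Int.odd_mul.mp hm).2
    have hn0 : (n : ℝ) ≠ 0 := by positivity
    have : Real.pi * ((n * (2 * l + 1) : ℤ) : ℝ) / n = Real.pi + l * (2 * Real.pi) := by
      push_cast
      field_simp
      ring
    rw [this, Real.cos_add_int_mul_two_pi, Real.cos_pi]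
    linarith [apothem_pos hn]
  · exact (le_abs_self _).trans (abs_cos_le_apothem hn h)

theorem dir_intCast_eq_iff {n : ℕ} (hn : n ≠ 0) (s t : ℤ) :
    dir n s = dir n t ↔ 2 * (n : ℤ) ∣ s - t := by
  have hn0 : (n : ℝ) ≠ 0 := by exact_mod_cast hn
  constructor
  · intro h
    have h1 : Real.cos (Real.pi * (s - t : ℝ) / n) = 1 := by
      rw [← inner_dir, h, real_inner_self_eq_norm_sq, norm_dir, one_pow]
    obtain ⟨k, hk⟩ := (Real.cos_eq_one_iff _).mp h1
    refine ⟨k, ?_⟩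
    have h2 : ((s - t : ℤ) : ℝ) = ((2 * n * k : ℤ) : ℝ) := by
      push_cast
      field_simp at hk
      linarith
    exact_mod_cast h2
  · rintro ⟨k, hk⟩
    rw [← dir_add_two_mul_period hn t k]
    congr 1
    have : (s : ℝ) - t = 2 * n * k := by exact_mod_cast hk
    linarith

theorem edgeNormal_eq_iff {n : ℕ} (hn : n ≠ 0) (i j : ℤ) :
    edgeNormal n i = edgeNormal n j ↔ (n : ℤ) ∣ i - j := by
  have h := dir_intCast_eq_iff hn (2 * i + 1) (2 * j + 1)
  push_cast at h
  rw [edgeNormal, edgeNormal, h, add_sub_add_right_eq_sub, ← mul_sub]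
  exact mul_dvd_mul_iff_left two_ne_zero

/-! ### The regular polygon as an intersection of half-planes -/

theorem vertex_eq_dir (n j : ℕ) : vertex n j = dir n (2 * j) := by
  rw [vertex, dir]
  congr 1
  push_cast
  ring

theorem dir_even_mem_range_vertex {n : ℕ} (hn : n ≠ 0) (k : ℤ) :
    dir n (2 * k) ∈ Set.range (vertex n) := by
  refine ⟨(k % n).toNat, ?_⟩
  have h : ((k % n).toNat : ℤ) = k % n :=
    Int.toNat_of_nonneg (Int.emod_nonneg k (by exact_mod_cast hn))
  have h' : (((k % n).toNat : ℕ) : ℝ) = ((k % n : ℤ) : ℝ) := by exact_mod_cast h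
  have h2 : (k : ℝ) = ((k % n : ℤ) : ℝ) + n * ((k / n : ℤ) : ℝ) := by
    exact_mod_cast (Int.emod_add_mul_ediv k n).symm
  rw [vertex_eq_dir, h', h2, ← dir_add_two_mul_period hn (2 * ((k % n : ℤ) : ℝ)) (k / n)]
  congr 1
  ring

theorem dir_even_mem_regularPolygon {n : ℕ} (hn : n ≠ 0) (k : ℤ) :
    dir n (2 * k) ∈ regularPolygon n :=
  subset_convexHull ℝ _ (dir_even_mem_range_vertex hn k)

theorem convex_regularPolygon (n : ℕ) : Convex ℝ (regularPolygon n) := convex_convexHull ℝ _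

theorem zero_mem_regularPolygon {n : ℕ} (hn : 3 ≤ n) : (0 : ℂ) ∈ regularPolygon n := by
  have hprim := Complex.isPrimitiveRoot_exp n (by omega)
  have hsum := hprim.geom_sum_eq_zero (by omega)
  have hv : ∀ j, vertex n j = Complex.exp (2 * Real.pi * Complex.I / n) ^ j := by
    intro j
    rw [vertex, ← Complex.exp_nat_mul]
    congr 1
    ring
  have hn0 : (n : ℝ) ≠ 0 := by positivity
  have h := (convex_regularPolygon n).sum_mem (t := Finset.range n) (w := fun _ => (n : ℝ)⁻¹)
    (z := vertex n) (fun _ _ => by positivity) (by simp [hn0])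
    (fun i _ => subset_convexHull ℝ _ ⟨i, rfl⟩)
  rwa [← Finset.smul_sum, Finset.sum_congr rfl (fun j _ => hv j), hsum, smul_zero] at h

/-- Every vector is a non-negative combination of two neighbouring vertices. -/
theorem exists_sector {n : ℕ} (hn : 3 ≤ n) (x : ℂ) :
    ∃ (k : ℤ) (a b : ℝ), 0 ≤ a ∧ 0 ≤ b ∧
      x = a • dir n (2 * k) + b • dir n (2 * (k + 1 : ℤ)) := by
  have hn0 : (0 : ℝ) < n := by positivity
  have h3 : (3 : ℝ) ≤ n := by exact_mod_cast hn
  have hpi := Real.pi_pos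
  -- `x` points in the direction `dir n s`; the coefficients below come from the law of sines
  set s : ℝ := x.arg * n / Real.pi with hs
  set k : ℤ := ⌊s / 2⌋ with hk
  have h1 : 2 * (k : ℝ) ≤ s := by linarith [Int.floor_le (s / 2)]
  have h2 : s ≤ 2 * (k : ℝ) + 2 := by linarith [Int.lt_floor_add_one (s / 2)]
  have harg : Real.pi * s / n = x.arg := by rw [hs]; field_simp
  have hS : 0 < Real.sin (2 * Real.pi / n) := by
    apply Real.sin_pos_of_pos_of_lt_pi (by positivity)
    rw [div_lt_iff₀ hn0]
    nlinarith
  have hbound : ∀ y : ℝ, 0 ≤ y → y ≤ 2 → 0 ≤ Real.sin (Real.pi * y / n) := by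
    intro y hy0 hy2
    apply Real.sin_nonneg_of_nonneg_of_le_pi (by positivity)
    rw [div_le_iff₀ hn0]
    nlinarith
  refine ⟨k, ‖x‖ * Real.sin (Real.pi * (2 * k + 2 - s) / n) / Real.sin (2 * Real.pi / n),
    ‖x‖ * Real.sin (Real.pi * (s - 2 * k) / n) / Real.sin (2 * Real.pi / n), ?_, ?_, ?_⟩
  · exact div_nonneg (mul_nonneg (norm_nonneg _) (hbound _ (by linarith) (by linarith))) hS.le
  · exact div_nonneg (mul_nonneg (norm_nonneg _) (hbound _ (by linarith) (by linarith))) hS.le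
  · have e1 : Real.pi * (2 * k + 2 - s) / n
        = Real.pi * (2 * k) / n + 2 * Real.pi / n - x.arg := by rw [← harg]; ring
    have e2 : Real.pi * (s - 2 * k) / n = x.arg - Real.pi * (2 * k) / n := by rw [← harg]; ring
    have e3 : Real.pi * (2 * ((k + 1 : ℤ) : ℝ)) / n = Real.pi * (2 * k) / n + 2 * Real.pi / n := by
      push_cast; ring
    have hx : x = (‖x‖ : ℂ) * Complex.exp (x.arg * Complex.I) :=
      (Complex.norm_mul_exp_arg_mul_I x).symm
    set A := Real.pi * (2 * k) / n with hA
    set B := 2 * Real.pi / n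
    apply Complex.ext
    · rw [Complex.add_re, Complex.smul_re, Complex.smul_re, dir_re, dir_re, e1, e2, e3, ← hA]
      have hre : x.re = ‖x‖ * Real.cos x.arg := (Complex.norm_mul_cos_arg x).symm
      rw [hre]
      generalize x.arg = t
      rw [smul_eq_mul, smul_eq_mul, Real.cos_add, Real.sin_sub, Real.sin_sub, Real.sin_add,
        Real.cos_add]
      field_simp
      linear_combination (-‖x‖ * Real.cos t * Real.sin B) * Real.sin_sq_add_cos_sq A
    · rw [Complex.add_im, Complex.smul_im, Complex.smul_im, dir_im, dir_im, e1, e2, e3, ← hA]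
      have him : x.im = ‖x‖ * Real.sin x.arg := (Complex.norm_mul_sin_arg x).symm
      rw [him]
      generalize x.arg = t
      rw [smul_eq_mul, smul_eq_mul, Real.sin_add, Real.sin_sub, Real.sin_sub, Real.sin_add,
        Real.cos_add]
      field_simp
      linear_combination (-‖x‖ * Real.sin t * Real.sin B) * Real.sin_sq_add_cos_sq A

theorem inner_edgeNormal_dir_even {n : ℕ} (hn : 3 ≤ n) (j k : ℤ) :
    inner ℝ (edgeNormal n j) (dir n (2 * k)) ≤ apothem n := by
  rw [edgeNormal, inner_dir]
  have h := cos_odd_le_apothem hn (m := 2 * (j - k) + 1) ⟨j - k, rfl⟩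
  push_cast at h
  convert h using 3
  ring

theorem inner_edgeNormal_dir_left (n : ℕ) (k : ℤ) :
    inner ℝ (edgeNormal n k) (dir n (2 * k)) = apothem n := by
  rw [edgeNormal, inner_dir, apothem]
  congr 1
  ring

theorem inner_edgeNormal_dir_right (n : ℕ) (k : ℤ) :
    inner ℝ (edgeNormal n k) (dir n (2 * (k + 1 : ℤ))) = apothem n := by
  rw [edgeNormal, inner_dir, apothem, ← Real.cos_neg]
  congr 1
  push_cast
  ring

theorem mem_regularPolygon_iff {n : ℕ} (hn : 3 ≤ n) {x : ℂ} :
    x ∈ regularPolygon n ↔ ∀ j : ℤ, inner ℝ (edgeNormal n j) x ≤ apothem n := by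
  constructor
  · intro hx j
    have hsub : regularPolygon n ⊆ {y | inner ℝ (edgeNormal n j) y ≤ apothem n} := by
      apply convexHull_min
      · rintro _ ⟨k, rfl⟩
        have := inner_edgeNormal_dir_even hn j k
        rw [Set.mem_ofPred_eq, vertex_eq_dir]
        exact_mod_cast this
      · exact convex_halfSpace_le (innerₛₗ ℝ (edgeNormal n j)).isLinear _
    exact hsub hx
  · intro h
    obtain ⟨k, a, b, ha, hb, rfl⟩ := exists_sector hn x
    have hk := h k
    rw [inner_add_right, inner_smul_right, inner_smul_right, inner_edgeNormal_dir_left,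
      inner_edgeNormal_dir_right] at hk
    -- the defining inequality of the edge `k` says that `a + b ≤ 1`, so that `x` is in the triangle
    -- spanned by two neighbouring vertices and the centre
    have hab : a + b ≤ 1 := by nlinarith [apothem_pos hn]
    have hv : ∀ l : ℤ, dir n (2 * l) ∈ regularPolygon n :=
      dir_even_mem_regularPolygon (by omega)
    have := (convex_regularPolygon n).sum_mem (t := Finset.univ) (w := ![a, b, 1 - a - b])
      (z := ![dir n (2 * k), dir n (2 * (k + 1 : ℤ)), 0])
      (by intro i _; fin_cases i <;> simp <;> linarith)
      (by simp [Fin.sum_univ_three])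
      (by
        intro i _
        fin_cases i
        · exact hv _
        · exact hv _
        · exact zero_mem_regularPolygon hn)
    simpa [Fin.sum_univ_three] using this

/-! ### The boundary of the regular polygon -/

theorem isOpen_interior_halfPlanes (n : ℕ) :
    IsOpen {x : ℂ | ∀ j ∈ Finset.range n, inner ℝ (edgeNormal n (j : ℕ)) x < apothem n} := by
  have : {x : ℂ | ∀ j ∈ Finset.range n, inner ℝ (edgeNormal n (j : ℕ)) x < apothem n}
      = ⋂ j ∈ Finset.range n, {x : ℂ | inner ℝ (edgeNormal n (j : ℕ)) x < apothem n} := by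
    ext x; simp
  rw [this]
  refine isOpen_biInter_finset fun j _ => ?_
  exact isOpen_lt (by fun_prop) continuous_const

theorem forall_edgeNormal_iff {n : ℕ} (hn : n ≠ 0) (P : ℂ → Prop) :
    (∀ j : ℤ, P (edgeNormal n j)) ↔ ∀ j ∈ Finset.range n, P (edgeNormal n (j : ℕ)) := by
  refine ⟨fun h j _ => h j, fun h j => ?_⟩
  have h1 := Int.emod_nonneg j (b := n) (by exact_mod_cast hn)
  have h2 := Int.emod_lt_of_pos j (b := n) (by omega)
  have h3 := h (j % n).toNat (by rw [Finset.mem_range]; omega)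
  rwa [Int.toNat_of_nonneg h1, edgeNormal_emod hn] at h3

theorem mem_interior_of_inner_lt {n : ℕ} (hn : 3 ≤ n) {x : ℂ}
    (h : ∀ j : ℤ, inner ℝ (edgeNormal n j) x < apothem n) : x ∈ interior (regularPolygon n) := by
  refine mem_interior.mpr ⟨_, ?_, isOpen_interior_halfPlanes n, fun j _ => h j⟩
  intro y hy
  rw [mem_regularPolygon_iff hn]
  intro j
  exact ((forall_edgeNormal_iff (by omega) (fun e => inner ℝ e y < apothem n)).mpr hy j).le

theorem isClosed_regularPolygon {n : ℕ} (hn : 3 ≤ n) : IsClosed (regularPolygon n) := by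
  have : regularPolygon n = ⋂ j : ℤ, {x | inner ℝ (edgeNormal n j) x ≤ apothem n} := by
    ext x
    simp [mem_regularPolygon_iff hn]
  rw [this]
  exact isClosed_iInter fun j => isClosed_le (by fun_prop) continuous_const

theorem isOutwardSupport_smul_edgeNormal {n : ℕ} (hn : 3 ≤ n) {q : ℂ} {a : ℤ} {c : ℝ}
    (hc : 0 ≤ c) (hq : inner ℝ (edgeNormal n a) q = apothem n) :
    IsOutwardSupport (regularPolygon n) q (c • edgeNormal n a) := by
  intro x hx
  have := (mem_regularPolygon_iff hn).mp hx a
  rw [inner_smul_right, real_inner_comm, inner_sub_right, hq]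
  exact mul_nonpos_of_nonneg_of_nonpos hc (by linarith)

theorem mem_frontier_iff {n : ℕ} (hn : 3 ≤ n) {x : ℂ} :
    x ∈ frontier (regularPolygon n) ↔
      x ∈ regularPolygon n ∧ ∃ j : ℤ, inner ℝ (edgeNormal n j) x = apothem n := by
  rw [(isClosed_regularPolygon hn).frontier_eq, Set.mem_sdiff]
  refine and_congr_right fun hx => ⟨fun h => ?_, ?_⟩
  · by_contra! h'
    exact h (mem_interior_of_inner_lt hn fun j =>
      lt_of_le_of_ne ((mem_regularPolygon_iff hn).mp hx j) (h' j))
  · rintro ⟨j, hj⟩ hint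
    -- moving outwards along the normal stays in the polygon for a short time
    have hcont : Continuous fun ε : ℝ => x + ε • edgeNormal n j := by fun_prop
    have h0 : (fun ε : ℝ => x + ε • edgeNormal n j) ⁻¹' regularPolygon n ∈ nhds (0 : ℝ) := by
      apply hcont.continuousAt.preimage_mem_nhds
      simpa using mem_interior_iff_mem_nhds.mp hint
    obtain ⟨ε, hε, hball⟩ := Metric.mem_nhds_iff.mp h0
    have hm : ε / 2 ∈ Metric.ball (0 : ℝ) ε := by
      rw [Metric.mem_ball, Real.dist_eq, sub_zero, abs_of_pos (by linarith)]
      linarith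
    have h1 := (mem_regularPolygon_iff hn).mp (hball hm) j
    rw [inner_add_right, inner_smul_right, inner_edgeNormal_self, hj] at h1
    linarith

theorem norm_le_one_of_mem_regularPolygon {n : ℕ} {x : ℂ} (hx : x ∈ regularPolygon n) :
    ‖x‖ ≤ 1 := by
  have : regularPolygon n ⊆ Metric.closedBall 0 1 := by
    apply convexHull_min _ (convex_closedBall _ _)
    rintro _ ⟨j, rfl⟩
    simp [vertex_eq_dir, norm_dir]
  simpa using this hx

theorem mem_regularPolygon_of_norm_le {n : ℕ} (hn : 3 ≤ n) {x : ℂ} (hx : ‖x‖ ≤ apothem n) :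
    x ∈ regularPolygon n := by
  rw [mem_regularPolygon_iff hn]
  intro j
  have := real_inner_le_norm (edgeNormal n j) x
  rw [norm_edgeNormal, one_mul] at this
  linarith

/-- A line through an edge, parametrised by the signed distance from the midpoint of the edge. -/
theorem exists_eq_of_inner_edgeNormal {n : ℕ} {a : ℤ} {x : ℂ} {r : ℝ}
    (h : inner ℝ (edgeNormal n a) x = r) :
    ∃ t : ℝ, x = edgeNormal n a * (r + t * Complex.I) := by
  set e := edgeNormal n a with he
  have h1 : e.re ^ 2 + e.im ^ 2 = 1 := by
    rw [← inner_edgeNormal_self n a, inner_eq]; ring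
  rw [inner_eq] at h
  refine ⟨e.re * x.im - e.im * x.re, ?_⟩
  rw [← h]
  apply Complex.ext
  · simp
    linear_combination (-x.re) * h1
  · simp
    linear_combination (-x.im) * h1

theorem inner_edgeNormal_mul (n : ℕ) (a b : ℤ) (r t : ℝ) :
    inner ℝ (edgeNormal n a) (edgeNormal n b * (r + t * Complex.I)) =
      r * Real.cos (2 * Real.pi * (a - b) / n) + t * Real.sin (2 * Real.pi * (a - b) / n) := by
  have : 2 * Real.pi * (a - b) / n =
      Real.pi * (2 * a + 1) / n - Real.pi * (2 * b + 1) / n := by ring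
  rw [inner_eq, this, Real.cos_sub, Real.sin_sub]
  simp only [edgeNormal, Complex.mul_re, Complex.mul_im, dir_re, dir_im, Complex.add_re,
    Complex.add_im, Complex.ofReal_re, Complex.ofReal_im, Complex.I_re, Complex.I_im]
  ring

theorem inner_edgeNormal_mul_self (n : ℕ) (a : ℤ) (r t : ℝ) :
    inner ℝ (edgeNormal n a) (edgeNormal n a * (r + t * Complex.I)) = r := by
  rw [inner_edgeNormal_mul]; simp

theorem inner_edgeNormal_succ_sub (n : ℕ) (a : ℤ) (t : ℝ) :
    inner ℝ (edgeNormal n (a + 1)) (edgeNormal n a * (apothem n + t * Complex.I)) - apothem n =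
      2 * apothem n * halfSide n * (t - halfSide n) := by
  have : 2 * Real.pi * (((a + 1 : ℤ) : ℝ) - a) / n = 2 * (Real.pi / n) := by push_cast; ring
  rw [inner_edgeNormal_mul, this, Real.cos_two_mul, Real.sin_two_mul, ← apothem,
    ← halfSide]
  linear_combination (2 * apothem n) * apothem_sq_add n

theorem inner_edgeNormal_pred_sub (n : ℕ) (a : ℤ) (t : ℝ) :
    inner ℝ (edgeNormal n (a - 1)) (edgeNormal n a * (apothem n + t * Complex.I)) - apothem n =
      2 * apothem n * halfSide n * (-t - halfSide n) := by
  have : 2 * Real.pi * (((a - 1 : ℤ) : ℝ) - a) / n = -(2 * (Real.pi / n)) := by push_cast; ring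
  rw [inner_edgeNormal_mul, this, Real.cos_neg, Real.sin_neg, Real.cos_two_mul, Real.sin_two_mul,
    ← apothem, ← halfSide]
  linear_combination (2 * apothem n) * apothem_sq_add n

theorem abs_le_of_mem_regularPolygon {n : ℕ} (hn : 3 ≤ n) {a : ℤ} {t : ℝ}
    (h : edgeNormal n a * (apothem n + t * Complex.I) ∈ regularPolygon n) :
    |t| ≤ halfSide n := by
  rw [mem_regularPolygon_iff hn] at h
  have hpos : 0 < 2 * apothem n * halfSide n := by
    have := apothem_pos hn
    have := halfSide_pos hn
    positivity
  have h1 := sub_nonpos.mpr (h (a + 1))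
  have h2 := sub_nonpos.mpr (h (a - 1))
  rw [inner_edgeNormal_succ_sub] at h1
  rw [inner_edgeNormal_pred_sub] at h2
  rw [abs_le]
  constructor
  · nlinarith [nonpos_of_mul_nonpos_right h2 hpos]
  · nlinarith [nonpos_of_mul_nonpos_right h1 hpos]

theorem edge_left_eq (n : ℕ) (j : ℤ) :
    dir n (2 * j) = edgeNormal n j * (apothem n + (-halfSide n : ℝ) * Complex.I) := by
  have h : dir n (-1) = apothem n + (-halfSide n : ℝ) * Complex.I := by
    apply Complex.ext
    · rw [dir_re]
      simp [apothem, neg_div, -Complex.ofReal_cos]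
    · rw [dir_im]
      simp [halfSide, neg_div, -Complex.ofReal_sin]
  rw [← h, edgeNormal, ← dir_add]
  congr 1
  ring

theorem edge_right_eq (n : ℕ) (j : ℤ) :
    dir n (2 * (j + 1 : ℤ)) =
      edgeNormal n j * (apothem n + (halfSide n : ℝ) * Complex.I) := by
  have h : dir n 1 = apothem n + (halfSide n : ℝ) * Complex.I := by
    apply Complex.ext
    · rw [dir_re]
      simp [apothem, -Complex.ofReal_cos]
    · rw [dir_im]
      simp [halfSide, -Complex.ofReal_sin]
  rw [← h, edgeNormal, ← dir_add]
  congr 1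
  push_cast
  ring

theorem vertex_eq_edge_left (n j : ℕ) : vertex n j =
    edgeNormal n j * (apothem n + (-halfSide n : ℝ) * Complex.I) := by
  rw [vertex_eq_dir, ← edge_left_eq]
  simp

theorem vertex_succ_eq_edge_right (n j : ℕ) : vertex n (j + 1) =
    edgeNormal n j * (apothem n + (halfSide n : ℝ) * Complex.I) := by
  rw [vertex_eq_dir, ← edge_right_eq]
  simp

theorem vertex_mem_regularPolygon (n j : ℕ) : vertex n j ∈ regularPolygon n :=
  subset_convexHull ℝ _ ⟨j, rfl⟩

theorem edgeMidpoint_eq (n j : ℕ) : edgeMidpoint n j = apothem n • edgeNormal n j := by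
  rw [edgeMidpoint, midpoint_eq_smul_add, vertex_eq_edge_left, vertex_succ_eq_edge_right]
  simp only [Complex.real_smul, invOf_eq_inv]
  push_cast
  ring

theorem inner_edgeNormal_edgeMidpoint (n j : ℕ) :
    inner ℝ (edgeNormal n j) (edgeMidpoint n j) = apothem n := by
  rw [edgeMidpoint_eq, inner_smul_right, inner_edgeNormal_self, mul_one]

theorem edgeMidpoint_mem_regularPolygon {n : ℕ} (hn : 3 ≤ n) (j : ℕ) :
    edgeMidpoint n j ∈ regularPolygon n := by
  apply mem_regularPolygon_of_norm_le hn
  rw [edgeMidpoint_eq, norm_smul, norm_edgeNormal, mul_one, Real.norm_of_nonneg (apothem_pos hn).le]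

theorem mem_edge_iff {n : ℕ} (hn : 3 ≤ n) {j : ℕ} {x : ℂ} :
    x ∈ edge n j ↔ x ∈ regularPolygon n ∧ inner ℝ (edgeNormal n j) x = apothem n := by
  constructor
  · intro hx
    refine ⟨(convex_regularPolygon n).segment_subset (vertex_mem_regularPolygon n _)
      (vertex_mem_regularPolygon n _) hx, ?_⟩
    obtain ⟨a, b, ha, hb, hab, rfl⟩ := hx
    rw [inner_add_right, inner_smul_right, inner_smul_right, vertex_eq_edge_left,
      vertex_succ_eq_edge_right, inner_edgeNormal_mul_self, inner_edgeNormal_mul_self, ← add_mul,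
      hab, one_mul]
  · rintro ⟨hx, hj⟩
    obtain ⟨t, rfl⟩ := exists_eq_of_inner_edgeNormal hj
    have ht := abs_le.mp (abs_le_of_mem_regularPolygon hn hx)
    have hs := halfSide_pos hn
    set s := halfSide n
    refine ⟨(s - t) / (2 * s), (s + t) / (2 * s), div_nonneg (by linarith) (by linarith),
      div_nonneg (by linarith) (by linarith), by field_simp; ring, ?_⟩
    rw [vertex_eq_edge_left, vertex_succ_eq_edge_right]
    have hs' : (s : ℂ) ≠ 0 := by exact_mod_cast hs.ne'
    simp only [Complex.real_smul]
    push_cast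
    field_simp
    ring

/-! ### Smooth boundary points -/

theorem IsSmoothPoint.edgeNormal_eq {n : ℕ} (hn : 3 ≤ n) {q : ℂ}
    (h : IsSmoothPoint (regularPolygon n) q) {a b : ℤ}
    (ha : inner ℝ (edgeNormal n a) q = apothem n) (hb : inner ℝ (edgeNormal n b) q = apothem n) :
    edgeNormal n a = edgeNormal n b := by
  refine h.2.unique ⟨norm_edgeNormal n a, ?_⟩ ⟨norm_edgeNormal n b, ?_⟩
  · simpa using isOutwardSupport_smul_edgeNormal hn zero_le_one ha
  · simpa using isOutwardSupport_smul_edgeNormal hn zero_le_one hb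

theorem IsSmoothPoint.exists_smul {n : ℕ} (hn : 3 ≤ n) {q ν : ℂ}
    (h : IsSmoothPoint (regularPolygon n) q) {a : ℤ}
    (ha : inner ℝ (edgeNormal n a) q = apothem n)
    (hν : IsOutwardSupport (regularPolygon n) q ν) :
    ∃ c : ℝ, 0 ≤ c ∧ ν = c • edgeNormal n a := by
  by_cases h0 : ν = 0
  · exact ⟨0, le_rfl, by simp [h0]⟩
  have hpos : 0 < ‖ν‖ := norm_pos_iff.mpr h0
  refine ⟨‖ν‖, hpos.le, ?_⟩
  have h1 : ‖ν‖⁻¹ • ν = edgeNormal n a := by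
    refine h.2.unique ⟨?_, fun x hx => ?_⟩ ⟨norm_edgeNormal n a, ?_⟩
    · rw [norm_smul, norm_inv, norm_norm, inv_mul_cancel₀ hpos.ne']
    · rw [inner_smul_right]
      exact mul_nonpos_of_nonneg_of_nonpos (by positivity) (hν x hx)
    · simpa using isOutwardSupport_smul_edgeNormal hn zero_le_one ha
  rw [← h1, smul_smul, mul_inv_cancel₀ hpos.ne', one_smul]

theorem IsSmoothPoint.abs_lt {n : ℕ} (hn : 3 ≤ n) {a : ℤ} {t : ℝ}
    (h : IsSmoothPoint (regularPolygon n) (edgeNormal n a * (apothem n + t * Complex.I))) :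
    |t| < halfSide n := by
  have hmem := ((mem_frontier_iff hn).mp h.1).1
  refine lt_of_le_of_ne (abs_le_of_mem_regularPolygon hn hmem) fun heq => ?_
  have hne : ∀ b : ℤ, ¬ (n : ℤ) ∣ a - b →
      inner ℝ (edgeNormal n b) (edgeNormal n a * (apothem n + t * Complex.I)) ≠ apothem n := by
    intro b hb hb'
    exact hb ((edgeNormal_eq_iff (by omega) a b).mp
      (h.edgeNormal_eq hn (inner_edgeNormal_mul_self n a _ _) hb'))
  have hdvd : ∀ c : ℤ, c = 1 ∨ c = -1 → ¬ (n : ℤ) ∣ c := by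
    intro c hc hd
    have : (n : ℤ) ∣ 1 := by rcases hc with rfl | rfl <;> simpa using hd
    have := Int.le_of_dvd one_pos this
    omega
  rcases abs_choice t with h' | h'
  · apply hne (a + 1) (hdvd _ (by right; ring))
    rw [← sub_eq_zero, inner_edgeNormal_succ_sub, ← heq, h', sub_self, mul_zero]
  · apply hne (a - 1) (hdvd _ (by left; ring))
    rw [← sub_eq_zero, inner_edgeNormal_pred_sub, ← heq, h', sub_self, mul_zero]

theorem isSmoothPoint_edgeMidpoint {n : ℕ} (hn : 3 ≤ n) (j : ℕ) :
    IsSmoothPoint (regularPolygon n) (edgeMidpoint n j) := by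
  have hj := inner_edgeNormal_edgeMidpoint n j
  refine ⟨(mem_frontier_iff hn).mpr ⟨edgeMidpoint_mem_regularPolygon hn j, j, hj⟩,
    edgeNormal n j, ⟨norm_edgeNormal n j, ?_⟩, ?_⟩
  · simpa using isOutwardSupport_smul_edgeNormal hn zero_le_one hj
  · rintro ν ⟨hν1, hν⟩
    have hs := halfSide_pos hn
    have hr := apothem_pos hn
    have h0 := hν 0 (zero_mem_regularPolygon hn)
    have h1 := hν _ (vertex_mem_regularPolygon n j)
    have h2 := hν _ (vertex_mem_regularPolygon n (j + 1))
    rw [vertex_eq_edge_left] at h1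
    rw [vertex_succ_eq_edge_right] at h2
    have he := inner_edgeNormal_self n j
    have hν2 : inner ℝ ν ν = 1 := by rw [real_inner_self_eq_norm_sq, hν1, one_pow]
    rw [edgeMidpoint_eq] at h0 h1 h2
    set e := edgeNormal n j
    rw [inner_eq] at h0 h1 h2 he hν2
    simp at h0 h1 h2
    -- `ν` has no tangential component and a non-negative normal component
    have ht : e.re * ν.im - e.im * ν.re = 0 := by
      have h3 : 0 ≤ e.re * ν.im - e.im * ν.re := by
        by_contra! hc
        nlinarith
      have h4 : e.re * ν.im - e.im * ν.re ≤ 0 := by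
        by_contra! hc
        nlinarith
      linarith
    have hc : 0 ≤ e.re * ν.re + e.im * ν.im := by
      by_contra! hc
      nlinarith
    have hsq : (e.re * ν.re + e.im * ν.im) ^ 2 = 1 := by
      linear_combination (e.re * e.re + e.im * e.im) * hν2 + he
        - (e.re * ν.im - e.im * ν.re) * ht
    have hc1 : e.re * ν.re + e.im * ν.im = 1 := by nlinarith
    apply Complex.ext
    · linear_combination e.re * hc1 - e.im * ht - ν.re * he
    · linear_combination e.im * hc1 + e.re * ht - ν.im * he

/-! ### Moving a boundary point inwards -/

/-- A direction that points strictly inwards at every edge through `q` has a negative component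
along every non-zero outward support vector at `q`. -/
theorem inner_neg_of_isOutwardSupport {n : ℕ} (hn : 3 ≤ n) {q ν d : ℂ}
    (hq : q ∈ regularPolygon n) (hν : IsOutwardSupport (regularPolygon n) q ν) (hν0 : ν ≠ 0)
    (hd : ∀ j : ℤ, inner ℝ (edgeNormal n j) q = apothem n → inner ℝ (edgeNormal n j) d < 0) :
    inner ℝ d ν < 0 := by
  rw [mem_regularPolygon_iff hn] at hq
  -- a short step in the direction `d` leads to an interior point, from which a further short step
  -- in the direction `ν` stays in the polygon
  have hev : ∀ᶠ ε : ℝ in nhdsWithin 0 (Set.Ioi 0), ∀ j ∈ Finset.range n,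
      inner ℝ (edgeNormal n (j : ℕ)) (q + ε • d) < apothem n := by
    rw [Filter.eventually_all_finset]
    intro j _
    rcases (hq j).lt_or_eq with h | h
    · have hcont : Continuous fun ε : ℝ => inner ℝ (edgeNormal n (j : ℕ)) (q + ε • d) := by
        fun_prop
      refine nhdsWithin_le_nhds (hcont.continuousAt.eventually_lt continuousAt_const ?_)
      simpa using h
    · filter_upwards [self_mem_nhdsWithin] with ε hε
      rw [inner_add_right, inner_smul_right, h]
      have := mul_neg_of_pos_of_neg (Set.mem_Ioi.mp hε) (hd j h)
      linarith
  obtain ⟨ε, hε, hε0⟩ := (hev.and self_mem_nhdsWithin).exists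
  replace hε0 : 0 < ε := hε0
  have hint : q + ε • d ∈ interior (regularPolygon n) :=
    mem_interior_of_inner_lt hn fun j =>
      (forall_edgeNormal_iff (by omega) (fun e => inner ℝ e (q + ε • d) < apothem n)).mpr hε j
  have hcont : Continuous fun δ : ℝ => q + ε • d + δ • ν := by fun_prop
  have h0 : (fun δ : ℝ => q + ε • d + δ • ν) ⁻¹' regularPolygon n ∈ nhds (0 : ℝ) := by
    apply hcont.continuousAt.preimage_mem_nhds
    simpa using mem_interior_iff_mem_nhds.mp hint
  obtain ⟨η, hη, hball⟩ := Metric.mem_nhds_iff.mp h0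
  have hm : η / 2 ∈ Metric.ball (0 : ℝ) η := by
    rw [Metric.mem_ball, Real.dist_eq, sub_zero, abs_of_pos (by linarith)]
    linarith
  have h1 := hν _ (hball hm)
  have h2 : q + ε • d + (η / 2) • ν - q = ε • d + (η / 2) • ν := by abel
  rw [h2, inner_add_left, inner_smul_left, inner_smul_left, real_inner_self_eq_norm_sq] at h1
  have h3 : 0 < ‖ν‖ ^ 2 := by have := norm_pos_iff.mpr hν0; positivity
  simp only [conj_trivial] at h1
  by_contra! h4
  nlinarith [mul_nonneg hε0.le h4, mul_pos hη h3]

/-! ### Paths along a sequence of points -/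

section Paths

variable {E : Type*} [NormedAddCommGroup E]

theorem segment_union_segment [InnerProductSpace ℝ E] {x y z : E} (h : y ∈ segment ℝ x z) :
    segment ℝ x y ∪ segment ℝ y z = segment ℝ x z := by
  apply Set.Subset.antisymm
  · exact Set.union_subset ((convex_segment x z).segment_subset (left_mem_segment ℝ x z) h)
      ((convex_segment x z).segment_subset h (right_mem_segment ℝ x z))
  · rw [segment_eq_image_lineMap] at h
    obtain ⟨s, ⟨hs0, hs1⟩, rfl⟩ := h
    intro w hw
    rw [segment_eq_image_lineMap] at hw
    obtain ⟨t, ⟨ht0, ht1⟩, rfl⟩ := hw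
    have key : ∀ a b c : ℝ, b ∈ segment ℝ a c →
        AffineMap.lineMap x z b ∈
          segment ℝ (AffineMap.lineMap x z a : E) (AffineMap.lineMap x z c) := by
      intro a b c hb
      rw [← image_segment]
      exact ⟨b, hb, rfl⟩
    rcases le_total t s with hts | hts
    · left
      have := key 0 t s (by rw [segment_eq_Icc hs0]; exact ⟨ht0, hts⟩)
      simpa using this
    · right
      have := key s t 1 (by rw [segment_eq_Icc hs1]; exact ⟨hts, ht1⟩)
      simpa using this

/-- The length of the polygonal path with vertices `q i, q (i + 1), …, q (i + k)`. -/
noncomputable def pathLength (q : ℤ → E) (i : ℤ) (k : ℕ) : ℝ :=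
  ∑ l ∈ Finset.range k, ‖q (i + l + 1) - q (i + l)‖

/-- The union of the edges of the polygonal path with vertices `q i, q (i + 1), …, q (i + k)`. -/
def pathTrace [InnerProductSpace ℝ E] (q : ℤ → E) (i : ℤ) (k : ℕ) : Set E :=
  ⋃ l < k, segment ℝ (q (i + (l : ℕ))) (q (i + (l : ℕ) + 1))

theorem pathLength_succ (q : ℤ → E) (i : ℤ) (k : ℕ) :
    pathLength q i (k + 1) = pathLength q i k + ‖q (i + k + 1) - q (i + k)‖ :=
  Finset.sum_range_succ _ _

theorem pathLength_add (q : ℤ → E) (i : ℤ) (k l : ℕ) :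
    pathLength q i (k + l) = pathLength q i k + pathLength q (i + k) l := by
  rw [pathLength, Finset.sum_range_add]
  congr 1
  refine Finset.sum_congr rfl fun x _ => ?_
  push_cast
  rw [add_assoc i k x]

theorem pathTrace_succ [InnerProductSpace ℝ E] (q : ℤ → E) (i : ℤ) (k : ℕ) :
    pathTrace q i (k + 1) = pathTrace q i k ∪ segment ℝ (q (i + k)) (q (i + k + 1)) :=
  Set.biUnion_lt_succ (fun l => segment ℝ (q (i + (l : ℕ))) (q (i + (l : ℕ) + 1))) k

theorem mem_pathTrace [InnerProductSpace ℝ E] {q : ℤ → E} {i : ℤ} {k : ℕ} {x : E} :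
    x ∈ pathTrace q i k ↔ ∃ l < k, x ∈ segment ℝ (q (i + (l : ℕ))) (q (i + (l : ℕ) + 1)) := by
  simp [pathTrace]

theorem norm_sub_le_pathLength (q : ℤ → E) (i : ℤ) (k : ℕ) :
    ‖q (i + k) - q i‖ ≤ pathLength q i k := by
  induction k with
  | zero => simp [pathLength]
  | succ k ih =>
    rw [pathLength_succ]
    push_cast
    rw [← add_assoc]
    have := norm_sub_le_norm_sub_add_norm_sub (q (i + k + 1)) (q (i + k)) (q i)
    linarith

/-- A path that is as short as possible runs along the segment between its endpoints. -/
theorem pathTrace_eq_segment [InnerProductSpace ℝ E] {q : ℤ → E} {i : ℤ} {k : ℕ}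
    (h : pathLength q i k = ‖q (i + k) - q i‖) :
    {q i} ∪ pathTrace q i k = segment ℝ (q i) (q (i + k)) := by
  induction k with
  | zero => simp [pathTrace]
  | succ k ih =>
    rw [pathLength_succ] at h
    push_cast at h ⊢
    rw [← add_assoc] at h ⊢
    have h1 := norm_sub_le_norm_sub_add_norm_sub (q (i + k + 1)) (q (i + k)) (q i)
    have h2 := norm_sub_le_pathLength q i k
    have hmem : q (i + k) ∈ segment ℝ (q i) (q (i + k + 1)) := by
      rw [mem_segment_iff_wbtw, ← dist_add_dist_eq_iff, dist_comm (q i) (q (i + k)),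
        dist_comm (q (i + k)) (q (i + k + 1)), dist_comm (q i) (q (i + k + 1)), dist_eq_norm,
        dist_eq_norm, dist_eq_norm]
      linarith
    rw [pathTrace_succ, ← Set.union_assoc, ih (by linarith), segment_union_segment hmem]

theorem pathLength_eq_of_periodic {q : ℤ → E} {m : ℕ} (hq : ∀ i : ℤ, q (i + m) = q i) (i : ℤ) :
    pathLength q i m = pathLength q 0 m := by
  have step : ∀ j : ℤ, pathLength q (j + 1) m = pathLength q j m := by
    intro j
    have h1 := pathLength_add q j 1 m
    have h2 := pathLength_succ q j m
    rw [add_comm 1 m, h2, add_right_comm j (m : ℤ) 1, hq, hq] at h1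
    simp only [pathLength, Finset.sum_range_one] at h1 ⊢
    push_cast at h1
    simp only [add_zero] at h1
    linarith
  induction i with
  | zero => rfl
  | succ i ih => rw [step, ih]
  | pred i ih => rw [← ih, ← step, sub_add_cancel]

theorem periodic_int {α : Type*} {q : ℤ → α} {m : ℕ} (hq : ∀ i : ℤ, q (i + m) = q i) (i k : ℤ) :
    q (i + m * k) = q i := by
  induction k with
  | zero => simp
  | succ k ih => rw [mul_add, mul_one, ← add_assoc, hq, ih]
  | pred k ih => rw [← ih, ← hq (i + m * (-(k : ℤ) - 1))]; congr 1; ring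

theorem periodic_emod {α : Type*} {q : ℤ → α} {m : ℕ} (hq : ∀ i : ℤ, q (i + m) = q i) (i : ℤ) :
    q (i % m) = q i := by
  rw [← periodic_int hq (i % m) (i / m), Int.emod_add_mul_ediv]

theorem pathTrace_eq_trace [InnerProductSpace ℝ E] {q : ℤ → E} {m : ℕ} (hm : m ≠ 0)
    (hq : ∀ i : ℤ, q (i + m) = q i)
    (i : ℤ) : pathTrace q i m = trace q := by
  ext x
  rw [mem_pathTrace, trace, Set.mem_iUnion]
  constructor
  · rintro ⟨l, _, hl⟩
    exact ⟨_, hl⟩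
  · rintro ⟨j, hj⟩
    have h1 := Int.emod_nonneg (j - i) (b := m) (by exact_mod_cast hm)
    have h2 := Int.emod_lt_of_pos (j - i) (b := m) (by omega)
    refine ⟨((j - i) % m).toNat, by omega, ?_⟩
    rw [Int.toNat_of_nonneg h1]
    have h3 : j = i + (j - i) % m + m * ((j - i) / m) := by
      have := Int.emod_add_mul_ediv (j - i) m
      linarith
    have h4 : q j = q (i + (j - i) % m) := by
      conv_lhs => rw [h3]
      exact periodic_int hq _ _
    have h5 : q (j + 1) = q (i + (j - i) % m + 1) := by
      conv_lhs => rw [h3, add_right_comm]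
      exact periodic_int hq _ _
    rwa [← h4, ← h5]

/-- The perimeter of the triangle `x y z`. -/
noncomputable def perimeter (x y z : E) : ℝ := ‖y - x‖ + ‖z - y‖ + ‖x - z‖

/-- The boundary of the triangle `x y z`. -/
def triangleTrace [InnerProductSpace ℝ E] (x y z : E) : Set E :=
    segment ℝ x y ∪ segment ℝ y z ∪ segment ℝ z x

theorem perimeter_rotate (x y z : E) : perimeter y z x = perimeter x y z := by
  unfold perimeter; ring

theorem perimeter_swap (x y z : E) : perimeter y x z = perimeter x y z := by
  rw [perimeter, perimeter, norm_sub_rev x y, norm_sub_rev z x, norm_sub_rev y z]; ring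

theorem triangleTrace_rotate [InnerProductSpace ℝ E] (x y z : E) :
    triangleTrace y z x = triangleTrace x y z := by
  unfold triangleTrace
  ext w
  simp only [Set.mem_union]
  tauto

theorem triangleTrace_swap [InnerProductSpace ℝ E] (x y z : E) :
    triangleTrace y x z = triangleTrace x y z := by
  unfold triangleTrace
  rw [segment_symm ℝ y x, segment_symm ℝ x z, segment_symm ℝ z y]
  ext w
  simp only [Set.mem_union]
  tauto

/-- The case of `perimeter_le_pathLength` in which the three vertices are in order within one
period: the closed path is cut into three arcs. -/
theorem perimeter_le_pathLength_of_le [InnerProductSpace ℝ E] {q : ℤ → E} {m : ℕ} (hm : m ≠ 0)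
    (hq : ∀ i : ℤ, q (i + m) = q i) {i j k : ℤ} (hij : i ≤ j) (hjk : j ≤ k) (hki : k ≤ i + m) :
    perimeter (q i) (q j) (q k) ≤ pathLength q 0 m ∧
      (pathLength q 0 m = perimeter (q i) (q j) (q k) →
        trace q = triangleTrace (q i) (q j) (q k)) := by
  obtain ⟨a, rfl⟩ := Int.le.dest hij
  obtain ⟨b, rfl⟩ := Int.le.dest hjk
  obtain ⟨c, hc⟩ := Int.le.dest hki
  have hm' : m = a + b + c := by omega
  have e1 := norm_sub_le_pathLength q i a
  have e2 := norm_sub_le_pathLength q (i + a) b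
  have e3 := norm_sub_le_pathLength q (i + a + b) c
  have hL : pathLength q 0 m = pathLength q i a + pathLength q (i + a) b
      + pathLength q (i + a + b) c := by
    rw [← pathLength_eq_of_periodic hq i, hm', pathLength_add, pathLength_add]
    push_cast
    rw [add_assoc i]
  rw [hc, hq] at e3
  refine ⟨by unfold perimeter; linarith, fun h => ?_⟩
  unfold perimeter at h
  have t1 := pathTrace_eq_segment (q := q) (i := i) (k := a) (by linarith)
  have t2 := pathTrace_eq_segment (q := q) (i := i + a) (k := b) (by linarith)
  have t3 := pathTrace_eq_segment (q := q) (i := i + a + b) (k := c) (by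
    rw [hc, hq]; linarith)
  rw [hc, hq] at t3
  have hmem : ∀ l : ℤ, q l ∈ trace q := fun l =>
    Set.mem_iUnion.mpr ⟨l, left_mem_segment ℝ _ _⟩
  have hsub : ∀ (l : ℤ) (k : ℕ), pathTrace q l k ⊆ trace q := by
    intro l k x hx
    obtain ⟨p, _, hp⟩ := mem_pathTrace.mp hx
    exact Set.mem_iUnion.mpr ⟨_, hp⟩
  rw [triangleTrace, ← t1, ← t2, ← t3]
  apply Set.Subset.antisymm
  · rw [← pathTrace_eq_trace hm hq i]
    intro x hx
    obtain ⟨l, hl, hx⟩ := mem_pathTrace.mp hx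
    rcases lt_or_ge l a with h1 | h1
    · exact Or.inl (Or.inl (Or.inr (mem_pathTrace.mpr ⟨l, h1, hx⟩)))
    · obtain ⟨l, rfl⟩ := Nat.exists_eq_add_of_le h1
      push_cast at hx
      rw [← add_assoc] at hx
      rcases lt_or_ge l b with h2 | h2
      · exact Or.inl (Or.inr (Or.inr (mem_pathTrace.mpr ⟨l, h2, hx⟩)))
      · obtain ⟨l, rfl⟩ := Nat.exists_eq_add_of_le h2
        push_cast at hx
        rw [← add_assoc] at hx
        exact Or.inr (Or.inr (mem_pathTrace.mpr ⟨l, by omega, hx⟩))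
  · simp only [Set.union_subset_iff, Set.singleton_subset_iff]
    exact ⟨⟨⟨hmem _, hsub _ _⟩, hmem _, hsub _ _⟩, hmem _, hsub _ _⟩

/-- A closed polygon is at least as long as the triangle spanned by any three of its vertices;
in case of equality it runs along the sides of that triangle. -/
theorem perimeter_le_pathLength [InnerProductSpace ℝ E] {q : ℤ → E} {m : ℕ} (hm : m ≠ 0)
    (hq : ∀ i : ℤ, q (i + m) = q i) (i j k : ℤ) :
    perimeter (q i) (q j) (q k) ≤ pathLength q 0 m ∧
      (pathLength q 0 m = perimeter (q i) (q j) (q k) →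
        trace q = triangleTrace (q i) (q j) (q k)) := by
  have hb : ∀ l : ℤ, 0 ≤ l % m ∧ l % m < m := fun l =>
    ⟨Int.emod_nonneg l (by exact_mod_cast hm), Int.emod_lt_of_pos l (by omega)⟩
  rw [← periodic_emod hq i, ← periodic_emod hq j, ← periodic_emod hq k]
  obtain ⟨hi0, him⟩ := hb i
  obtain ⟨hj0, hjm⟩ := hb j
  obtain ⟨hk0, hkm⟩ := hb k
  generalize i % m = i at *
  generalize j % m = j at *
  generalize k % m = k at *
  have main : ∀ i j k : ℤ, 0 ≤ i → k < m → i ≤ j → j ≤ k →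
      perimeter (q i) (q j) (q k) ≤ pathLength q 0 m ∧
      (pathLength q 0 m = perimeter (q i) (q j) (q k) →
        trace q = triangleTrace (q i) (q j) (q k)) := fun i j k h1 h2 h3 h4 =>
    perimeter_le_pathLength_of_le hm hq h3 h4 (by omega)
  rcases le_total i j with h1 | h1 <;> rcases le_total j k with h2 | h2 <;>
    rcases le_total i k with h3 | h3
  · exact main i j k hi0 hkm h1 h2
  · exact main i j k hi0 hkm h1 h2
  · have := main i k j hi0 hjm h3 h2
    rwa [← perimeter_rotate, ← triangleTrace_rotate, perimeter_swap, triangleTrace_swap,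
      perimeter_rotate, triangleTrace_rotate] at this
  · have := main k i j hk0 hjm h3 h1
    rwa [← perimeter_rotate, ← triangleTrace_rotate] at this
  · have := main j i k hj0 hkm h1 h3
    rwa [perimeter_swap, triangleTrace_swap] at this
  · have := main j k i hj0 him h2 h3
    rwa [perimeter_rotate, triangleTrace_rotate] at this
  · have := main k j i hk0 him h2 h1
    rwa [← perimeter_swap, ← triangleTrace_swap, perimeter_rotate, triangleTrace_rotate] at this
  · have := main k j i hk0 him h2 h1
    rwa [← perimeter_swap, ← triangleTrace_swap, perimeter_rotate, triangleTrace_rotate] at this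

/-! ### Closed billiard orbits -/

/-- The unit vector pointing from `q i` to `q (i + 1)`. -/
noncomputable def direction [InnerProductSpace ℝ E] (q : ℤ → E) (i : ℤ) : E :=
  ‖q (i + 1) - q i‖⁻¹ • (q (i + 1) - q i)

theorem norm_direction [InnerProductSpace ℝ E] {q : ℤ → E} {i : ℤ} (h : q i ≠ q (i + 1)) :
    ‖direction q i‖ = 1 := by
  have : ‖q (i + 1) - q i‖ ≠ 0 := norm_ne_zero_iff.mpr (sub_ne_zero.mpr h.symm)
  rw [direction, norm_smul, norm_inv, norm_norm, inv_mul_cancel₀ this]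

theorem norm_smul_direction [InnerProductSpace ℝ E] {q : ℤ → E} {i : ℤ} (h : q i ≠ q (i + 1)) :
    ‖q (i + 1) - q i‖ • direction q i = q (i + 1) - q i := by
  have : ‖q (i + 1) - q i‖ ≠ 0 := norm_ne_zero_iff.mpr (sub_ne_zero.mpr h.symm)
  rw [direction, smul_smul, mul_inv_cancel₀ this, one_smul]

theorem bounceVector_eq [InnerProductSpace ℝ E] (q : ℤ → E) (i : ℤ) :
    bounceVector q i = direction q (i - 1) - direction q i := by
  rw [bounceVector, direction, direction, sub_add_cancel, ← neg_sub (q i) (q (i + 1)), smul_neg,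
    norm_neg, sub_neg_eq_add]

theorem sum_range_shift {M : Type*} [AddCommGroup M] {f : ℤ → M} {m : ℕ} (hf : f m = f 0) :
    ∑ i ∈ Finset.range m, f ((i : ℤ) + 1) = ∑ i ∈ Finset.range m, f (i : ℤ) := by
  have := Finset.sum_range_sub (fun i : ℕ => f (i : ℤ)) m
  simp only [Nat.cast_add, Nat.cast_one, Nat.cast_zero] at this
  rw [← sub_eq_zero, ← Finset.sum_sub_distrib, this, hf, sub_self]

theorem direction_add_period [InnerProductSpace ℝ E] {q : ℤ → E} {m : ℕ}
    (hq : ∀ i : ℤ, q (i + m) = q i) (i : ℤ) :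
    direction q (i + m) = direction q i := by
  rw [direction, direction, add_right_comm, hq, hq]

theorem sum_bounceVector [InnerProductSpace ℝ E] {q : ℤ → E} {m : ℕ}
    (hq : ∀ i : ℤ, q (i + m) = q i) :
    ∑ i ∈ Finset.range m, bounceVector q i = 0 := by
  have h := sum_range_shift (f := fun i => direction q (i - 1)) (m := m) (by
    have := direction_add_period hq (-1)
    simpa [add_comm, sub_eq_add_neg] using this)
  simp only [add_sub_cancel_right] at h
  simp only [bounceVector_eq, Finset.sum_sub_distrib]
  rw [h, sub_self]

/-- The length of a closed orbit, by summation by parts. -/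
theorem sum_inner_bounceVector [InnerProductSpace ℝ E] {q : ℤ → E} {m : ℕ}
    (hq : ∀ i : ℤ, q (i + m) = q i)
    (hne : ∀ i, q i ≠ q (i + 1)) :
    ∑ i ∈ Finset.range m, inner ℝ (bounceVector q i) (q i) = pathLength q 0 m := by
  have h := sum_range_shift (f := fun i => inner ℝ (direction q (i - 1)) (q i)) (m := m) (by
    have h1 := direction_add_period hq (-1)
    have h2 := hq 0
    rw [zero_add] at h2
    simp only [h2, zero_sub]
    rw [← h1, neg_add_eq_sub])
  simp only [add_sub_cancel_right] at h
  simp only [bounceVector_eq, inner_sub_left, Finset.sum_sub_distrib]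
  rw [← h, ← Finset.sum_sub_distrib, pathLength]
  refine Finset.sum_congr rfl fun i _ => ?_
  rw [← inner_sub_right, zero_add]
  have hn := norm_direction (hne i)
  conv_lhs => rw [← norm_smul_direction (hne i)]
  rw [inner_smul_right, real_inner_self_eq_norm_sq, hn, one_pow, mul_one]

theorem bounceNumber_mem_periods {α : Type*} {q : ℤ → α} (h : (periods q).Nonempty) :
    bounceNumber q ∈ periods q := Nat.sInf_mem h

theorem orbitLength_eq_pathLength (q : ℤ → E) :
    orbitLength q = pathLength q 0 (bounceNumber q) := by
  simp [orbitLength, pathLength]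

theorem perimeter_le_orbitLength [InnerProductSpace ℝ E] {q : ℤ → E} (h : (periods q).Nonempty)
    (i j k : ℤ) :
    perimeter (q i) (q j) (q k) ≤ orbitLength q ∧
      (orbitLength q = perimeter (q i) (q j) (q k) →
        trace q = triangleTrace (q i) (q j) (q k)) := by
  obtain ⟨h2, hper⟩ := bounceNumber_mem_periods h
  rw [orbitLength_eq_pathLength]
  exact perimeter_le_pathLength (by omega) hper i j k

end Paths

/-! ### The edges met by a closed orbit -/

/-- The outward normals of the edges that contain a bounce point of `q`. -/
def touchedNormals (n : ℕ) (q : ℤ → ℂ) : Set ℂ :=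
  {e | ∃ a : ℤ, e = edgeNormal n a ∧ ∃ i : ℤ, inner ℝ (edgeNormal n a) (q i) = apothem n}

theorem finite_touchedNormals {n : ℕ} (hn : n ≠ 0) (q : ℤ → ℂ) : (touchedNormals n q).Finite := by
  refine Set.Finite.subset ((Finset.range n).finite_toSet.image fun j : ℕ => edgeNormal n j) ?_
  rintro _ ⟨a, rfl, _⟩
  exact (forall_edgeNormal_iff hn (fun e => e ∈ (fun j : ℕ => edgeNormal n j) ''
    (Finset.range n : Set ℕ))).mpr (fun j hj => ⟨j, hj, rfl⟩) a

/-- The bounce points of a closed orbit cannot be moved into the interior of the polygon by a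
common translation: otherwise the bounce vectors, whose sum is zero, would all have non-positive
components in the direction of the translation, and some of them negative ones. -/
theorem zero_mem_convexHull_touchedNormals {n : ℕ} (hn : 3 ≤ n) {q : ℤ → ℂ}
    (hq : q ∈ closedOrbits (regularPolygon n)) :
    (0 : ℂ) ∈ convexHull ℝ (touchedNormals n q) := by
  by_contra h0
  have hfin := finite_touchedNormals (n := n) (by omega) q
  obtain ⟨f, u, hu0, hu⟩ := geometric_hahn_banach_point_closed (convex_convexHull ℝ _)
    (hfin.isCompact_convexHull (𝕜 := ℝ)).isClosed h0
  rw [map_zero] at hu0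
  obtain ⟨d, hd⟩ : ∃ d : ℂ, ∀ x, f x = -inner ℝ x d := by
    refine ⟨-((InnerProductSpace.toDual ℝ ℂ).symm f), fun x => ?_⟩
    rw [inner_neg_right, neg_neg, real_inner_comm, InnerProductSpace.toDual_symm_apply]
  obtain ⟨horb, hper⟩ := hq
  obtain ⟨-, hq⟩ := bounceNumber_mem_periods hper
  set m := bounceNumber q
  have hdir : ∀ (i a : ℤ), inner ℝ (edgeNormal n a) (q i) = apothem n →
      inner ℝ (edgeNormal n a) d < 0 := by
    intro i a h
    have h1 := hu _ (subset_convexHull ℝ _ (⟨a, rfl, i, h⟩ : edgeNormal n a ∈ touchedNormals n q))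
    rw [hd] at h1
    linarith
  have hneg : ∀ i : ℤ, bounceVector q i ≠ 0 → inner ℝ d (bounceVector q i) < 0 := fun i hi =>
    inner_neg_of_isOutwardSupport hn ((mem_frontier_iff hn).mp (horb i).1).1 (horb i).2.2 hi
      (hdir i)
  have hsum : ∑ i ∈ Finset.range m, inner ℝ d (bounceVector q i) = 0 := by
    rw [← inner_sum, sum_bounceVector hq, inner_zero_right]
  have hle : ∀ i ∈ Finset.range m, inner ℝ d (bounceVector q (i : ℕ)) ≤ 0 := by
    intro i _
    by_cases hi : bounceVector q i = 0
    · rw [hi, inner_zero_right]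
    · exact (hneg i hi).le
  -- all bounce vectors vanish, which would make the length of the orbit zero
  have hall := (Finset.sum_eq_zero_iff_of_nonpos hle).mp hsum
  have hzero : ∀ i ∈ Finset.range m, bounceVector q (i : ℕ) = 0 := by
    intro i hi
    by_contra hne
    exact (hneg i hne).ne (hall i hi)
  have hlen := sum_inner_bounceVector hq fun i => (horb i).2.1
  rw [Finset.sum_eq_zero (fun i hi => by rw [hzero i hi, inner_zero_left])] at hlen
  have h2 : 2 ≤ m := (bounceNumber_mem_periods hper).1
  have hpos : 0 < pathLength q 0 m := by
    refine Finset.sum_pos (fun i _ => ?_) ⟨0, by simp; omega⟩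
    exact norm_pos_iff.mpr (sub_ne_zero.mpr (horb _).2.1.symm)
  linarith

/-- A closed orbit meets two parallel edges, or three edges whose normals positively span the
plane. -/
theorem exists_touched_pair_or_triple {n : ℕ} (hn : 3 ≤ n) {q : ℤ → ℂ}
    (hq : q ∈ closedOrbits (regularPolygon n)) :
    (∃ a b i j : ℤ, edgeNormal n b = -edgeNormal n a ∧
      inner ℝ (edgeNormal n a) (q i) = apothem n ∧ inner ℝ (edgeNormal n b) (q j) = apothem n) ∨
    (∃ a b c i j k : ℤ, edgeNormal n a ≠ edgeNormal n b ∧ edgeNormal n b ≠ edgeNormal n c ∧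
      edgeNormal n c ≠ edgeNormal n a ∧
      inner ℝ (edgeNormal n a) (q i) = apothem n ∧ inner ℝ (edgeNormal n b) (q j) = apothem n ∧
      inner ℝ (edgeNormal n c) (q k) = apothem n ∧
      ∃ α β γ : ℝ, 0 < α ∧ 0 < β ∧ 0 < γ ∧
        α • edgeNormal n a + β • edgeNormal n b + γ • edgeNormal n c = 0) := by
  obtain ⟨ι, hι, z, w, hz, haff, hw, hw1, hwz⟩ :=
    eq_pos_convex_span_of_mem_convexHull (zero_mem_convexHull_touchedNormals hn hq)
  have hcard := haff.card_le_finrank_succ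
  have hfin : Module.finrank ℝ (vectorSpan ℝ (Set.range z)) ≤ 2 :=
    (Submodule.finrank_le _).trans_eq Complex.finrank_real_complex
  have hinj := haff.injective
  choose! a ha i hi using fun x => hz (Set.mem_range_self x)
  obtain ⟨k, hk⟩ : ∃ k, Fintype.card ι = k := ⟨_, rfl⟩
  let e := (Fintype.equivFinOfCardEq hk).symm
  rw [← e.sum_comp] at hw1 hwz
  have hk3 : k ≤ 3 := by omega
  interval_cases k
  · simp at hw1
  · simp only [Fin.sum_univ_one, ha] at hw1 hwz
    rw [hw1, one_smul] at hwz
    exact absurd hwz (dir_ne_zero n _)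
  · left
    simp only [Fin.sum_univ_two, ha] at hw1 hwz
    refine ⟨a (e 0), a (e 1), i (e 0), i (e 1), ?_, hi _, hi _⟩
    have h0 := hw (e 0)
    have h1 := hw (e 1)
    have hab : edgeNormal n (a (e 1)) = -((w (e 0) / w (e 1)) • edgeNormal n (a (e 0))) := by
      rw [eq_neg_iff_add_eq_zero, ← smul_right_injective ℂ h1.ne' |>.eq_iff]
      simp only [smul_add, smul_smul, smul_zero, mul_div_cancel₀ _ h1.ne']
      rw [add_comm, hwz]
    have hnorm := congrArg norm hab
    rw [norm_neg, norm_smul, norm_edgeNormal, norm_edgeNormal, mul_one,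
      Real.norm_of_nonneg (div_pos h0 h1).le] at hnorm
    rw [hab, ← hnorm, one_smul]
  · right
    simp only [Fin.sum_univ_three, ha] at hw1 hwz
    have hne : ∀ s t : Fin 3, s ≠ t → edgeNormal n (a (e s)) ≠ edgeNormal n (a (e t)) := by
      intro s t hst h
      rw [← ha, ← ha] at h
      exact hst (e.injective (hinj h))
    exact ⟨a (e 0), a (e 1), a (e 2), i (e 0), i (e 1), i (e 2), hne _ _ (by decide),
      hne _ _ (by decide), hne _ _ (by decide), hi _, hi _, hi _, w (e 0), w (e 1), w (e 2),
      hw _, hw _, hw _, hwz⟩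

/-! ### Lower bounds for the perimeter of a triangle that touches given edges -/

/-- Vectors in the unit ball bound the perimeter of a triangle from below. -/
theorem inner_add_inner_add_inner_le_perimeter {u v w x y z : ℂ} (hu : ‖u‖ ≤ 1) (hv : ‖v‖ ≤ 1)
    (hw : ‖w‖ ≤ 1) :
    inner ℝ u (y - x) + inner ℝ v (z - y) + inner ℝ w (x - z) ≤ perimeter x y z ∧
      (perimeter x y z = inner ℝ u (y - x) + inner ℝ v (z - y) + inner ℝ w (x - z) →
        inner ℝ u (y - x) = ‖y - x‖ ∧ inner ℝ v (z - y) = ‖z - y‖ ∧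
        inner ℝ w (x - z) = ‖x - z‖) := by
  have key : ∀ s t : ℂ, ‖s‖ ≤ 1 → inner ℝ s t ≤ ‖t‖ := fun s t hs =>
    (real_inner_le_norm s t).trans (mul_le_of_le_one_left (norm_nonneg _) hs)
  have h1 := key u (y - x) hu
  have h2 := key v (z - y) hv
  have h3 := key w (x - z) hw
  unfold perimeter
  exact ⟨by linarith, fun h => ⟨by linarith, by linarith, by linarith⟩⟩

theorem eq_norm_smul_of_inner_eq_norm {u v : ℂ} (hu : ‖u‖ = 1) (h : inner ℝ u v = ‖v‖) :
    v = ‖v‖ • u := by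
  have := (inner_eq_norm_mul_iff_real (x := u) (y := v)).mp (by rw [hu, one_mul, h])
  rw [hu, one_smul] at this
  exact this.symm

/-- A path back and forth between two opposite edges is encoded as a degenerate triangle. -/
theorem perimeter_pair_bound {n : ℕ} {a b : ℤ} {x y : ℂ}
    (hab : edgeNormal n b = -edgeNormal n a)
    (hx : inner ℝ (edgeNormal n a) x = apothem n) (hy : inner ℝ (edgeNormal n b) y = apothem n) :
    4 * apothem n ≤ perimeter x y y ∧
      (perimeter x y y = 4 * apothem n → y - x = -((2 * apothem n) • edgeNormal n a)) := by
  rw [hab, inner_neg_left] at hy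
  have h1 : inner ℝ (edgeNormal n b) (y - x) = 2 * apothem n := by
    rw [hab, inner_neg_left, inner_sub_right, hx]
    linarith
  have h2 := real_inner_le_norm (edgeNormal n b) (y - x)
  rw [h1, norm_edgeNormal, one_mul] at h2
  have hp : perimeter x y y = 2 * ‖y - x‖ := by
    rw [perimeter, sub_self, norm_zero, norm_sub_rev x y]
    ring
  rw [hp]
  refine ⟨by linarith, fun h => ?_⟩
  have h3 : ‖y - x‖ = 2 * apothem n := by linarith
  have h4 := eq_norm_smul_of_inner_eq_norm (norm_edgeNormal n b) (h1.trans h3.symm)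
  rw [h4, h3, hab, smul_neg]

theorem sq_add_sq_add_eq_one {n : ℕ} {a b c : ℤ} {β γ : ℝ}
    (hcomb : -edgeNormal n a = β • edgeNormal n b + γ • edgeNormal n c) :
    β ^ 2 + γ ^ 2 + 2 * β * γ * inner ℝ (edgeNormal n b) (edgeNormal n c) = 1 := by
  have h1 : inner ℝ (-edgeNormal n a) (-edgeNormal n a) = 1 := by
    rw [inner_neg_neg, inner_edgeNormal_self]
  rw [hcomb] at h1
  simp only [inner_add_left, inner_add_right, inner_smul_left, inner_smul_right,
    inner_edgeNormal_self, conj_trivial,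
    real_inner_comm (edgeNormal n b) (edgeNormal n c)] at h1
  linarith

/-- If the triangle formed by three edge lines is not acute, the shortest closed path that touches
the three lines runs back and forth along the altitude onto the longest side. Accordingly, two of
the vectors in the bound are `± edgeNormal n a`. -/
theorem perimeter_nonacute_bound {n : ℕ} {a b c : ℤ} {x y z : ℂ} {β γ : ℝ} (hβ : 0 < β)
    (hγ : 0 < γ) (hcomb : -edgeNormal n a = β • edgeNormal n b + γ • edgeNormal n c)
    (hbc : 0 ≤ inner ℝ (edgeNormal n b) (edgeNormal n c))
    (hx : inner ℝ (edgeNormal n a) x = apothem n) (hy : inner ℝ (edgeNormal n b) y = apothem n)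
    (hz : inner ℝ (edgeNormal n c) z = apothem n) :
    2 * apothem n * (1 + β + γ) ≤ perimeter x y z ∧
      (perimeter x y z = 2 * apothem n * (1 + β + γ) →
        y - x = -(‖y - x‖ • edgeNormal n a) ∧ x - z = ‖x - z‖ • edgeNormal n a ∧
        inner ℝ (γ • edgeNormal n c - β • edgeNormal n b) (z - y) = ‖z - y‖) := by
  have ha := inner_edgeNormal_self n a
  have hb := inner_edgeNormal_self n b
  have hc := inner_edgeNormal_self n c
  have hna := norm_edgeNormal n a
  have hna' : ‖-edgeNormal n a‖ = 1 := by rw [norm_neg, hna]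
  have hsq := sq_add_sq_add_eq_one hcomb
  -- the third vector of the bound; the angle between the edges `b` and `c` enters only here
  have hv : ‖γ • edgeNormal n c - β • edgeNormal n b‖ ≤ 1 := by
    rw [← sq_le_one_iff₀ (norm_nonneg _), ← real_inner_self_eq_norm_sq]
    simp only [inner_sub_left, inner_sub_right, inner_smul_left, inner_smul_right, hb, hc,
      conj_trivial, real_inner_comm (edgeNormal n b) (edgeNormal n c)]
    nlinarith [mul_nonneg (mul_nonneg hβ.le hγ.le) hbc]
  have hsum : inner ℝ (-edgeNormal n a) (y - x)
      + inner ℝ (γ • edgeNormal n c - β • edgeNormal n b) (z - y)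
      + inner ℝ (edgeNormal n a) (x - z) = 2 * apothem n * (1 + β + γ) := by
    have h1 : ∀ t, inner ℝ (edgeNormal n a) t = -(β * inner ℝ (edgeNormal n b) t
        + γ * inner ℝ (edgeNormal n c) t) := by
      intro t
      rw [← neg_neg (edgeNormal n a), hcomb, inner_neg_left, inner_add_left, inner_smul_left,
        inner_smul_left]
      simp
    simp only [inner_neg_left, inner_sub_left, inner_sub_right, inner_smul_left, conj_trivial,
      hx, hy, hz, h1 y, h1 z]
    ring
  obtain ⟨h1, h2⟩ := inner_add_inner_add_inner_le_perimeter (x := x) (y := y) (z := z)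
    hna'.le hv hna.le
  rw [hsum] at h1 h2
  refine ⟨h1, fun h => ?_⟩
  obtain ⟨e1, e2, e3⟩ := h2 h
  refine ⟨?_, eq_norm_smul_of_inner_eq_norm hna e3, e2⟩
  rw [← smul_neg]
  exact eq_norm_smul_of_inner_eq_norm hna' e1

theorem inner_edgeNormal_lt_one {n : ℕ} {b c : ℤ} (h : edgeNormal n b ≠ edgeNormal n c) :
    inner ℝ (edgeNormal n b) (edgeNormal n c) < 1 := by
  have h1 := norm_sub_sq_real (edgeNormal n b) (edgeNormal n c)
  have h2 : 0 < ‖edgeNormal n b - edgeNormal n c‖ := norm_pos_iff.mpr (sub_ne_zero.mpr h)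
  rw [norm_edgeNormal, norm_edgeNormal] at h1
  nlinarith

/-- In the situation of `perimeter_nonacute_bound`, the altitude is longer than `2 * apothem n`,
since `β + γ > 1` by the triangle inequality. -/
theorem four_apothem_lt_perimeter_of_nonacute {n : ℕ} (hn : 3 ≤ n) {a b c : ℤ} {x y z : ℂ}
    {β γ : ℝ} (hβ : 0 < β) (hγ : 0 < γ)
    (hcomb : -edgeNormal n a = β • edgeNormal n b + γ • edgeNormal n c)
    (hbc : 0 ≤ inner ℝ (edgeNormal n b) (edgeNormal n c))
    (hne : edgeNormal n b ≠ edgeNormal n c)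
    (hx : inner ℝ (edgeNormal n a) x = apothem n) (hy : inner ℝ (edgeNormal n b) y = apothem n)
    (hz : inner ℝ (edgeNormal n c) z = apothem n) :
    4 * apothem n < perimeter x y z := by
  have h1 := (perimeter_nonacute_bound hβ hγ hcomb hbc hx hy hz).1
  have h2 : (1 : ℝ) < β + γ := by
    have h3 := sq_add_sq_add_eq_one hcomb
    have h4 := mul_pos (mul_pos hβ hγ) (sub_pos.mpr (inner_edgeNormal_lt_one hne))
    by_contra! h5
    nlinarith
  nlinarith [apothem_pos hn]

/-- In the polygon with an odd number of edges, the altitude in question is at least as long as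
the distance between an edge and the opposite vertex, with equality only if the two remaining
edges meet in that vertex. -/
theorem perimeter_nonacute_bound_of_odd {n : ℕ} (hn : 3 ≤ n) {a b c : ℤ} {x y z : ℂ}
    {β γ : ℝ} (hβ : 0 < β) (hγ : 0 < γ)
    (hcomb : -edgeNormal n a = β • edgeNormal n b + γ • edgeNormal n c)
    (hbc : 0 ≤ inner ℝ (edgeNormal n b) (edgeNormal n c))
    (hne : edgeNormal n b ≠ edgeNormal n c) (hmem : -edgeNormal n a ∈ regularPolygon n)
    (hx : inner ℝ (edgeNormal n a) x = apothem n) (hy : inner ℝ (edgeNormal n b) y = apothem n)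
    (hz : inner ℝ (edgeNormal n c) z = apothem n) (hz1 : ‖z‖ ≤ 1) :
    2 * (1 + apothem n) ≤ perimeter x y z ∧
      (perimeter x y z = 2 * (1 + apothem n) → x = apothem n • edgeNormal n a ∧
        y = -edgeNormal n a ∧ z = -edgeNormal n a) := by
  obtain ⟨hbound, heq⟩ := perimeter_nonacute_bound hβ hγ hcomb hbc hx hy hz
  have hr := apothem_pos hn
  have ha := inner_edgeNormal_self n a
  have hb := inner_edgeNormal_self n b
  have hc := inner_edgeNormal_self n c
  have hlt := inner_edgeNormal_lt_one hne
  have hvb := (mem_regularPolygon_iff hn).mp hmem b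
  have hvc := (mem_regularPolygon_iff hn).mp hmem c
  have h1 : ∀ t, inner ℝ (-edgeNormal n a) t =
      β * inner ℝ (edgeNormal n b) t + γ * inner ℝ (edgeNormal n c) t := by
    intro t
    rw [hcomb, inner_add_left, inner_smul_left, inner_smul_left]
    simp
  have hv := h1 (-edgeNormal n a)
  rw [inner_neg_neg, ha] at hv
  -- the unit vector `-edgeNormal n a` is a vertex, so its components along the other two normals
  -- are at most `apothem n`
  have hβγ : 1 ≤ apothem n * (β + γ) := by nlinarith
  refine ⟨by nlinarith, fun h => ?_⟩
  have hβγ' : apothem n * (β + γ) = 1 := by nlinarith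
  obtain ⟨e1, e2, e3⟩ := heq (by rw [h]; linear_combination (-2) * hβγ')
  have hvb' : inner ℝ (edgeNormal n b) (-edgeNormal n a) = apothem n := by nlinarith
  have hvc' : inner ℝ (edgeNormal n c) (-edgeNormal n a) = apothem n := by nlinarith
  have hβγ'' : β = γ := by
    have e4 := hvb'
    have e5 := hvc'
    rw [hcomb, inner_add_right, inner_smul_right, inner_smul_right, hb] at e4
    rw [hcomb, inner_add_right, inner_smul_right, inner_smul_right, hc,
      real_inner_comm] at e5
    have : (β - γ) * (1 - inner ℝ (edgeNormal n b) (edgeNormal n c)) = 0 := by linarith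
    rcases mul_eq_zero.mp this with h' | h' <;> linarith
  -- the side from `y` to `z` is parallel to `edgeNormal n a`, hence degenerate
  have hzy : z - y = (‖y - x‖ - ‖x - z‖) • edgeNormal n a := by
    rw [sub_smul, ← e2, ← neg_neg (‖y - x‖ • edgeNormal n a), ← e1]
    abel
  have hyz : z = y := by
    have e4 : inner ℝ (γ • edgeNormal n c - β • edgeNormal n b) (z - y) = 0 := by
      rw [inner_neg_right] at hvb' hvc'
      rw [hzy, inner_smul_right, inner_sub_left, inner_smul_left, inner_smul_left, hβγ'']
      simp only [conj_trivial]
      rw [show inner ℝ (edgeNormal n c) (edgeNormal n a)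
        = inner ℝ (edgeNormal n b) (edgeNormal n a) by linarith]
      ring
    rw [e4] at e3
    exact sub_eq_zero.mp (norm_eq_zero.mp e3.symm)
  subst hyz
  have hax : inner ℝ (edgeNormal n a) (z - x) = -‖z - x‖ := by
    rw [e1, inner_neg_right, inner_smul_right, ha, norm_neg, norm_smul, norm_norm,
      norm_edgeNormal]
  have hz2 : inner ℝ (-edgeNormal n a) z = 1 := by
    rw [h1, hy, hz, ← hβγ']; ring
  have hzx : ‖z - x‖ = 1 + apothem n := by
    rw [inner_neg_left] at hz2
    rw [inner_sub_right, hx] at hax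
    linarith
  -- a vector of norm at most one with inner product one with a unit vector is that vector
  have hzv : z = -edgeNormal n a := by
    have h3 := norm_sub_sq_real (-edgeNormal n a) z
    rw [hz2, norm_neg, norm_edgeNormal] at h3
    have h4 : ‖-edgeNormal n a - z‖ = 0 := by
      nlinarith [norm_nonneg (-edgeNormal n a - z), norm_nonneg z]
    exact (sub_eq_zero.mp (norm_eq_zero.mp h4)).symm
  refine ⟨?_, hzv, hzv⟩
  rw [hzx, add_smul, one_smul, hzv] at e1
  have h5 : x = -edgeNormal n a - (-edgeNormal n a - x) := by abel
  rw [h5, e1]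
  abel

/-- The perimeter of a triangle with vertices on three edge lines is at least the length of the
closed path through the feet of the altitudes of the triangle formed by these lines. -/
theorem perimeter_altitude_bound {n : ℕ} {a b c : ℤ} {x y z : ℂ}
    (hx : inner ℝ (edgeNormal n a) x = apothem n) (hy : inner ℝ (edgeNormal n b) y = apothem n)
    (hz : inner ℝ (edgeNormal n c) z = apothem n) :
    2 * apothem n * (Real.sin (2 * Real.pi * (c - b) / n) + Real.sin (2 * Real.pi * (a - c) / n)
        + Real.sin (2 * Real.pi * (b - a) / n)) ≤ perimeter x y z ∧
      (perimeter x y z = 2 * apothem n * (Real.sin (2 * Real.pi * (c - b) / n)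
          + Real.sin (2 * Real.pi * (a - c) / n) + Real.sin (2 * Real.pi * (b - a) / n)) →
        inner ℝ (edgeNormal n (a + b - c)) x = inner ℝ (edgeNormal n (a + b - c)) y ∧
        inner ℝ (edgeNormal n (b + c - a)) y = inner ℝ (edgeNormal n (b + c - a)) z ∧
        inner ℝ (edgeNormal n (c + a - b)) z = inner ℝ (edgeNormal n (c + a - b)) x) := by
  -- the unit vectors of the bound are the directions of the sides of the orthic triangle
  have hI : ∀ s : ℤ, ‖-(Complex.I * edgeNormal n s)‖ = 1 := fun s => by
    rw [norm_neg, norm_mul, Complex.norm_I, one_mul, norm_edgeNormal]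
  have hpar : ∀ (s : ℤ) (w : ℂ), inner ℝ (-(Complex.I * edgeNormal n s)) w = ‖w‖ →
      inner ℝ (edgeNormal n s) w = 0 := by
    intro s w h
    rw [eq_norm_smul_of_inner_eq_norm (hI s) h, inner_smul_right, inner_eq]
    simp
    right
    ring
  have hinner : ∀ (s t : ℤ) (τ : ℝ), inner ℝ (-(Complex.I * edgeNormal n s))
      (edgeNormal n t * (apothem n + τ * Complex.I)) =
      apothem n * Real.sin (2 * Real.pi * (s - t) / n)
        - τ * Real.cos (2 * Real.pi * (s - t) / n) := by
    intro s t τ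
    have h1 := inner_edgeNormal_mul n s t (-τ) (apothem n)
    have h2 : inner ℝ (-(Complex.I * edgeNormal n s))
        (edgeNormal n t * (apothem n + τ * Complex.I)) =
        inner ℝ (edgeNormal n s) (edgeNormal n t * ((-τ : ℝ) + apothem n * Complex.I)) := by
      rw [inner_eq, inner_eq]
      simp
      ring
    rw [h2, h1]
    ring
  obtain ⟨h1, h2⟩ := inner_add_inner_add_inner_le_perimeter (x := x) (y := y) (z := z)
    (hI (a + b - c)).le (hI (b + c - a)).le (hI (c + a - b)).le
  obtain ⟨tx, rfl⟩ := exists_eq_of_inner_edgeNormal hx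
  obtain ⟨ty, rfl⟩ := exists_eq_of_inner_edgeNormal hy
  obtain ⟨tz, rfl⟩ := exists_eq_of_inner_edgeNormal hz
  have hsum : ∀ x y z : ℂ, ∀ u v w : ℂ,
      inner ℝ u (y - x) + inner ℝ v (z - y) + inner ℝ w (x - z) =
      (inner ℝ w x - inner ℝ u x) + (inner ℝ u y - inner ℝ v y) + (inner ℝ v z - inner ℝ w z) := by
    intro x y z u v w
    simp only [inner_sub_right]
    ring
  have hflip : ∀ p q : ℝ, p = -q → Real.sin (2 * Real.pi * p / n) = -Real.sin (2 * Real.pi * q / n)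
      ∧ Real.cos (2 * Real.pi * p / n) = Real.cos (2 * Real.pi * q / n) := by
    rintro p q rfl
    rw [← Real.sin_neg, ← Real.cos_neg (2 * Real.pi * q / n)]
    constructor <;> congr 1 <;> ring
  -- both sides at a vertex make the same angle with the edge, so the position `τ` of the vertex on
  -- the edge cancels
  have key : ∀ (s s' t : ℤ) (τ : ℝ), s - t = -(s' - t) →
      inner ℝ (-(Complex.I * edgeNormal n s)) (edgeNormal n t * (apothem n + τ * Complex.I)) -
      inner ℝ (-(Complex.I * edgeNormal n s')) (edgeNormal n t * (apothem n + τ * Complex.I)) =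
      2 * apothem n * Real.sin (2 * Real.pi * ((s : ℝ) - t) / n) := by
    intro s s' t τ hst
    have hst' : (s' : ℝ) - t = -((s : ℝ) - t) := by
      have : (s : ℝ) - t = -((s' : ℝ) - t) := by exact_mod_cast hst
      linarith
    rw [hinner, hinner, (hflip _ _ hst').1, (hflip _ _ hst').2]
    ring
  rw [hsum, key _ _ a tx (by ring), key _ _ b ty (by ring), key _ _ c tz (by ring)] at h1 h2
  have hv : 2 * apothem n * Real.sin (2 * Real.pi * (((c + a - b : ℤ) : ℝ) - a) / n)
      + 2 * apothem n * Real.sin (2 * Real.pi * (((a + b - c : ℤ) : ℝ) - b) / n)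
      + 2 * apothem n * Real.sin (2 * Real.pi * (((b + c - a : ℤ) : ℝ) - c) / n) =
      2 * apothem n * (Real.sin (2 * Real.pi * (c - b) / n) + Real.sin (2 * Real.pi * (a - c) / n)
        + Real.sin (2 * Real.pi * (b - a) / n)) := by
    push_cast
    ring_nf
  rw [hv] at h1 h2
  refine ⟨h1, fun h => ?_⟩
  obtain ⟨e1, e2, e3⟩ := h2 h
  have e1' := hpar _ _ e1
  have e2' := hpar _ _ e2
  have e3' := hpar _ _ e3
  rw [inner_sub_right] at e1' e2' e3'
  exact ⟨by linarith, by linarith, by linarith⟩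

/-- The position of the foot of an altitude on an edge line, relative to the midpoint of the
edge, for a triangle whose sides have the directions of an orthic triangle. -/
theorem offset_mul_sin {n : ℕ} {a b c : ℤ} {tx ty tz : ℝ} {x y z : ℂ}
    (hx : x = edgeNormal n a * (apothem n + tx * Complex.I))
    (hy : y = edgeNormal n b * (apothem n + ty * Complex.I))
    (hz : z = edgeNormal n c * (apothem n + tz * Complex.I))
    (h1 : inner ℝ (edgeNormal n (a + b - c)) x = inner ℝ (edgeNormal n (a + b - c)) y)
    (h2 : inner ℝ (edgeNormal n (b + c - a)) y = inner ℝ (edgeNormal n (b + c - a)) z)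
    (h3 : inner ℝ (edgeNormal n (c + a - b)) z = inner ℝ (edgeNormal n (c + a - b)) x) :
    tz * Real.sin (2 * Real.pi * (b - a) / n) =
      apothem n * (Real.cos (2 * Real.pi * (a - c) / n)
        - Real.cos (2 * Real.pi * (c - b) / n)) := by
  subst hx hy hz
  rw [inner_edgeNormal_mul, inner_edgeNormal_mul] at h1 h2 h3
  push_cast at h1 h2 h3
  have hflip : ∀ p q : ℝ, Real.sin (2 * Real.pi * (p - q) / n) =
    -Real.sin (2 * Real.pi * (q - p) / n)
      ∧ Real.cos (2 * Real.pi * (p - q) / n) = Real.cos (2 * Real.pi * (q - p) / n) := by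
    intro p q
    rw [← Real.sin_neg, ← Real.cos_neg (2 * Real.pi * (q - p) / n)]
    constructor <;> congr 1 <;> ring
  have r1 : ∀ p q s : ℝ, p + q - s - p = q - s := fun p q s => by ring
  have r2 : ∀ p q s : ℝ, p + q - s - q = p - s := fun p q s => by ring
  rw [r1, r2] at h1 h2 h3
  rw [(hflip b c).1, (hflip b c).2] at h1
  rw [(hflip c a).1, (hflip c a).2] at h2
  rw [(hflip a b).1, (hflip a b).2] at h3
  linarith

/-! ### Acute triangles formed by edge lines -/

/-- The elementary inequality behind `lt_perimeter_of_acute`: `A`, `B`, `C` are the angles of an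
acute triangle, `A` at most `π / 3`, and `x` stands for `π / n`. -/
theorem one_lt_cos_mul_of_acute {A B C x : ℝ} (hsum : A + B + C = Real.pi)
    (hB : B < Real.pi / 2) (hC : C < Real.pi / 2) (hx0 : 0 < x)
    (hxA : x ≤ A) (hA : A ≤ Real.pi / 3) (hx : x ≤ Real.pi / 6) :
    1 < Real.cos x * (Real.sin A + Real.sin B + Real.sin C - 1) := by
  have hpi := Real.pi_pos
  have hcx : 0 < Real.cos x := Real.cos_pos_of_mem_Ioo ⟨by linarith, by linarith⟩
  have hsx : 0 < Real.sin x := Real.sin_pos_of_pos_of_lt_pi hx0 (by linarith)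
  have hcA : 0 < Real.cos A := Real.cos_pos_of_mem_Ioo ⟨by linarith, by linarith⟩
  have hsA : 0 < Real.sin A := Real.sin_pos_of_pos_of_lt_pi (by linarith) (by linarith)
  -- with `B` and `C` acute, `|B - C| ≤ A`
  have h1 : 1 + Real.cos A ≤ Real.sin B + Real.sin C := by
    have e1 : Real.sin B + Real.sin C = 2 * Real.cos (A / 2) * Real.cos ((B - C) / 2) := by
      have : B = (Real.pi / 2 - A / 2) + (B - C) / 2 := by linarith
      have h2 : C = (Real.pi / 2 - A / 2) - (B - C) / 2 := by linarith
      have e : ∀ P S : ℝ, Real.sin (P + S) + Real.sin (P - S) =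
          2 * Real.sin P * Real.cos S := by
        intro P S
        rw [Real.sin_add, Real.sin_sub]; ring
      have e' := e (Real.pi / 2 - A / 2) ((B - C) / 2)
      rwa [← this, ← h2, Real.sin_pi_div_two_sub] at e'
    have e2 : Real.cos (A / 2) ≤ Real.cos ((B - C) / 2) := by
      rw [← Real.cos_abs ((B - C) / 2)]
      apply Real.cos_le_cos_of_nonneg_of_le_pi (abs_nonneg _) (by linarith)
      rw [abs_le]
      constructor <;> linarith
    have e3 : 0 < Real.cos (A / 2) := Real.cos_pos_of_mem_Ioo ⟨by linarith, by linarith⟩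
    have e4 : Real.cos A = 2 * Real.cos (A / 2) ^ 2 - 1 := by
      rw [← Real.cos_two_mul]; congr 1; ring
    rw [e1, e4]
    nlinarith
  have h2 : Real.sin x + Real.cos x ≤ Real.sin A + Real.cos A := by
    have e1 : Real.sin (2 * x) ≤ Real.sin (2 * A) := by
      rcases le_total (2 * A) (Real.pi / 2) with h | h
      · exact Real.sin_le_sin_of_le_of_le_pi_div_two (by linarith) h (by linarith)
      · rw [← Real.sin_pi_sub (2 * A)]
        exact Real.sin_le_sin_of_le_of_le_pi_div_two (by linarith) (by linarith) (by linarith)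
    rw [Real.sin_two_mul, Real.sin_two_mul] at e1
    apply (pow_le_pow_iff_left₀ (by positivity) (by positivity) two_ne_zero).mp
    nlinarith [Real.sin_sq_add_cos_sq x, Real.sin_sq_add_cos_sq A]
  have h3 : 1 < Real.cos x * (Real.sin x + Real.cos x) := by
    have hlt : Real.sin x < Real.cos x := by
      rw [← Real.sin_pi_div_two_sub]
      exact Real.sin_lt_sin_of_lt_of_le_pi_div_two (by linarith) (by linarith) (by linarith)
    nlinarith [Real.sin_sq_add_cos_sq x]
  nlinarith

theorem pi_div_two_lt_of_cos_neg {t : ℝ} (h : Real.cos t < 0) (h0 : 0 ≤ t) :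
    Real.pi / 2 < t := by
  by_contra! hle
  exact absurd (Real.cos_nonneg_of_mem_Icc ⟨by linarith [Real.pi_pos], hle⟩) (by linarith)

/-- The three numbers `π - 2 * π * kᵢ / n` are the angles of the triangle formed by three edge
lines. -/
theorem one_lt_apothem_mul {n : ℕ} (hn : 4 ≤ n) {k₁ k₂ k₃ : ℤ} (h₁ : 0 < k₁) (h₂ : 0 < k₂)
    (h₃ : 0 < k₃) (hsum : k₁ + k₂ + k₃ = n) (hc₁ : Real.cos (2 * Real.pi * k₁ / n) < 0)
    (hc₂ : Real.cos (2 * Real.pi * k₂ / n) < 0) (hc₃ : Real.cos (2 * Real.pi * k₃ / n) < 0) :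
    1 < apothem n * (Real.sin (2 * Real.pi * k₁ / n) + Real.sin (2 * Real.pi * k₂ / n)
      + Real.sin (2 * Real.pi * k₃ / n) - 1) := by
  have hpi := Real.pi_pos
  have hn0 : (0 : ℝ) < n := by positivity
  -- every gap is larger than a quarter turn, because the triangle is acute, and smaller than a half
  -- turn, because the three gaps add up to a full turn
  have hlow : ∀ k : ℤ, 0 < k → Real.cos (2 * Real.pi * k / n) < 0 → (n : ℤ) < 4 * k := by
    intro k hk hc
    have hk' : (0 : ℝ) < k := by exact_mod_cast hk
    have h := pi_div_two_lt_of_cos_neg hc (by positivity)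
    rw [lt_div_iff₀ hn0] at h
    have : (n : ℝ) < 4 * k := by nlinarith
    exact_mod_cast this
  have l₁ := hlow k₁ h₁ hc₁
  have l₂ := hlow k₂ h₂ hc₂
  have l₃ := hlow k₃ h₃ hc₃
  have hn6 : (6 : ℝ) ≤ n := by
    have : 6 ≤ n := by omega
    exact_mod_cast this
  set x : ℝ := Real.pi / n with hx
  have hx0 : 0 < x := by positivity
  have hxn : x * n = Real.pi := div_mul_cancel₀ _ hn0.ne'
  have hx6 : x ≤ Real.pi / 6 := by rw [hx]; gcongr
  have hang : ∀ k : ℤ, Real.sin (2 * Real.pi * k / n) = Real.sin ((n - 2 * k) * x) := by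
    intro k
    rw [← Real.sin_pi_sub]
    congr 1
    rw [← hxn]
    field_simp
  have hup : ∀ k : ℤ, (n : ℤ) < 4 * k → ((n : ℝ) - 2 * k) * x < Real.pi / 2 := by
    intro k hk
    have : (n : ℝ) < 4 * k := by exact_mod_cast hk
    rw [← hxn]
    nlinarith
  have hone : ∀ k : ℤ, 2 * k + 1 ≤ (n : ℤ) → x ≤ ((n : ℝ) - 2 * k) * x := by
    intro k hk
    have : 2 * (k : ℝ) + 1 ≤ n := by exact_mod_cast hk
    nlinarith
  have hsum' : ((n : ℝ) - 2 * k₁) * x + (n - 2 * k₂) * x + (n - 2 * k₃) * x = Real.pi := by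
    have : (k₁ : ℝ) + k₂ + k₃ = n := by exact_mod_cast hsum
    rw [← hxn]
    linear_combination (-2 * x) * this
  rw [hang, hang, hang, apothem, ← hx]
  have u₁ := hup k₁ l₁
  have u₂ := hup k₂ l₂
  have u₃ := hup k₃ l₃
  have o₁ := hone k₁ (by omega)
  have o₂ := hone k₂ (by omega)
  have o₃ := hone k₃ (by omega)
  set A := ((n : ℝ) - 2 * k₁) * x
  set B := ((n : ℝ) - 2 * k₂) * x
  set C := ((n : ℝ) - 2 * k₃) * x
  -- the smallest angle is at most `π / 3`
  rcases le_or_gt A (Real.pi / 3) with hA | hA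
  · exact one_lt_cos_mul_of_acute hsum' u₂ u₃ hx0 o₁ hA hx6
  rcases le_or_gt B (Real.pi / 3) with hB | hB
  · have := one_lt_cos_mul_of_acute (by linarith) u₁ u₃ hx0 o₂ hB hx6
    linarith
  · have := one_lt_cos_mul_of_acute (by linarith) u₁ u₂ hx0 o₃ (by linarith) hx6
    linarith

/-- Three distinct edges in cyclic order, with the gaps `k₁`, `k₂`, `k₃` between their indices. -/
theorem exists_cyclic_order {n : ℕ} (hn : n ≠ 0) {a b c : ℤ}
    (hab : edgeNormal n a ≠ edgeNormal n b) (hbc : edgeNormal n b ≠ edgeNormal n c)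
    (hca : edgeNormal n c ≠ edgeNormal n a) :
    ∃ k₁ k₂ k₃ : ℤ, 0 < k₁ ∧ 0 < k₂ ∧ 0 < k₃ ∧ k₁ + k₂ + k₃ = n ∧
      ((edgeNormal n b = edgeNormal n (a + k₁) ∧ edgeNormal n c = edgeNormal n (a + k₁ + k₂)) ∨
      (edgeNormal n c = edgeNormal n (a + k₁) ∧ edgeNormal n b = edgeNormal n (a + k₁ + k₂))) := by
  have hred : ∀ d : ℤ, edgeNormal n d ≠ edgeNormal n a → ∃ k : ℤ, 0 < k ∧ k < n ∧
      edgeNormal n d = edgeNormal n (a + k) := by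
    intro d hd
    have h0 := Int.emod_nonneg (d - a) (b := n) (by exact_mod_cast hn)
    have h1 := Int.emod_lt_of_pos (d - a) (b := n) (by omega)
    have h2 : edgeNormal n d = edgeNormal n (a + (d - a) % n) := by
      apply edgeNormal_eq_of_dvd hn
      refine ⟨(d - a) / n, ?_⟩
      have := Int.emod_add_mul_ediv (d - a) n
      linarith
    refine ⟨(d - a) % n, lt_of_le_of_ne h0 fun h => hd ?_, h1, h2⟩
    rw [h2, ← h, add_zero]
  obtain ⟨p, hp0, hpn, hp⟩ := hred b hab.symm
  obtain ⟨s, hs0, hsn, hs⟩ := hred c hca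
  rcases lt_trichotomy p s with h | h | h
  · refine ⟨p, s - p, n - s, hp0, by omega, by omega, by ring, Or.inl ⟨hp, ?_⟩⟩
    rw [hs]; congr 1; ring
  · exact absurd (hp.trans (h ▸ hs.symm)) hbc
  · refine ⟨s, p - s, n - p, hs0, by omega, by omega, by ring, Or.inr ⟨hs, ?_⟩⟩
    rw [hp]; congr 1; ring

theorem perimeter_cyclic_bound {n : ℕ} (hn : n ≠ 0) {a k₁ k₂ k₃ : ℤ} {x y z : ℂ}
    (hsum : k₁ + k₂ + k₃ = n) (hx : inner ℝ (edgeNormal n a) x = apothem n)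
    (hy : inner ℝ (edgeNormal n (a + k₁)) y = apothem n)
    (hz : inner ℝ (edgeNormal n (a + k₁ + k₂)) z = apothem n) :
    2 * apothem n * (Real.sin (2 * Real.pi * k₁ / n) + Real.sin (2 * Real.pi * k₂ / n)
      + Real.sin (2 * Real.pi * k₃ / n)) ≤ perimeter x y z := by
  have h := (perimeter_altitude_bound hx hy hz).1
  have hn0 : (n : ℝ) ≠ 0 := by exact_mod_cast hn
  have e1 : Real.sin (2 * Real.pi * (((a + k₁ + k₂ : ℤ) : ℝ) - (a + k₁ : ℤ)) / n)
      = Real.sin (2 * Real.pi * k₂ / n) := by push_cast; congr 1; ring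
  have e2 : Real.sin (2 * Real.pi * (a - ((a + k₁ + k₂ : ℤ) : ℝ)) / n)
      = Real.sin (2 * Real.pi * k₃ / n) := by
    have : (k₁ : ℝ) + k₂ + k₃ = n := by exact_mod_cast hsum
    rw [← Real.sin_add_two_pi]
    congr 1
    field_simp
    push_cast
    linarith
  have e3 : Real.sin (2 * Real.pi * (((a + k₁ : ℤ) : ℝ) - a) / n)
      = Real.sin (2 * Real.pi * k₁ / n) := by push_cast; congr 1; ring
  rw [e1, e2, e3] at h
  linarith

/-- Three edge lines that form an acute triangle do not contribute to the minimal orbits if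
`n ≥ 4`. -/
theorem lt_perimeter_of_acute {n : ℕ} (hn : 4 ≤ n) {a b c : ℤ} {x y z : ℂ}
    (hab : inner ℝ (edgeNormal n a) (edgeNormal n b) < 0)
    (hbc : inner ℝ (edgeNormal n b) (edgeNormal n c) < 0)
    (hca : inner ℝ (edgeNormal n c) (edgeNormal n a) < 0)
    (hx : inner ℝ (edgeNormal n a) x = apothem n) (hy : inner ℝ (edgeNormal n b) y = apothem n)
    (hz : inner ℝ (edgeNormal n c) z = apothem n) :
    2 * (1 + apothem n) < perimeter x y z := by
  have hne : ∀ d e : ℤ, inner ℝ (edgeNormal n d) (edgeNormal n e) < 0 →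
      edgeNormal n d ≠ edgeNormal n e := by
    intro d e h heq
    rw [heq, inner_edgeNormal_self] at h
    linarith
  have hn0 : (n : ℝ) ≠ 0 := by positivity
  obtain ⟨k₁, k₂, k₃, p₁, p₂, p₃, hsum, h⟩ :=
    exists_cyclic_order (by omega) (hne a b hab) (hne b c hbc) (hne c a hca)
  have c1 : inner ℝ (edgeNormal n (a + k₁)) (edgeNormal n a) = Real.cos (2 * Real.pi * k₁ / n) := by
    rw [inner_edgeNormal]; push_cast; congr 1; ring
  have c2 : inner ℝ (edgeNormal n (a + k₁ + k₂)) (edgeNormal n (a + k₁))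
      = Real.cos (2 * Real.pi * k₂ / n) := by
    rw [inner_edgeNormal]; push_cast; congr 1; ring
  have c3 : inner ℝ (edgeNormal n a) (edgeNormal n (a + k₁ + k₂))
      = Real.cos (2 * Real.pi * k₃ / n) := by
    have : (k₁ : ℝ) + k₂ + k₃ = n := by exact_mod_cast hsum
    rw [inner_edgeNormal, ← Real.cos_add_two_pi]
    congr 1
    field_simp
    push_cast
    linarith
  rcases h with ⟨h1, h2⟩ | ⟨h1, h2⟩
  · rw [h1] at hab hbc hy
    rw [h2] at hbc hca hz
    rw [real_inner_comm] at hab hbc hca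
    have hb := perimeter_cyclic_bound (by omega) hsum hx hy hz
    have := one_lt_apothem_mul hn p₁ p₂ p₃ hsum (c1 ▸ hab) (c2 ▸ hbc) (c3 ▸ hca)
    linarith
  · rw [h1] at hbc hca hz
    rw [h2] at hab hbc hy
    have hb := perimeter_cyclic_bound (by omega) hsum hx hz hy
    rw [← perimeter_rotate, perimeter_swap, perimeter_rotate] at hb
    have := one_lt_apothem_mul hn p₁ p₂ p₃ hsum (c1 ▸ hca) (c2 ▸ hbc) (c3 ▸ hab)
    linarith

/-! ### Lower bounds for the length of a closed orbit -/

theorem neg_eq_of_combination {n : ℕ} {a b c : ℤ} {α β γ : ℝ} (hα : 0 < α)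
    (h : α • edgeNormal n a + β • edgeNormal n b + γ • edgeNormal n c = 0) :
    -edgeNormal n a = (β / α) • edgeNormal n b + (γ / α) • edgeNormal n c := by
  have h1 : α⁻¹ • (α • edgeNormal n a + β • edgeNormal n b + γ • edgeNormal n c) = 0 := by
    rw [h, smul_zero]
  simp only [smul_add, smul_smul, inv_mul_cancel₀ hα.ne', one_smul] at h1
  rw [neg_eq_iff_add_eq_zero, ← add_assoc, div_eq_inv_mul, div_eq_inv_mul]
  exact h1

theorem four_apothem_lt_perimeter {n : ℕ} (hn : 4 ≤ n) {a b c : ℤ} {x y z : ℂ} {α β γ : ℝ}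
    (hα : 0 < α) (hβ : 0 < β) (hγ : 0 < γ) (hab : edgeNormal n a ≠ edgeNormal n b)
    (hbc : edgeNormal n b ≠ edgeNormal n c) (hca : edgeNormal n c ≠ edgeNormal n a)
    (hcomb : α • edgeNormal n a + β • edgeNormal n b + γ • edgeNormal n c = 0)
    (hx : inner ℝ (edgeNormal n a) x = apothem n) (hy : inner ℝ (edgeNormal n b) y = apothem n)
    (hz : inner ℝ (edgeNormal n c) z = apothem n) :
    4 * apothem n < perimeter x y z := by
  rcases le_or_gt 0 (inner ℝ (edgeNormal n b) (edgeNormal n c)) with h1 | h1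
  · exact four_apothem_lt_perimeter_of_nonacute (by omega) (div_pos hβ hα) (div_pos hγ hα)
      (neg_eq_of_combination hα hcomb) h1 hbc hx hy hz
  rcases le_or_gt 0 (inner ℝ (edgeNormal n c) (edgeNormal n a)) with h2 | h2
  · rw [← perimeter_rotate]
    exact four_apothem_lt_perimeter_of_nonacute (by omega) (div_pos hγ hβ) (div_pos hα hβ)
      (neg_eq_of_combination hβ (by rw [← hcomb]; abel)) h2 hca hy hz hx
  rcases le_or_gt 0 (inner ℝ (edgeNormal n a) (edgeNormal n b)) with h3 | h3
  · rw [← perimeter_rotate, ← perimeter_rotate]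
    exact four_apothem_lt_perimeter_of_nonacute (by omega) (div_pos hα hγ) (div_pos hβ hγ)
      (neg_eq_of_combination hγ (by rw [← hcomb]; abel)) h3 hab hz hx hy
  · have := lt_perimeter_of_acute hn h3 h1 h2 hx hy hz
    linarith [apothem_lt_one (n := n) (by omega)]

theorem triangleTrace_self_right (x y : ℂ) : triangleTrace x y y = segment ℝ x y := by
  rw [triangleTrace, segment_same, segment_symm ℝ y x, Set.union_right_comm, Set.union_self,
    Set.union_singleton, Set.insert_eq_of_mem (right_mem_segment ℝ x y)]

theorem neg_edgeNormal_eq_dir {n : ℕ} (hn : Odd n) (a : ℤ) :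
    -edgeNormal n a = dir n (2 * (a + (n + 1) / 2 : ℤ)) := by
  obtain ⟨p, rfl⟩ := hn
  have h : (((2 * p + 1 : ℕ) : ℤ) + 1) / 2 = p + 1 := by omega
  rw [h, edgeNormal, ← dir_add_period (by omega)]
  congr 1
  push_cast
  ring

theorem perimeter_bound_of_odd {n : ℕ} (hn : 4 ≤ n) (hodd : Odd n) {a b c : ℤ} {x y z : ℂ}
    {α β γ : ℝ} (hα : 0 < α) (hβ : 0 < β) (hγ : 0 < γ) (hab : edgeNormal n a ≠ edgeNormal n b)
    (hbc : edgeNormal n b ≠ edgeNormal n c) (hca : edgeNormal n c ≠ edgeNormal n a)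
    (hcomb : α • edgeNormal n a + β • edgeNormal n b + γ • edgeNormal n c = 0)
    (hx : inner ℝ (edgeNormal n a) x = apothem n) (hy : inner ℝ (edgeNormal n b) y = apothem n)
    (hz : inner ℝ (edgeNormal n c) z = apothem n) (hx1 : ‖x‖ ≤ 1) (hy1 : ‖y‖ ≤ 1)
    (hz1 : ‖z‖ ≤ 1) :
    2 * (1 + apothem n) ≤ perimeter x y z ∧
      (perimeter x y z = 2 * (1 + apothem n) → ∃ a : ℤ,
        triangleTrace x y z = segment ℝ (apothem n • edgeNormal n a) (-edgeNormal n a)) := by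
  have hmem : ∀ a : ℤ, -edgeNormal n a ∈ regularPolygon n := fun a => by
    rw [neg_edgeNormal_eq_dir hodd]
    exact dir_even_mem_regularPolygon (by omega) _
  rcases le_or_gt 0 (inner ℝ (edgeNormal n b) (edgeNormal n c)) with h1 | h1
  · obtain ⟨e1, e2⟩ := perimeter_nonacute_bound_of_odd (by omega) (div_pos hβ hα) (div_pos hγ hα)
      (neg_eq_of_combination hα hcomb) h1 hbc (hmem a) hx hy hz hz1
    refine ⟨e1, fun h => ⟨a, ?_⟩⟩
    obtain ⟨rfl, rfl, rfl⟩ := e2 h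
    exact triangleTrace_self_right _ _
  rcases le_or_gt 0 (inner ℝ (edgeNormal n c) (edgeNormal n a)) with h2 | h2
  · rw [← perimeter_rotate, ← triangleTrace_rotate]
    obtain ⟨e1, e2⟩ := perimeter_nonacute_bound_of_odd (by omega) (div_pos hγ hβ) (div_pos hα hβ)
      (neg_eq_of_combination hβ (by rw [← hcomb]; abel)) h2 hca (hmem b) hy hz hx hx1
    refine ⟨e1, fun h => ⟨b, ?_⟩⟩
    obtain ⟨rfl, rfl, rfl⟩ := e2 h
    exact triangleTrace_self_right _ _
  rcases le_or_gt 0 (inner ℝ (edgeNormal n a) (edgeNormal n b)) with h3 | h3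
  · rw [← perimeter_rotate, ← perimeter_rotate, ← triangleTrace_rotate, ← triangleTrace_rotate]
    obtain ⟨e1, e2⟩ := perimeter_nonacute_bound_of_odd (by omega) (div_pos hα hγ) (div_pos hβ hγ)
      (neg_eq_of_combination hγ (by rw [← hcomb]; abel)) h3 hab (hmem c) hz hx hy hy1
    refine ⟨e1, fun h => ⟨c, ?_⟩⟩
    obtain ⟨rfl, rfl, rfl⟩ := e2 h
    exact triangleTrace_self_right _ _
  · have := lt_perimeter_of_acute hn h3 h1 h2 hx hy hz
    exact ⟨this.le, fun h => absurd h this.ne'⟩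

theorem not_parallel_of_odd {n : ℕ} (hodd : Odd n) (a b : ℤ) :
    edgeNormal n b ≠ -edgeNormal n a := by
  obtain ⟨p, rfl⟩ := hodd
  intro h
  have h1 := dir_intCast_eq_iff (n := 2 * p + 1) (by omega) (2 * b + 1)
    (2 * (a + ((2 * p + 1 : ℕ) + 1) / 2))
  rw [neg_edgeNormal_eq_dir ⟨p, rfl⟩, edgeNormal] at h
  push_cast at h1 h
  obtain ⟨k, hk⟩ := h1.mp h
  rw [mul_assoc] at hk
  omega

theorem orbitLength_bound_of_even {n : ℕ} (hn : 4 ≤ n) {q : ℤ → ℂ}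
    (hq : q ∈ closedOrbits (regularPolygon n)) :
    4 * apothem n ≤ orbitLength q ∧ (orbitLength q = 4 * apothem n →
      ∃ (a : ℤ) (x y : ℂ), x ∈ regularPolygon n ∧ y ∈ regularPolygon n ∧
        inner ℝ (edgeNormal n a) x = apothem n ∧
        y - x = -((2 * apothem n) • edgeNormal n a) ∧ trace q = segment ℝ x y) := by
  have hT : ∀ i, q i ∈ regularPolygon n := fun i =>
    ((mem_frontier_iff (by omega)).mp (hq.1 i).1).1
  rcases exists_touched_pair_or_triple (by omega) hq with
    ⟨a, b, i, j, hab, hi, hj⟩ | ⟨a, b, c, i, j, k, hab, hbc, hca, hi, hj, hk, α, β, γ, hα, hβ,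
      hγ, hcomb⟩
  · obtain ⟨e1, e2⟩ := perimeter_pair_bound hab hi hj
    obtain ⟨e3, e4⟩ := perimeter_le_orbitLength hq.2 i j j
    refine ⟨e1.trans e3, fun h => ⟨a, q i, q j, hT i, hT j, hi, e2 (by linarith), ?_⟩⟩
    rw [e4 (by linarith), triangleTrace_self_right]
  · have e1 := four_apothem_lt_perimeter hn hα hβ hγ hab hbc hca hcomb hi hj hk
    have e2 := (perimeter_le_orbitLength hq.2 i j k).1
    exact ⟨by linarith, fun h => by linarith⟩

theorem orbitLength_bound_of_odd {n : ℕ} (hn : 4 ≤ n) (hodd : Odd n) {q : ℤ → ℂ}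
    (hq : q ∈ closedOrbits (regularPolygon n)) :
    2 * (1 + apothem n) ≤ orbitLength q ∧ (orbitLength q = 2 * (1 + apothem n) →
      ∃ a : ℤ, trace q = segment ℝ (apothem n • edgeNormal n a) (-edgeNormal n a)) := by
  have hT : ∀ i, ‖q i‖ ≤ 1 := fun i =>
    norm_le_one_of_mem_regularPolygon ((mem_frontier_iff (n := n) (by omega)).mp (hq.1 i).1).1
  rcases exists_touched_pair_or_triple (by omega) hq with
    ⟨a, b, i, j, hab, hi, hj⟩ | ⟨a, b, c, i, j, k, hab, hbc, hca, hi, hj, hk, α, β, γ, hα, hβ,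
      hγ, hcomb⟩
  · exact absurd hab (not_parallel_of_odd hodd a b)
  · obtain ⟨e1, e2⟩ := perimeter_bound_of_odd hn hodd hα hβ hγ hab hbc hca hcomb hi hj hk
      (hT i) (hT j) (hT k)
    obtain ⟨e3, e4⟩ := perimeter_le_orbitLength hq.2 i j k
    refine ⟨e1.trans e3, fun h => ?_⟩
    obtain ⟨a', ha'⟩ := e2 (by linarith)
    exact ⟨a', by rw [e4 (by linarith), ha']⟩

theorem apothem_three : apothem 3 = 1 / 2 := by
  rw [apothem, Nat.cast_ofNat, Real.cos_pi_div_three]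

theorem sin_two_pi_div_three : Real.sin (2 * Real.pi / 3) = Real.sqrt 3 / 2 := by
  rw [← Real.sin_pi_div_three, ← Real.sin_pi_sub]
  congr 1
  ring

theorem cos_two_pi_div_three : Real.cos (2 * Real.pi / 3) = -(1 / 2) := by
  rw [← Real.cos_pi_div_three, ← Real.cos_pi_sub]
  congr 1
  ring

theorem sin_four_pi_div_three : Real.sin (2 * Real.pi * 2 / 3) = -(Real.sqrt 3 / 2) := by
  rw [← Real.sin_pi_div_three, ← Real.sin_add_pi]
  congr 1
  ring

theorem cos_four_pi_div_three : Real.cos (2 * Real.pi * 2 / 3) = -(1 / 2) := by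
  rw [← Real.cos_pi_div_three, ← Real.cos_add_pi]
  congr 1
  ring

theorem perimeter_bound_triangle {a : ℤ} {x y z : ℂ}
    (hx : inner ℝ (edgeNormal 3 a) x = apothem 3)
    (hy : inner ℝ (edgeNormal 3 (a + 1)) y = apothem 3)
    (hz : inner ℝ (edgeNormal 3 (a + 2)) z = apothem 3) :
    3 * Real.sqrt 3 / 2 ≤ perimeter x y z ∧ (perimeter x y z = 3 * Real.sqrt 3 / 2 →
      x = apothem 3 • edgeNormal 3 a ∧ y = apothem 3 • edgeNormal 3 (a + 1) ∧
        z = apothem 3 • edgeNormal 3 (a + 2)) := by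
  obtain ⟨h1, h2⟩ := perimeter_altitude_bound hx hy hz
  have r1 : ∀ s : ℝ, s + 2 - (s + 1) = 1 := fun s => by ring
  have r2 : ∀ s : ℝ, s - (s + 2) = -2 := fun s => by ring
  have s3 : Real.sin (2 * Real.pi * -2 / 3) = Real.sqrt 3 / 2 := by
    rw [mul_neg, neg_div, Real.sin_neg, sin_four_pi_div_three, neg_neg]
  have c3 : Real.cos (2 * Real.pi * -2 / 3) = -(1 / 2) := by
    rw [mul_neg, neg_div, Real.cos_neg, cos_four_pi_div_three]
  have hval : 2 * apothem 3 * (Real.sin (2 * Real.pi * (((a + 2 : ℤ) : ℝ) - (a + 1 : ℤ)) / (3 : ℕ))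
      + Real.sin (2 * Real.pi * (a - (a + 2 : ℤ)) / (3 : ℕ))
      + Real.sin (2 * Real.pi * ((a + 1 : ℤ) - a) / (3 : ℕ))) = 3 * Real.sqrt 3 / 2 := by
    push_cast
    rw [r1, r2, add_sub_cancel_left, mul_one, sin_two_pi_div_three, s3, apothem_three]
    ring
  rw [hval] at h1 h2
  refine ⟨h1, fun h => ?_⟩
  obtain ⟨e1, e2, e3⟩ := h2 h
  obtain ⟨tx, hx'⟩ := exists_eq_of_inner_edgeNormal hx
  obtain ⟨ty, hy'⟩ := exists_eq_of_inner_edgeNormal hy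
  obtain ⟨tz, hz'⟩ := exists_eq_of_inner_edgeNormal hz
  have oz := offset_mul_sin hx' hy' hz' e1 e2 e3
  have ox := offset_mul_sin hy' hz' hx' e2 e3 e1
  have oy := offset_mul_sin hz' hx' hy' e3 e1 e2
  have hs : Real.sqrt 3 / 2 ≠ 0 := by positivity
  push_cast at ox oy oz
  simp only [r1, r2, add_sub_cancel_left, mul_one, sin_two_pi_div_three,
    cos_two_pi_div_three, s3, c3, sub_self, mul_zero, mul_eq_zero, hs, or_false] at ox oy oz
  have hfin : ∀ d : ℤ, edgeNormal 3 d * ((apothem 3 : ℂ) + ((0 : ℝ) : ℂ) * Complex.I) =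
      apothem 3 • edgeNormal 3 d := fun d => by
    rw [Complex.real_smul, Complex.ofReal_zero, zero_mul, add_zero, mul_comm]
  rw [hx', hy', hz', ox, oy, oz]
  exact ⟨hfin _, hfin _, hfin _⟩

theorem orbitLength_bound_triangle {q : ℤ → ℂ} (hq : q ∈ closedOrbits (regularPolygon 3)) :
    3 * Real.sqrt 3 / 2 ≤ orbitLength q ∧ (orbitLength q = 3 * Real.sqrt 3 / 2 →
      ∃ a : ℤ, trace q = triangleTrace (apothem 3 • edgeNormal 3 a)
        (apothem 3 • edgeNormal 3 (a + 1)) (apothem 3 • edgeNormal 3 (a + 2))) := by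
  rcases exists_touched_pair_or_triple le_rfl hq with
    ⟨a, b, i, j, hab, hi, hj⟩ | ⟨a, b, c, i, j, k, hab, hbc, hca, hi, hj, hk, -⟩
  · exact absurd hab (not_parallel_of_odd (by decide) a b)
  · obtain ⟨k₁, k₂, k₃, p₁, p₂, p₃, hsum, h⟩ := exists_cyclic_order (by omega) hab hbc hca
    obtain rfl : k₁ = 1 := by omega
    obtain rfl : k₂ = 1 := by omega
    rw [add_assoc, show (1 : ℤ) + 1 = 2 from rfl] at h
    have main : ∀ i j k : ℤ, inner ℝ (edgeNormal 3 a) (q i) = apothem 3 →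
        inner ℝ (edgeNormal 3 (a + 1)) (q j) = apothem 3 →
        inner ℝ (edgeNormal 3 (a + 2)) (q k) = apothem 3 →
        3 * Real.sqrt 3 / 2 ≤ orbitLength q ∧ (orbitLength q = 3 * Real.sqrt 3 / 2 →
          ∃ a : ℤ, trace q = triangleTrace (apothem 3 • edgeNormal 3 a)
            (apothem 3 • edgeNormal 3 (a + 1)) (apothem 3 • edgeNormal 3 (a + 2))) := by
      intro i j k hi hj hk
      obtain ⟨e1, e2⟩ := perimeter_bound_triangle hi hj hk
      obtain ⟨e3, e4⟩ := perimeter_le_orbitLength hq.2 i j k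
      refine ⟨e1.trans e3, fun h => ⟨a, ?_⟩⟩
      obtain ⟨f1, f2, f3⟩ := e2 (by linarith)
      rw [e4 (by linarith), f1, f2, f3]
    rcases h with ⟨h1, h2⟩ | ⟨h1, h2⟩
    · exact main i j k hi (h1 ▸ hj) (h2 ▸ hk)
    · exact main i k j hi (h1 ▸ hk) (h2 ▸ hj)

/-! ### Orbits with two and three bounce points -/

section Bounces

variable {E : Type*} [NormedAddCommGroup E]

theorem IsOutwardSupport.smul [InnerProductSpace ℝ E] {T : Set E} {q ν : E}
    (h : IsOutwardSupport T q ν) {c : ℝ} (hc : 0 ≤ c) : IsOutwardSupport T q (c • ν) := by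
  intro x hx
  rw [inner_smul_right]
  exact mul_nonpos_of_nonneg_of_nonpos hc (h x hx)

theorem twoBounce_add_two {α : Type*} (x y : α) (i : ℤ) :
    twoBounce x y (i + 2) = twoBounce x y i := by
  simp [twoBounce]

theorem twoBounce_even {α : Type*} (x y : α) {i : ℤ} (h : i % 2 = 0) : twoBounce x y i = x := by
  simp [twoBounce, h]

theorem twoBounce_odd {α : Type*} (x y : α) {i : ℤ} (h : i % 2 ≠ 0) : twoBounce x y i = y := by
  simp [twoBounce, h]

theorem two_mem_periods_twoBounce {α : Type*} (x y : α) : 2 ∈ periods (twoBounce x y) :=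
  ⟨le_rfl, fun i => twoBounce_add_two x y i⟩

theorem bounceNumber_twoBounce {α : Type*} (x y : α) : bounceNumber (twoBounce x y) = 2 :=
  le_antisymm (Nat.sInf_le (two_mem_periods_twoBounce x y))
    (bounceNumber_mem_periods ⟨2, two_mem_periods_twoBounce x y⟩).1

theorem orbitLength_twoBounce (x y : E) : orbitLength (twoBounce x y) = 2 * ‖y - x‖ := by
  rw [orbitLength, bounceNumber_twoBounce, Finset.sum_range_succ, Finset.sum_range_one]
  simp [twoBounce, norm_sub_rev x y]
  ring

theorem trace_twoBounce [InnerProductSpace ℝ E] (x y : E) :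
    trace (twoBounce x y) = segment ℝ x y := by
  apply Set.Subset.antisymm
  · refine Set.iUnion_subset fun i => ?_
    rcases Int.emod_two_eq_zero_or_one i with h | h
    · rw [twoBounce_even x y h, twoBounce_odd x y (by omega)]
    · rw [twoBounce_odd x y (by omega), twoBounce_even x y (by omega), segment_symm]
  · intro z hz
    refine Set.mem_iUnion.mpr ⟨0, ?_⟩
    rwa [twoBounce_even x y (by rfl), twoBounce_odd x y (by decide)]

theorem twoBounce_mem_bounceOrbits [InnerProductSpace ℝ E] {T : Set E} {x y : E} (hne : x ≠ y)
    (hx : x ∈ frontier T)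
    (hy : y ∈ frontier T) (hsx : IsOutwardSupport T x (x - y))
    (hsy : IsOutwardSupport T y (y - x)) : twoBounce x y ∈ bounceOrbits T 2 := by
  refine ⟨⟨fun i => ?_, 2, two_mem_periods_twoBounce x y⟩, bounceNumber_twoBounce x y⟩
  unfold bounceVector
  rcases Int.emod_two_eq_zero_or_one i with h | h
  · rw [twoBounce_even x y h, twoBounce_odd x y (i := i + 1) (by omega),
      twoBounce_odd x y (i := i - 1) (by omega), ← add_smul]
    exact ⟨hx, hne, hsx.smul (by positivity)⟩
  · rw [twoBounce_odd x y (i := i) (by omega), twoBounce_even x y (i := i + 1) (by omega),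
      twoBounce_even x y (i := i - 1) (by omega), ← add_smul]
    exact ⟨hy, hne.symm, hsy.smul (by positivity)⟩

theorem orbitLength_of_bounceNumber_eq_three {q : ℤ → E} (h : bounceNumber q = 3)
    (hq : 3 ∈ periods q) : orbitLength q = perimeter (q 0) (q 1) (q 2) := by
  have h3 : q 3 = q 0 := hq.2 0
  rw [orbitLength, h, Finset.sum_range_succ, Finset.sum_range_succ, Finset.sum_range_one, perimeter]
  norm_num
  rw [h3]

theorem trace_of_three_mem_periods [InnerProductSpace ℝ E] {q : ℤ → E} (hq : 3 ∈ periods q) :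
    trace q = triangleTrace (q 0) (q 1) (q 2) := by
  have h3 : q 3 = q 0 := hq.2 0
  rw [← pathTrace_eq_trace three_ne_zero hq.2 0, pathTrace_succ, pathTrace_succ, pathTrace_succ,
    triangleTrace]
  simp [pathTrace]
  rw [h3]

theorem three_mem_periods_threeBounce {α : Type*} (x y z : α) : 3 ∈ periods (threeBounce x y z) :=
  ⟨by norm_num, fun i => by simp [threeBounce]⟩

theorem bounceNumber_threeBounce {α : Type*} {x y z : α} (hzx : z ≠ x) :
    bounceNumber (threeBounce x y z) = 3 := by
  have hne : (periods (threeBounce x y z)).Nonempty := ⟨3, three_mem_periods_threeBounce x y z⟩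
  have h1 := bounceNumber_mem_periods hne
  refine le_antisymm (Nat.sInf_le (three_mem_periods_threeBounce x y z)) ?_
  by_contra! h
  have h2 : bounceNumber (threeBounce x y z) = 2 := le_antisymm (by omega) h1.1
  rw [h2] at h1
  exact hzx (by simpa [threeBounce] using h1.2 0)

theorem trace_threeBounce [InnerProductSpace ℝ E] (x y z : E) :
    trace (threeBounce x y z) = triangleTrace x y z := by
  rw [trace_of_three_mem_periods (three_mem_periods_threeBounce x y z)]
  simp [threeBounce]

theorem threeBounce_mem_bounceOrbits [InnerProductSpace ℝ E] {T : Set E} {x y z : E} (hxy : x ≠ y)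
    (hyz : y ≠ z)
    (hzx : z ≠ x) (hx : x ∈ frontier T) (hy : y ∈ frontier T) (hz : z ∈ frontier T)
    (hsx : IsOutwardSupport T x (‖x - z‖⁻¹ • (x - z) + ‖x - y‖⁻¹ • (x - y)))
    (hsy : IsOutwardSupport T y (‖y - x‖⁻¹ • (y - x) + ‖y - z‖⁻¹ • (y - z)))
    (hsz : IsOutwardSupport T z (‖z - y‖⁻¹ • (z - y) + ‖z - x‖⁻¹ • (z - x))) :
    threeBounce x y z ∈ bounceOrbits T 3 := by
  refine ⟨⟨fun i => ?_, 3, three_mem_periods_threeBounce x y z⟩, bounceNumber_threeBounce hzx⟩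
  unfold bounceVector
  have h : i % 3 = 0 ∨ i % 3 = 1 ∨ i % 3 = 2 := by omega
  rcases h with h | h | h
  · have h1 : (i + 1) % 3 = 1 := by omega
    have h2 : (i - 1) % 3 = 2 := by omega
    simp only [threeBounce, h, h1, h2, if_true]
    norm_num
    exact ⟨hx, hxy, hsx⟩
  · have h1 : (i + 1) % 3 = 2 := by omega
    have h2 : (i - 1) % 3 = 0 := by omega
    simp only [threeBounce, h, h1, h2, if_true]
    norm_num
    exact ⟨hy, hyz, hsy⟩
  · have h1 : (i + 1) % 3 = 0 := by omega
    have h2 : (i - 1) % 3 = 1 := by omega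
    simp only [threeBounce, h, h1, h2, if_true]
    norm_num
    exact ⟨hz, hzx, hsz⟩

end Bounces

/-! ### The orbits between a vertex and the midpoint of the opposite edge -/

theorem edgeMidpoint_opposite {n : ℕ} (hodd : Odd n) (j : ℕ) :
    edgeMidpoint n (j + (n - 1) / 2) = -(apothem n • vertex n j) := by
  obtain ⟨p, rfl⟩ := hodd
  have h : (2 * p + 1 - 1) / 2 = p := by omega
  rw [edgeMidpoint_eq, vertex_eq_dir, ← smul_neg, ← dir_add_period (by omega), edgeNormal, h]
  congr 2
  push_cast
  ring

theorem inner_edgeNormal_vertex (n j : ℕ) : inner ℝ (edgeNormal n j) (vertex n j) = apothem n := by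
  rw [vertex_eq_edge_left, inner_edgeNormal_mul_self]

theorem norm_vertex (n j : ℕ) : ‖vertex n j‖ = 1 := by rw [vertex_eq_dir, norm_dir]

theorem edgeMidpoint_mem_frontier {n : ℕ} (hn : 3 ≤ n) (j : ℕ) :
    edgeMidpoint n j ∈ frontier (regularPolygon n) :=
  (isSmoothPoint_edgeMidpoint hn j).1

theorem vertex_mem_frontier {n : ℕ} (hn : 3 ≤ n) (j : ℕ) :
    vertex n j ∈ frontier (regularPolygon n) :=
  (mem_frontier_iff hn).mpr ⟨vertex_mem_regularPolygon n j, j, inner_edgeNormal_vertex n j⟩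

theorem isOutwardSupport_vertex (n j : ℕ) :
    IsOutwardSupport (regularPolygon n) (vertex n j) (vertex n j) := by
  intro x hx
  rw [inner_sub_left, real_inner_self_eq_norm_sq, norm_vertex]
  have := real_inner_le_norm x (vertex n j)
  rw [norm_vertex] at this
  linarith [norm_le_one_of_mem_regularPolygon hx]

theorem vertexOrbit_mem_bounceOrbits {n : ℕ} (hn : 3 ≤ n) (hodd : Odd n) (j : ℕ) :
    vertexOrbit n j ∈ bounceOrbits (regularPolygon n) 2 := by
  have hr := apothem_pos hn
  have hv : vertex n j ≠ 0 := by rw [← norm_ne_zero_iff, norm_vertex]; exact one_ne_zero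
  have hm := edgeMidpoint_opposite hodd j
  have hxy : vertex n j - edgeMidpoint n (j + (n - 1) / 2) = (1 + apothem n) • vertex n j := by
    rw [hm, add_smul, one_smul, sub_neg_eq_add]
  refine twoBounce_mem_bounceOrbits ?_ (vertex_mem_frontier hn j)
    (edgeMidpoint_mem_frontier hn _) ?_ ?_
  · rw [← sub_ne_zero, hxy]
    exact smul_ne_zero (by linarith) hv
  · rw [hxy]
    exact (isOutwardSupport_vertex n j).smul (by linarith)
  · have h1 : vertex n j = -edgeNormal n (j + (n - 1) / 2 : ℕ) := by
      have h2 : apothem n • (vertex n j + edgeNormal n (j + (n - 1) / 2 : ℕ)) = 0 := by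
        rw [smul_add, ← edgeMidpoint_eq, hm, add_neg_cancel]
      exact eq_neg_of_add_eq_zero_left ((smul_eq_zero.mp h2).resolve_left hr.ne')
    rw [← neg_sub, hxy, h1, smul_neg, neg_neg]
    exact isOutwardSupport_smul_edgeNormal hn (by linarith) (inner_edgeNormal_edgeMidpoint n _)

theorem orbitLength_vertexOrbit {n : ℕ} (hn : 3 ≤ n) (hodd : Odd n) (j : ℕ) :
    orbitLength (vertexOrbit n j) = 2 * (1 + apothem n) := by
  have hr := apothem_pos hn
  rw [vertexOrbit, orbitLength_twoBounce, edgeMidpoint_opposite hodd, ← neg_add', norm_neg]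
  have : apothem n • vertex n j + vertex n j = (1 + apothem n) • vertex n j := by
    rw [add_smul, one_smul, add_comm]
  rw [this, norm_smul, norm_vertex, Real.norm_of_nonneg (by linarith), mul_one]

theorem not_isSmoothPoint_vertex {n : ℕ} (hn : 3 ≤ n) (j : ℕ) :
    ¬ IsSmoothPoint (regularPolygon n) (vertex n j) := by
  intro h
  have h1 := inner_edgeNormal_dir_right n ((j : ℤ) - 1)
  rw [sub_add_cancel, Int.cast_natCast, ← vertex_eq_dir] at h1
  have h2 := (edgeNormal_eq_iff (by omega) _ _).mp
    (h.edgeNormal_eq hn (inner_edgeNormal_vertex n j) h1)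
  rw [sub_sub_cancel] at h2
  have := Int.le_of_dvd one_pos h2
  omega

theorem not_isRegularOrbit_vertexOrbit {n : ℕ} (hn : 3 ≤ n) (j : ℕ) :
    ¬ IsRegularOrbit (regularPolygon n) (vertexOrbit n j) := fun h =>
  not_isSmoothPoint_vertex hn j (h 0)

theorem vertex_eq_iff {n : ℕ} (hn : n ≠ 0) {i j : ℕ} (hi : i < n) (hj : j < n)
    (h : vertex n i = vertex n j) : i = j := by
  have h1 := dir_intCast_eq_iff hn (2 * i) (2 * j)
  rw [vertex_eq_dir, vertex_eq_dir] at h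
  push_cast at h1
  have h2 := h1.mp h
  rw [← mul_sub, mul_dvd_mul_iff_left two_ne_zero] at h2
  have h3 := Int.eq_zero_of_abs_lt_dvd h2 (by rw [abs_lt]; omega)
  omega

/-- The vertex is the only point of norm one on the trace. -/
theorem vertexOrbit_trace_injective {n : ℕ} (hn : 3 ≤ n) (hodd : Odd n) {i j : ℕ} (hi : i < n)
    (hj : j < n) (h : trace (vertexOrbit n i) = trace (vertexOrbit n j)) : i = j := by
  have hr := apothem_pos hn
  have hr1 := apothem_lt_one hn
  have hmem : vertex n i ∈ trace (vertexOrbit n j) := by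
    rw [← h, vertexOrbit, trace_twoBounce]
    exact left_mem_segment ℝ _ _
  rw [vertexOrbit, trace_twoBounce, edgeMidpoint_opposite hodd] at hmem
  obtain ⟨s, t, hs, ht, hst, he⟩ := hmem
  have h1 : (s - t * apothem n) • vertex n j = vertex n i := by
    rw [← he, sub_smul, smul_neg, smul_smul, sub_eq_add_neg]
  have h2 := congrArg norm h1
  rw [norm_smul, norm_vertex, norm_vertex, mul_one, Real.norm_eq_abs] at h2
  have ht0 : t = 0 := by
    rcases abs_choice (s - t * apothem n) with h3 | h3
    · nlinarith
    · nlinarith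
  rw [ht0, zero_mul, sub_zero, show s = 1 by linarith, one_smul] at h1
  exact (vertex_eq_iff (by omega) hj hi h1).symm

/-! ### The bands of orbits between opposite edges -/

theorem edgeNormal_opposite {n : ℕ} (hn : n ≠ 0) (heven : Even n) (a : ℤ) :
    edgeNormal n (a + (n / 2 : ℕ)) = -edgeNormal n a := by
  obtain ⟨p, rfl⟩ := heven
  have h : (p + p) / 2 = p := by omega
  rw [edgeNormal, edgeNormal, ← dir_add_period hn, h]
  congr 1
  push_cast
  ring

theorem vertex_succ_sub_vertex (n j : ℕ) :
    vertex n (j + 1) - vertex n j = (2 * halfSide n : ℝ) * (Complex.I * edgeNormal n j) := by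
  rw [vertex_succ_eq_edge_right, vertex_eq_edge_left]
  push_cast
  ring

theorem mem_band_iff {n : ℕ} (hn : 3 ≤ n) (heven : Even n) {j : ℕ} {q : ℤ → ℂ} :
    q ∈ band n j ↔ ∃ x ∈ regularPolygon n, ∃ y ∈ regularPolygon n,
      inner ℝ (edgeNormal n j) x = apothem n ∧
      y - x = -((2 * apothem n) • edgeNormal n j) ∧ q = twoBounce x y := by
  have hopp : edgeNormal n ((j + n / 2 : ℕ) : ℤ) = -edgeNormal n j := by
    rw [← edgeNormal_opposite (by omega) heven]
    push_cast
    rfl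
  have hs := halfSide_pos hn
  constructor
  · rintro ⟨x, hx, y, hy, hperp, rfl⟩
    obtain ⟨hx, hxj⟩ := (mem_edge_iff hn).mp hx
    obtain ⟨hy, hyj⟩ := (mem_edge_iff hn).mp hy
    rw [hopp, inner_neg_left] at hyj
    refine ⟨x, hx, y, hy, hxj, ?_, rfl⟩
    obtain ⟨t, rfl⟩ := exists_eq_of_inner_edgeNormal hxj
    obtain ⟨t', rfl⟩ := exists_eq_of_inner_edgeNormal (neg_eq_iff_eq_neg.mp hyj)
    have he := inner_edgeNormal_self n j
    rw [vertex_succ_sub_vertex, inner_eq] at hperp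
    rw [inner_eq] at he
    set e := edgeNormal n j
    simp at hperp
    have h0 : 2 * halfSide n * (t' - t) = 0 := by
      linear_combination hperp - 2 * halfSide n * (t' - t) * he
    have : t' = t := by
      have := (mul_eq_zero.mp h0).resolve_left (by positivity)
      linarith
    rw [this, Complex.real_smul]
    push_cast
    ring
  · rintro ⟨x, hx, y, hy, hxj, hyx, rfl⟩
    refine ⟨x, (mem_edge_iff hn).mpr ⟨hx, hxj⟩, y, (mem_edge_iff hn).mpr ⟨hy, ?_⟩, ?_, rfl⟩
    · have : y = x + (y - x) := by abel
      rw [hopp, inner_neg_left, this, hyx, inner_add_right, inner_neg_right, inner_smul_right,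
        inner_edgeNormal_self, hxj]
      ring
    · rw [hyx, vertex_succ_sub_vertex, inner_eq]
      simp
      ring

theorem band_nonempty {n : ℕ} (hn : 3 ≤ n) (heven : Even n) (j : ℕ) : (band n j).Nonempty := by
  refine ⟨_, (mem_band_iff hn heven).mpr ⟨edgeMidpoint n j, edgeMidpoint_mem_regularPolygon hn j,
    -edgeMidpoint n j, ?_, inner_edgeNormal_edgeMidpoint n j, ?_, rfl⟩⟩
  · apply mem_regularPolygon_of_norm_le hn
    rw [edgeMidpoint_eq, norm_neg, norm_smul, norm_edgeNormal, mul_one,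
      Real.norm_of_nonneg (apothem_pos hn).le]
  · rw [edgeMidpoint_eq, two_mul, add_smul]
    abel

theorem band_subset_bounceOrbits {n : ℕ} (hn : 3 ≤ n) (heven : Even n) (j : ℕ) :
    band n j ⊆ bounceOrbits (regularPolygon n) 2 := by
  intro q hq
  obtain ⟨x, hx, y, hy, hxj, hyx, rfl⟩ := (mem_band_iff hn heven).mp hq
  have hr := apothem_pos hn
  have hopp := edgeNormal_opposite (n := n) (by omega) heven j
  have hyj : inner ℝ (edgeNormal n (j + (n / 2 : ℕ))) y = apothem n := by
    have : y = x + (y - x) := by abel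
    rw [hopp, inner_neg_left, this, hyx, inner_add_right, inner_neg_right, inner_smul_right,
      inner_edgeNormal_self, hxj]
    ring
  refine twoBounce_mem_bounceOrbits ?_ ((mem_frontier_iff hn).mpr ⟨hx, j, hxj⟩)
    ((mem_frontier_iff hn).mpr ⟨hy, _, hyj⟩) ?_ ?_
  · rw [ne_comm, ← sub_ne_zero, hyx, neg_ne_zero]
    exact smul_ne_zero (by positivity) (dir_ne_zero n _)
  · rw [← neg_sub, hyx, neg_neg]
    exact isOutwardSupport_smul_edgeNormal hn (by positivity) hxj
  · rw [hyx, ← smul_neg, ← hopp]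
    exact isOutwardSupport_smul_edgeNormal hn (by positivity) hyj

theorem orbitLength_of_mem_band {n : ℕ} (hn : 3 ≤ n) (heven : Even n) {j : ℕ} {q : ℤ → ℂ}
    (hq : q ∈ band n j) : orbitLength q = 4 * apothem n := by
  obtain ⟨x, hx, y, hy, hxj, hyx, rfl⟩ := (mem_band_iff hn heven).mp hq
  have hr := apothem_pos hn
  rw [orbitLength_twoBounce, hyx, norm_neg, norm_smul, norm_edgeNormal,
    Real.norm_of_nonneg (by positivity)]
  ring

/-- A segment that joins two opposite edges orthogonally belongs to one of the `n / 2` bands. -/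
theorem exists_segment_eq_trace_band {n : ℕ} (hn : 3 ≤ n) (heven : Even n) {a : ℤ} {x y : ℂ}
    (hx : x ∈ regularPolygon n) (hy : y ∈ regularPolygon n)
    (hxa : inner ℝ (edgeNormal n a) x = apothem n)
    (hyx : y - x = -((2 * apothem n) • edgeNormal n a)) :
    ∃ j < n / 2, segment ℝ x y ∈ trace '' band n j := by
  have h0 := Int.emod_nonneg a (b := n) (by omega)
  have h1 := Int.emod_lt_of_pos a (b := n) (by omega)
  have h2 := edgeNormal_emod (n := n) (by omega) a
  obtain ⟨k, hk⟩ := Int.eq_ofNat_of_zero_le h0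
  rw [hk] at h1 h2
  rw [← h2] at hxa hyx
  rcases lt_or_ge k (n / 2) with h | h
  · exact ⟨k, h, _, (mem_band_iff hn heven).mpr ⟨x, hx, y, hy, hxa, hyx, rfl⟩,
      trace_twoBounce x y⟩
  · -- the edge has an opposite edge with a smaller index
    have h3 : edgeNormal n k = -edgeNormal n (k - n / 2 : ℕ) := by
      rw [← edgeNormal_opposite (by omega) heven]
      congr 1
      omega
    have hyk : inner ℝ (edgeNormal n k) y = -apothem n := by
      have : y = x + (y - x) := by abel
      rw [this, hyx, inner_add_right, inner_neg_right, inner_smul_right, inner_edgeNormal_self, hxa]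
      ring
    rw [h3, inner_neg_left, neg_inj] at hyk
    have h4 : k - n / 2 < n / 2 := by
      obtain ⟨p, rfl⟩ := heven
      omega
    refine ⟨k - n / 2, h4, _, (mem_band_iff hn heven).mpr ⟨y, hy, x, hx, hyk, ?_, rfl⟩, ?_⟩
    · rw [← neg_sub, hyx, neg_neg, h3, smul_neg]
    · rw [trace_twoBounce, segment_symm]

/-- The segments of different bands have different directions. -/
theorem disjoint_trace_band {n : ℕ} (hn : 3 ≤ n) (heven : Even n) {i j : ℕ} (hi : i < n / 2)
    (hj : j < n / 2) (hij : i ≠ j) : Disjoint (trace '' band n i) (trace '' band n j) := by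
  rw [Set.disjoint_left]
  rintro _ ⟨q, hq, rfl⟩ ⟨q', hq', htr⟩
  obtain ⟨x, hx, y, hy, hxi, hyx, rfl⟩ := (mem_band_iff hn heven).mp hq
  obtain ⟨x', hx', y', hy', hxj, hyx', rfl⟩ := (mem_band_iff hn heven).mp hq'
  have hr := apothem_pos hn
  rw [trace_twoBounce, trace_twoBounce] at htr
  -- both segments have the same direction up to sign
  have hdir : ∀ w ∈ segment ℝ x y, ∃ s : ℝ, w = x' + s • edgeNormal n j := by
    intro w hw
    rw [← htr, segment_eq_image'] at hw
    obtain ⟨t, -, rfl⟩ := hw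
    exact ⟨-(t * (2 * apothem n)), by simp only [hyx', smul_neg, smul_smul, neg_smul]⟩
  obtain ⟨s, hs⟩ := hdir x (left_mem_segment ℝ _ _)
  obtain ⟨t, ht⟩ := hdir y (right_mem_segment ℝ _ _)
  have h1 : (2 * apothem n) • edgeNormal n i = (s - t) • edgeNormal n j := by
    rw [← neg_neg ((2 * apothem n) • edgeNormal n i), ← hyx, hs, ht, sub_smul]
    abel
  have h2 : edgeNormal n i = ((2 * apothem n)⁻¹ * (s - t)) • edgeNormal n j := by
    rw [mul_smul, ← h1, smul_smul, inv_mul_cancel₀ (by positivity), one_smul]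
  set c := (2 * apothem n)⁻¹ * (s - t)
  have h3 := congrArg norm h2
  rw [norm_smul, norm_edgeNormal, norm_edgeNormal, mul_one, Real.norm_eq_abs] at h3
  have hcases : edgeNormal n i = edgeNormal n j ∨
    edgeNormal n i = edgeNormal n (j + (n / 2 : ℕ)) := by
    rcases (abs_eq zero_le_one).mp h3.symm with h | h
    · left; rw [h2, h, one_smul]
    · right; rw [edgeNormal_opposite (by omega) heven, h2, h, neg_smul, one_smul]
  rcases hcases with h | h
  · have h4 := Int.eq_zero_of_abs_lt_dvd ((edgeNormal_eq_iff (by omega) _ _).mp h)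
      (by rw [abs_lt]; omega)
    omega
  · have h4 := Int.eq_zero_of_abs_lt_dvd ((edgeNormal_eq_iff (by omega) _ _).mp h)
      (by rw [abs_lt]; omega)
    omega

/-! ### The width of the regular polygon -/

theorem width_eq_of_bounds {T : Set ℂ} {w : ℝ} {u : ℂ} {a : ℝ} (hw : 0 ≤ w) (hu : ‖u‖ = 1)
    (hT : ∀ x ∈ T, a ≤ inner ℝ u x ∧ inner ℝ u x ≤ a + w)
    (hlow : ∀ u : ℂ, ‖u‖ = 1 → ∃ x ∈ T, ∃ y ∈ T, w ≤ inner ℝ u x - inner ℝ u y) :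
    width T = w := by
  refine IsLeast.csInf_eq ⟨⟨hw, u, hu, a, hT⟩, ?_⟩
  rintro w' ⟨-, u', hu', a', ha'⟩
  obtain ⟨x, hx, y, hy, h⟩ := hlow u' hu'
  linarith [(ha' x hx).2, (ha' y hy).1]

theorem width_regularPolygon_of_even {n : ℕ} (hn : 3 ≤ n) (heven : Even n) :
    width (regularPolygon n) = 2 * apothem n := by
  have hr := apothem_pos hn
  refine width_eq_of_bounds (u := edgeNormal n 0) (a := -apothem n) (by positivity)
    (norm_edgeNormal n 0) (fun x hx => ?_) fun u hu => ?_
  · rw [mem_regularPolygon_iff hn] at hx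
    have h1 := hx 0
    have h2 := hx (0 + (n / 2 : ℕ))
    rw [edgeNormal_opposite (by omega) heven, inner_neg_left] at h2
    constructor <;> linarith
  · have hmem : ∀ c : ℝ, |c| = apothem n → c • u ∈ regularPolygon n := fun c hc =>
      mem_regularPolygon_of_norm_le hn (by
        rw [norm_smul, hu, mul_one, Real.norm_eq_abs, hc])
    refine ⟨_, hmem (apothem n) (abs_of_pos hr), _, hmem (-apothem n) (by
      rw [abs_neg, abs_of_pos hr]), ?_⟩
    rw [inner_smul_right, inner_smul_right, real_inner_self_eq_norm_sq, hu]
    linarith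

/-- For odd `n`, the differences of almost opposite vertices point in `2 * n` equally spaced
directions; one of them is close to any given direction. -/
theorem exists_vertices_of_odd {n : ℕ} (hn : 3 ≤ n) (hodd : Odd n) {u : ℂ} (hu : ‖u‖ = 1) :
    ∃ x ∈ regularPolygon n, ∃ y ∈ regularPolygon n,
      1 + apothem n ≤ inner ℝ u x - inner ℝ u y := by
  have hn0 : (0 : ℝ) < n := by positivity
  have h3 : (3 : ℝ) ≤ n := by exact_mod_cast hn
  have hpi := Real.pi_pos
  have main : ∀ (s : ℝ) (k : ℤ), |s + 1 / 2 - 2 * k| ≤ 1 / 2 →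
      1 + apothem n ≤ inner ℝ (dir n s) (dir n (2 * k)) -
        inner ℝ (dir n s) (-dir n (2 * k - 1)) := by
    intro s k hk
    rw [inner_neg_right, inner_dir, inner_dir, sub_neg_eq_add]
    set h := Real.pi / (2 * n)
    set θ := Real.pi * (s + 1 / 2 - 2 * k) / n with hθ
    have e1 : Real.pi * (s - 2 * k) / n = θ - h := by simp only [hθ, h]; field_simp; ring
    have e2 : Real.pi * (s - (2 * k - 1)) / n = θ + h := by simp only [hθ, h]; field_simp; ring
    have e3 : Real.pi / n = 2 * h := by simp only [h]; field_simp
    have hh : 0 < h := by positivity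
    have hh2 : h < Real.pi / 2 := by
      apply div_lt_div_of_pos_left hpi (by norm_num)
      linarith
    have habs : |θ| ≤ h := by
      rw [hθ, abs_div, abs_mul, abs_of_pos hpi, abs_of_pos hn0, div_le_iff₀ hn0]
      have : h * n = Real.pi * (1 / 2) := by simp only [h]; field_simp
      rw [this]
      gcongr
    have hc : Real.cos h ≤ Real.cos θ := by
      rw [← Real.cos_abs θ]
      exact Real.cos_le_cos_of_nonneg_of_le_pi (abs_nonneg _) (by linarith) habs
    have hc0 : 0 < Real.cos h := Real.cos_pos_of_mem_Ioo ⟨by linarith, hh2⟩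
    rw [e1, e2, apothem, e3, Real.cos_two_mul, Real.cos_sub, Real.cos_add]
    nlinarith
  have hT : ∀ k : ℤ, dir n (2 * k) ∈ regularPolygon n ∧ -dir n (2 * k - 1) ∈ regularPolygon n := by
    intro k
    refine ⟨dir_even_mem_regularPolygon (by omega) k, ?_⟩
    have h := neg_edgeNormal_eq_dir hodd (k - 1)
    have h' : edgeNormal n (k - 1) = dir n (2 * k - 1) := by
      rw [edgeNormal]; congr 1; push_cast; ring
    rw [← h', h]
    exact dir_even_mem_regularPolygon (by omega) _
  have hpolar : u = dir n (u.arg * n / Real.pi) := by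
    have h1 := Complex.norm_mul_exp_arg_mul_I u
    rw [hu, Complex.ofReal_one, one_mul] at h1
    rw [dir, show Real.pi * (u.arg * n / Real.pi) / n = u.arg by field_simp, h1]
  set s := u.arg * n / Real.pi
  set l := round (s + 1 / 2) with hl
  have hround : |s + 1 / 2 - l| ≤ 1 / 2 := abs_sub_round _
  rcases Int.even_or_odd' l with ⟨k, hk | hk⟩
  · have := main s k (by rw [hk] at hround; push_cast at hround; exact hround)
    rw [← hpolar] at this
    exact ⟨_, (hT k).1, _, (hT k).2, this⟩
  · -- the opposite direction is the one near an even multiple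
    obtain ⟨p, hp⟩ := hodd
    have := main (s + n) (k + p + 1) (by
      rw [hk] at hround
      rw [hp]
      push_cast at hround ⊢
      convert hround using 2
      ring)
    rw [dir_add_period (by omega), ← hpolar, inner_neg_left, inner_neg_left] at this
    exact ⟨_, (hT (k + p + 1)).2, _, (hT (k + p + 1)).1, by push_cast at this ⊢; linarith⟩

theorem width_regularPolygon_of_odd {n : ℕ} (hn : 3 ≤ n) (hodd : Odd n) :
    width (regularPolygon n) = 1 + apothem n := by
  have hr := apothem_pos hn
  refine width_eq_of_bounds (u := edgeNormal n 0) (a := -1) (by positivity)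
    (norm_edgeNormal n 0) (fun x hx => ?_) fun u hu => exists_vertices_of_odd hn hodd hu
  have h1 := (mem_regularPolygon_iff hn).mp hx 0
  have h2 := norm_le_one_of_mem_regularPolygon hx
  have h3 := abs_le.mp (abs_real_inner_le_norm (edgeNormal n 0) x)
  rw [norm_edgeNormal, one_mul] at h3
  constructor <;> linarith

/-! ### The equilateral orbits through edge midpoints -/

theorem inner_edgeNormal_third {n k : ℕ} (hk : k ≠ 0) (hnk : n = 3 * k) (a : ℤ) :
    inner ℝ (edgeNormal n a) (edgeNormal n (a + k)) = -(1 / 2) ∧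
    inner ℝ (edgeNormal n a) (edgeNormal n (a + 2 * k)) = -(1 / 2) := by
  have hk0 : (k : ℝ) ≠ 0 := by exact_mod_cast hk
  subst hnk
  constructor
  · rw [inner_edgeNormal, ← Real.cos_neg, ← cos_two_pi_div_three]
    congr 1
    push_cast
    field_simp
    ring
  · rw [inner_edgeNormal, ← Real.cos_neg, ← cos_four_pi_div_three]
    congr 1
    push_cast
    field_simp
    ring

theorem add_add_eq_zero_of_inner {e f g : ℂ} (he : ‖e‖ = 1) (hf : ‖f‖ = 1) (hg : ‖g‖ = 1)
    (hef : inner ℝ e f = -(1 / 2)) (hfg : inner ℝ f g = -(1 / 2))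
    (hge : inner ℝ g e = -(1 / 2)) : e + f + g = 0 := by
  have h : ‖e + f + g‖ ^ 2 = 0 := by
    rw [← real_inner_self_eq_norm_sq]
    simp only [inner_add_left, inner_add_right, real_inner_self_eq_norm_sq, he, hf, hg, hef, hfg,
      hge, real_inner_comm e f, real_inner_comm f g, real_inner_comm g e]
    norm_num
  simpa using h

theorem norm_smul_sub_smul {e f : ℂ} {r : ℝ} (hr : 0 ≤ r) (he : ‖e‖ = 1) (hf : ‖f‖ = 1)
    (hef : inner ℝ e f = -(1 / 2)) : ‖r • e - r • f‖ = Real.sqrt 3 * r := by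
  have h : ‖e - f‖ = Real.sqrt 3 := by
    rw [eq_comm, Real.sqrt_eq_iff_mul_self_eq (by norm_num) (norm_nonneg _), ← pow_two,
      norm_sub_sq_real, he, hf, hef]
    norm_num
  rw [← smul_sub, norm_smul, h, Real.norm_of_nonneg hr, mul_comm]

theorem inner_edgeNormal_third_cycle {n k : ℕ} (hk : k ≠ 0) (hnk : n = 3 * k) (j : ℕ) :
    inner ℝ (edgeNormal n j) (edgeNormal n (j + k : ℕ)) = -(1 / 2) ∧
    inner ℝ (edgeNormal n (j + k : ℕ)) (edgeNormal n (j + 2 * k : ℕ)) = -(1 / 2) ∧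
    inner ℝ (edgeNormal n (j + 2 * k : ℕ)) (edgeNormal n j) = -(1 / 2) := by
  have h1 := inner_edgeNormal_third hk hnk j
  have h2 := inner_edgeNormal_third hk hnk (j + k)
  rw [add_assoc, ← two_mul] at h2
  refine ⟨?_, ?_, ?_⟩
  · push_cast; exact h1.1
  · push_cast; exact h2.1
  · rw [real_inner_comm]; push_cast; exact h1.2

theorem dist_edgeMidpoint_third {n k : ℕ} (hk : k ≠ 0) (hnk : n = 3 * k) (hn : 3 ≤ n) (j : ℕ) :
    dist (edgeMidpoint n j) (edgeMidpoint n (j + k)) = Real.sqrt 3 * apothem n ∧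
    dist (edgeMidpoint n (j + k)) (edgeMidpoint n (j + 2 * k)) = Real.sqrt 3 * apothem n ∧
    dist (edgeMidpoint n (j + 2 * k)) (edgeMidpoint n j) = Real.sqrt 3 * apothem n := by
  obtain ⟨h1, h2, h3⟩ := inner_edgeNormal_third_cycle hk hnk j
  have hr := (apothem_pos hn).le
  simp only [dist_eq_norm, edgeMidpoint_eq]
  exact ⟨norm_smul_sub_smul hr (norm_edgeNormal n _) (norm_edgeNormal n _) h1,
    norm_smul_sub_smul hr (norm_edgeNormal n _) (norm_edgeNormal n _) h2,
    norm_smul_sub_smul hr (norm_edgeNormal n _) (norm_edgeNormal n _) h3⟩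

theorem perimeter_edgeMidpoint_third {n k : ℕ} (hk : k ≠ 0) (hnk : n = 3 * k) (hn : 3 ≤ n)
    (j : ℕ) : perimeter (edgeMidpoint n j) (edgeMidpoint n (j + k)) (edgeMidpoint n (j + 2 * k)) =
      3 * Real.sqrt 3 * apothem n := by
  obtain ⟨h1, h2, h3⟩ := dist_edgeMidpoint_third hk hnk hn j
  rw [perimeter, ← dist_eq_norm, ← dist_eq_norm, ← dist_eq_norm, dist_comm, h1, dist_comm, h2,
    dist_comm, h3]
  ring

theorem midpointOrbit_mem_regularBounceOrbits {n k : ℕ} (hk : k ≠ 0) (hnk : n = 3 * k)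
    (hn : 3 ≤ n) (j : ℕ) : midpointOrbit n k j ∈ regularBounceOrbits (regularPolygon n) 3 := by
  obtain ⟨h1, h2, h3⟩ := dist_edgeMidpoint_third hk hnk hn j
  obtain ⟨i1, i2, i3⟩ := inner_edgeNormal_third_cycle hk hnk j
  have hr := apothem_pos hn
  have hpos : 0 < Real.sqrt 3 * apothem n := by positivity
  have hne : ∀ x y : ℂ, dist x y = Real.sqrt 3 * apothem n → x ≠ y := fun x y h =>
    dist_pos.mp (h ▸ hpos)
  have hsum : edgeMidpoint n j + edgeMidpoint n (j + k) + edgeMidpoint n (j + 2 * k) = 0 := by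
    rw [edgeMidpoint_eq, edgeMidpoint_eq, edgeMidpoint_eq, ← smul_add, ← smul_add,
      add_add_eq_zero_of_inner (norm_edgeNormal n _) (norm_edgeNormal n _) (norm_edgeNormal n _)
        i1 i2 i3, smul_zero]
  -- the bounce vector at a midpoint is a multiple of the midpoint, as the three midpoints add up
  -- to zero
  have key : ∀ (l : ℕ) (y z : ℂ), edgeMidpoint n l + y + z = 0 →
      ‖edgeMidpoint n l - y‖ = Real.sqrt 3 * apothem n →
      ‖edgeMidpoint n l - z‖ = Real.sqrt 3 * apothem n →
      IsOutwardSupport (regularPolygon n) (edgeMidpoint n l)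
        (‖edgeMidpoint n l - y‖⁻¹ • (edgeMidpoint n l - y)
          + ‖edgeMidpoint n l - z‖⁻¹ • (edgeMidpoint n l - z)) := by
    intro l y z h hy hz
    have hx : edgeMidpoint n l - y + (edgeMidpoint n l - z) = (3 * apothem n) • edgeNormal n l := by
      rw [mul_smul, ← edgeMidpoint_eq, eq_comm, ← sub_eq_zero, ← h]
      module
    rw [hy, hz, ← smul_add, hx, smul_smul]
    exact isOutwardSupport_smul_edgeNormal hn (by positivity) (inner_edgeNormal_edgeMidpoint n l)
  rw [dist_eq_norm] at h1 h2 h3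
  refine ⟨threeBounce_mem_bounceOrbits (hne _ _ (by rw [dist_eq_norm, h1]))
    (hne _ _ (by rw [dist_eq_norm, h2])) (hne _ _ (by rw [dist_eq_norm, h3]))
    (edgeMidpoint_mem_frontier hn _) (edgeMidpoint_mem_frontier hn _)
    (edgeMidpoint_mem_frontier hn _) ?_ ?_ ?_, fun i => ?_⟩
  · exact key _ _ _ (by rw [← hsum]; abel) (by rw [norm_sub_rev, h3]) h1
  · exact key _ _ _ (by rw [← hsum]; abel) (by rw [norm_sub_rev, h1]) h2
  · exact key _ _ _ (by rw [← hsum]; abel) (by rw [norm_sub_rev, h2]) h3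
  · unfold midpointOrbit threeBounce
    split_ifs <;> exact isSmoothPoint_edgeMidpoint hn _

theorem trace_midpointOrbit (n k j : ℕ) : trace (midpointOrbit n k j) =
    triangleTrace (edgeMidpoint n j) (edgeMidpoint n (j + k)) (edgeMidpoint n (j + 2 * k)) :=
  trace_threeBounce _ _ _

/-- The inner points of a side of the equilateral triangle are closer to the centre than its
vertices. -/
theorem eq_or_eq_of_mem_segment_of_norm_eq {e f x : ℂ} {r : ℝ} (hr : 0 < r) (he : ‖e‖ = 1)
    (hf : ‖f‖ = 1) (hef : inner ℝ e f = -(1 / 2)) (hx : ‖x‖ = r)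
    (hmem : x ∈ segment ℝ (r • e) (r • f)) : x = r • e ∨ x = r • f := by
  obtain ⟨s, t, hs, ht, hst, rfl⟩ := hmem
  have h1 : ‖s • r • e + t • r • f‖ ^ 2 = r ^ 2 * (1 - 3 * (s * t)) := by
    rw [← real_inner_self_eq_norm_sq]
    simp only [inner_add_left, inner_add_right, inner_smul_left, inner_smul_right,
      real_inner_self_eq_norm_sq, he, hf, hef, real_inner_comm e f, conj_trivial]
    have : s = 1 - t := by linarith
    subst this
    ring
  rw [hx] at h1
  have h2 : s * t = 0 := by
    have : r ^ 2 * (s * t) = 0 := by linarith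
    exact (mul_eq_zero.mp this).resolve_left (by positivity)
  rcases mul_eq_zero.mp h2 with h | h
  · right
    rw [h, show t = 1 by linarith, zero_smul, one_smul, zero_add]
  · left
    rw [h, show s = 1 by linarith, zero_smul, one_smul, add_zero]

theorem midpointOrbit_trace_injective {n k : ℕ} (hk : k ≠ 0) (hnk : n = 3 * k) (hn : 3 ≤ n)
    {i j : ℕ} (hi : i < k) (hj : j < k)
    (h : trace (midpointOrbit n k i) = trace (midpointOrbit n k j)) : i = j := by
  have hr := apothem_pos hn
  obtain ⟨i1, i2, i3⟩ := inner_edgeNormal_third_cycle hk hnk j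
  have hmem : edgeMidpoint n i ∈ trace (midpointOrbit n k j) := by
    rw [← h, trace_midpointOrbit]
    exact Or.inl (Or.inl (left_mem_segment ℝ _ _))
  rw [trace_midpointOrbit] at hmem
  have hnorm : ‖edgeMidpoint n i‖ = apothem n := by
    rw [edgeMidpoint_eq, norm_smul, norm_edgeNormal, mul_one, Real.norm_of_nonneg hr.le]
  -- the only points at distance `apothem n` from the centre on the trace are its three corners
  have hno : ∀ l : ℕ, edgeMidpoint n i = apothem n • edgeNormal n l → (n : ℤ) ∣ i - l := by
    intro l hl
    rw [edgeMidpoint_eq] at hl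
    exact (edgeNormal_eq_iff (by omega) _ _).mp (smul_right_injective ℂ hr.ne' hl)
  have hcases : (n : ℤ) ∣ i - (j : ℕ) ∨ (n : ℤ) ∣ i - (j + k : ℕ)
      ∨ (n : ℤ) ∣ i - (j + 2 * k : ℕ) := by
    simp only [edgeMidpoint_eq n j, edgeMidpoint_eq n (j + k), edgeMidpoint_eq n (j + 2 * k)]
      at hmem
    rcases hmem with (h | h) | h
    · rcases eq_or_eq_of_mem_segment_of_norm_eq hr (norm_edgeNormal n _) (norm_edgeNormal n _) i1
        hnorm h with h' | h'
      · exact Or.inl (hno _ h')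
      · exact Or.inr (Or.inl (hno _ h'))
    · rcases eq_or_eq_of_mem_segment_of_norm_eq hr (norm_edgeNormal n _) (norm_edgeNormal n _) i2
        hnorm h with h' | h'
      · exact Or.inr (Or.inl (hno _ h'))
      · exact Or.inr (Or.inr (hno _ h'))
    · rcases eq_or_eq_of_mem_segment_of_norm_eq hr (norm_edgeNormal n _) (norm_edgeNormal n _) i3
        hnorm h with h' | h'
      · exact Or.inr (Or.inr (hno _ h'))
      · exact Or.inl (hno _ h')
  rcases hcases with h | h | h
  · have := Int.eq_zero_of_abs_lt_dvd h (by rw [abs_lt]; omega)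
    omega
  · have := Int.eq_zero_of_abs_lt_dvd h (by rw [abs_lt]; omega)
    omega
  · have := Int.eq_zero_of_abs_lt_dvd h (by rw [abs_lt]; omega)
    omega

/-- Three points of a family with period three, at indices that are distinct modulo three, span
the same triangle as the points with indices `0`, `1`, `2`. -/
theorem triangle_eq_of_emod_three {f : ℤ → ℂ} (hf : ∀ l, f (l % 3) = f l) {a b c : ℤ}
    (hab : a % 3 ≠ b % 3) (hbc : b % 3 ≠ c % 3) (hca : c % 3 ≠ a % 3) :
    triangleTrace (f a) (f b) (f c) = triangleTrace (f 0) (f 1) (f 2) ∧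
      perimeter (f a) (f b) (f c) = perimeter (f 0) (f 1) (f 2) := by
  rw [← hf a, ← hf b, ← hf c]
  have ha : a % 3 = 0 ∨ a % 3 = 1 ∨ a % 3 = 2 := by omega
  have hb : b % 3 = 0 ∨ b % 3 = 1 ∨ b % 3 = 2 := by omega
  have hc : c % 3 = 0 ∨ c % 3 = 1 ∨ c % 3 = 2 := by omega
  generalize a % 3 = a at *
  generalize b % 3 = b at *
  generalize c % 3 = c at *
  have hswap := triangleTrace_swap (f 0) (f 1) (f 2)
  have hswap' := perimeter_swap (f 0) (f 1) (f 2)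
  have hrot := triangleTrace_rotate (f 0) (f 1) (f 2)
  have hrot' := perimeter_rotate (f 0) (f 1) (f 2)
  have hrot₂ := triangleTrace_rotate (f 2) (f 0) (f 1)
  have hrot₂' := perimeter_rotate (f 2) (f 0) (f 1)
  rcases ha with rfl | rfl | rfl <;> rcases hb with rfl | rfl | rfl <;>
    rcases hc with rfl | rfl | rfl <;> first | contradiction | skip
  · exact ⟨rfl, rfl⟩
  · exact ⟨by rw [← triangleTrace_rotate, triangleTrace_swap, triangleTrace_rotate],
      by rw [← perimeter_rotate, perimeter_swap, perimeter_rotate]⟩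
  · exact ⟨hswap, hswap'⟩
  · exact ⟨hrot, hrot'⟩
  · exact ⟨hrot₂.symm, hrot₂'.symm⟩
  · exact ⟨by rw [triangleTrace_swap, triangleTrace_rotate],
      by rw [perimeter_swap, perimeter_rotate]⟩

/-! ### Regular orbits with three bounce points -/

/-- The reflection law for a closed path with vertices `x`, `y`, `z` in the relative interiors of
the edges with indices `a`, `b`, `c`: the unit vectors `u`, `v`, `w` are the directions from `x`
to `y`, from `y` to `z` and from `z` to `x`. -/
structure IsRegularTriangle (n : ℕ) (a b c : ℤ) (x y z u v w : ℂ) : Prop where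
  smooth_x : IsSmoothPoint (regularPolygon n) x
  smooth_y : IsSmoothPoint (regularPolygon n) y
  smooth_z : IsSmoothPoint (regularPolygon n) z
  touch_x : inner ℝ (edgeNormal n a) x = apothem n
  touch_y : inner ℝ (edgeNormal n b) y = apothem n
  touch_z : inner ℝ (edgeNormal n c) z = apothem n
  norm_u : ‖u‖ = 1
  norm_v : ‖v‖ = 1
  norm_w : ‖w‖ = 1
  side_xy : ∃ s : ℝ, 0 < s ∧ y - x = s • u
  side_yz : ∃ s : ℝ, 0 < s ∧ z - y = s • v
  side_zx : ∃ s : ℝ, 0 < s ∧ x - z = s • w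
  bounce_x : ∃ c : ℝ, 0 ≤ c ∧ w - u = c • edgeNormal n a
  bounce_y : ∃ c : ℝ, 0 ≤ c ∧ u - v = c • edgeNormal n b
  bounce_z : ∃ d : ℝ, 0 ≤ d ∧ v - w = d • edgeNormal n c

namespace IsRegularTriangle

variable {n : ℕ} {a b c : ℤ} {x y z u v w : ℂ}

theorem rotate (h : IsRegularTriangle n a b c x y z u v w) :
    IsRegularTriangle n b c a y z x v w u :=
  ⟨h.smooth_y, h.smooth_z, h.smooth_x, h.touch_y, h.touch_z, h.touch_x, h.norm_v, h.norm_w,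
    h.norm_u, h.side_yz, h.side_zx, h.side_xy, h.bounce_y, h.bounce_z, h.bounce_x⟩

/-- The path does not pass straight through `x`: otherwise `x` would lie between `y` and `z`, so
that all three points would lie on one edge, and the path could not turn back. -/
theorem ne (h : IsRegularTriangle n a b c x y z u v w) (hn : 3 ≤ n) : w ≠ u := by
  rintro rfl
  obtain ⟨s, hs, hxy⟩ := h.side_xy
  obtain ⟨s', hs', hyz⟩ := h.side_yz
  obtain ⟨s'', hs'', hzx⟩ := h.side_zx
  obtain ⟨d, hd, hby⟩ := h.bounce_y
  obtain ⟨d', hd', hbz⟩ := h.bounce_z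
  have hTy := (mem_regularPolygon_iff hn).mp ((mem_frontier_iff hn).mp h.smooth_y.1).1 a
  have hTz := (mem_regularPolygon_iff hn).mp ((mem_frontier_iff hn).mp h.smooth_z.1).1 a
  have e1 : inner ℝ (edgeNormal n a) y = apothem n + s * inner ℝ (edgeNormal n a) w := by
    rw [← h.touch_x, ← inner_smul_right, ← hxy, ← inner_add_right, add_sub_cancel]
  have e2 : inner ℝ (edgeNormal n a) z = apothem n - s'' * inner ℝ (edgeNormal n a) w := by
    rw [← h.touch_x, ← inner_smul_right, ← hzx, ← inner_sub_right, sub_sub_cancel]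
  -- `y` and `z` lie on opposite sides of `x` but on the same side of the edge line
  have e3 : inner ℝ (edgeNormal n a) w = 0 := by
    apply le_antisymm
    · by_contra! hc
      nlinarith
    · by_contra! hc
      nlinarith
  rw [e3, mul_zero, add_zero] at e1
  rw [e3, mul_zero, sub_zero] at e2
  have hba := h.smooth_y.edgeNormal_eq hn h.touch_y e1
  have hca := h.smooth_z.edgeNormal_eq hn h.touch_z e2
  rw [hba] at hby
  rw [hca] at hbz
  have h1 : (d + d') • edgeNormal n a = 0 := by
    rw [add_smul, ← hby, ← hbz]
    abel
  have h2 : d + d' = 0 := (smul_eq_zero.mp h1).resolve_right (dir_ne_zero n _)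
  have h3 : d = 0 := by linarith
  rw [h3, zero_smul, sub_eq_zero] at hby
  subst hby
  have h4 : (s + s' + s'') • w = 0 := by
    rw [add_smul, add_smul, ← hxy, ← hyz, ← hzx]
    abel
  have h5 := (smul_eq_zero.mp h4).resolve_left (by positivity)
  have h6 := h.norm_w
  rw [h5, norm_zero] at h6
  exact zero_ne_one h6

theorem mul_conj_eq_one {z : ℂ} (hz : ‖z‖ = 1) : z * (starRingEnd ℂ) z = 1 := by
  rw [Complex.mul_conj, Complex.normSq_eq_norm_sq, hz]
  simp

/-- The reflection law at `x`, as an equation between complex numbers. -/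
theorem mul_eq (h : IsRegularTriangle n a b c x y z u v w) (hn : 3 ≤ n) :
    u * w = -edgeNormal n a ^ 2 := by
  obtain ⟨d, hd, hb⟩ := h.bounce_x
  have hd0 : (d : ℂ) ≠ 0 := by
    intro h0
    rw [Complex.ofReal_eq_zero] at h0
    rw [h0, zero_smul, sub_eq_zero] at hb
    exact h.ne hn hb
  rw [Complex.real_smul] at hb
  have hb' := congrArg (starRingEnd ℂ) hb
  rw [map_sub, map_mul, Complex.conj_ofReal] at hb'
  have hu := mul_conj_eq_one h.norm_u
  have hw := mul_conj_eq_one h.norm_w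
  have he := mul_conj_eq_one (norm_edgeNormal n a)
  apply mul_left_cancel₀ hd0
  linear_combination (-d * u * w) * he + edgeNormal n a * u * hw - edgeNormal n a * w * hu
    - edgeNormal n a * u * w * hb' - edgeNormal n a * hb

/-- The side `y - x` is orthogonal to the normal with index `a + b - c`: the three reflection
equations give `u ^ 2 = -edgeNormal n (a + b - c) ^ 2`. -/
theorem inner_eq_zero (h : IsRegularTriangle n a b c x y z u v w) (hn : 3 ≤ n) :
    inner ℝ (edgeNormal n (a + b - c)) u = 0 := by
  have h1 := h.mul_eq hn
  have h2 := h.rotate.mul_eq hn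
  have h3 := h.rotate.rotate.mul_eq hn
  set E := edgeNormal n (a + b - c) with hE
  have h4 : E * edgeNormal n c = edgeNormal n a * edgeNormal n b := by
    rw [hE, edgeNormal, edgeNormal, edgeNormal, edgeNormal, ← dir_add, ← dir_add]
    congr 1
    push_cast
    ring
  have hc : edgeNormal n c ^ 2 ≠ 0 := pow_ne_zero 2 (dir_ne_zero n _)
  have h5 : (u - Complex.I * E) * (u + Complex.I * E) = 0 := by
    apply mul_left_cancel₀ hc
    have hI := Complex.I_sq
    linear_combination u ^ 2 * h3 - u * v * h1 + edgeNormal n a ^ 2 * h2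
      + (E * edgeNormal n c + edgeNormal n a * edgeNormal n b) * h4
      - edgeNormal n c ^ 2 * E ^ 2 * hI
  have h6 : ∀ s : ℝ, inner ℝ E (s * (Complex.I * E)) = 0 := by
    intro s
    rw [Billiard.inner_eq]
    simp
    ring
  rcases mul_eq_zero.mp h5 with h7 | h7
  · have := h6 1
    rwa [Complex.ofReal_one, one_mul, ← sub_eq_zero.mp h7] at this
  · have := h6 (-1)
    rwa [Complex.ofReal_neg, Complex.ofReal_one, neg_one_mul, ← eq_neg_of_add_eq_zero_left h7]
      at this

theorem inner_eq_inner (h : IsRegularTriangle n a b c x y z u v w) (hn : 3 ≤ n) :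
    inner ℝ (edgeNormal n (a + b - c)) x = inner ℝ (edgeNormal n (a + b - c)) y := by
  obtain ⟨s, hs, hxy⟩ := h.side_xy
  rw [eq_comm, ← sub_eq_zero, ← inner_sub_right, hxy, inner_smul_right, h.inner_eq_zero hn,
    mul_zero]

/-- Consecutive bounce points lie on different edges. -/
theorem not_dvd (h : IsRegularTriangle n a b c x y z u v w) (hn : 3 ≤ n) :
    ¬ (n : ℤ) ∣ b - a := by
  intro hdvd
  have hab := edgeNormal_eq_of_dvd (n := n) (by omega) hdvd
  obtain ⟨s, hs, hxy⟩ := h.side_xy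
  obtain ⟨d, hd, hb⟩ := h.bounce_x
  have h1 : inner ℝ (edgeNormal n a) u = 0 := by
    have h2 : s * inner ℝ (edgeNormal n a) u = 0 := by
      rw [← inner_smul_right, ← hxy, inner_sub_right, h.touch_x, ← hab, h.touch_y, sub_self]
    exact (mul_eq_zero.mp h2).resolve_left hs.ne'
  have h2 : w = u + d • edgeNormal n a := by rw [← hb]; abel
  have h3 : ‖w‖ ^ 2 = 1 + d ^ 2 := by
    rw [h2, norm_add_sq_real, inner_smul_right, real_inner_comm, h1, h.norm_u, norm_smul,
      norm_edgeNormal, Real.norm_of_nonneg hd]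
    ring
  rw [h.norm_w] at h3
  have h4 : d = 0 := by nlinarith
  rw [h4, zero_smul, add_zero] at h2
  exact h.ne hn h2

/-- The bounce point `z` lies in the open edge `c` only if `c` is midway between `a` and `b` modulo
`n`. If moreover `b - a` is a multiple of a third of a full turn, then `z` is the midpoint of its
edge. -/
theorem dvd (h : IsRegularTriangle n a b c x y z u v w) (hn : 3 ≤ n) :
    (n : ℤ) ∣ a + b - 2 * c ∧
      ((n : ℤ) ∣ 3 * (b - a) → z = apothem n • edgeNormal n c) := by
  obtain ⟨tx, hx⟩ := exists_eq_of_inner_edgeNormal h.touch_x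
  obtain ⟨ty, hy⟩ := exists_eq_of_inner_edgeNormal h.touch_y
  obtain ⟨t, hz⟩ := exists_eq_of_inner_edgeNormal h.touch_z
  have hoff := offset_mul_sin hx hy hz (h.inner_eq_inner hn) (h.rotate.inner_eq_inner hn)
    (h.rotate.rotate.inner_eq_inner hn)
  have hn0 : (n : ℝ) ≠ 0 := by positivity
  have hr := apothem_pos hn
  have ht : |t| < halfSide n := by
    have := h.smooth_z
    rw [hz] at this
    exact this.abs_lt hn
  have hnd := h.not_dvd hn
  have hsin := halfSide_le_abs_sin (by omega) hnd
  have hcos := abs_cos_le_apothem hn hnd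
  have hsin0 : Real.sin (Real.pi * (b - a : ℤ) / n) ≠ 0 := by
    rw [← abs_pos]
    exact (halfSide_pos hn).trans_le hsin
  set δ := Real.pi * (b - a : ℤ) / n with hδ
  -- the position of `z` relative to the midpoint of its edge
  have key : t * Real.cos δ = apothem n * Real.sin (Real.pi * (a + b - 2 * c : ℤ) / n) := by
    have e1 : 2 * Real.pi * (b - a) / n = 2 * δ := by rw [hδ]; push_cast; ring
    set η := Real.pi * (a + b - 2 * c : ℤ) / n with hη
    have e2 : 2 * Real.pi * (a - c) / n = η - δ := by rw [hη, hδ]; push_cast; ring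
    have e3 : 2 * Real.pi * (c - b) / n = -(η + δ) := by rw [hη, hδ]; push_cast; ring
    rw [e1, e2, e3, Real.cos_neg, Real.sin_two_mul, Real.cos_sub, Real.cos_add] at hoff
    apply mul_left_cancel₀ hsin0
    linear_combination hoff / 2
  have hdvd : (n : ℤ) ∣ a + b - 2 * c := by
    by_contra hc
    -- otherwise the right-hand side of `key` is at least `apothem n * halfSide n` in absolute value
    have h1 := halfSide_le_abs_sin (by omega) hc
    have h2 := congrArg abs key
    rw [abs_mul, abs_mul, abs_of_pos hr] at h2
    have h3 : |t| * |Real.cos δ| < apothem n * halfSide n := by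
      calc |t| * |Real.cos δ| ≤ |t| * apothem n := by gcongr
        _ < halfSide n * apothem n := by gcongr
        _ = apothem n * halfSide n := mul_comm _ _
    nlinarith
  refine ⟨hdvd, fun h3 => ?_⟩
  have hsin' : Real.sin (Real.pi * (a + b - 2 * c : ℤ) / n) = 0 := by
    obtain ⟨l, hl⟩ := hdvd
    rw [hl]
    have : Real.pi * ((n * l : ℤ) : ℝ) / n = l * Real.pi := by push_cast; field_simp
    rw [this, Real.sin_int_mul_pi]
  -- `δ` is a multiple of `π / 3`, hence not an odd multiple of `π / 2`
  have hcos0 : Real.cos δ ≠ 0 := by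
    intro h0
    obtain ⟨l, hl⟩ := h3
    have h3δ : 3 * δ = l * Real.pi := by
      have : (3 : ℝ) * (b - a : ℤ) = n * l := by exact_mod_cast hl
      rw [hδ]
      field_simp
      linear_combination this
    have h4 := Real.cos_three_mul δ
    have h5 := Real.sin_int_mul_pi l
    have h6 := Real.sin_sq_add_cos_sq (l * Real.pi)
    rw [h3δ, h0] at h4
    rw [h4, h5] at h6
    norm_num at h6
  rw [hsin', mul_zero] at key
  have ht0 := (mul_eq_zero.mp key).resolve_right hcos0
  rw [hz, ht0, Complex.real_smul, Complex.ofReal_zero, zero_mul, add_zero, mul_comm]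

theorem equally_spaced (h : IsRegularTriangle n a b c x y z u v w) (hn : 3 ≤ n) :
    (n : ℤ) ∣ 3 * (b - a) := by
  have h1 := (h.rotate.dvd hn).1
  have h2 := (h.rotate.rotate.dvd hn).1
  have h3 := dvd_sub h1 h2
  have h4 : b + c - 2 * a - (c + a - 2 * b) = 3 * (b - a) := by ring
  rwa [h4] at h3

theorem three_dvd (h : IsRegularTriangle n a b c x y z u v w) (hn : 3 ≤ n) : 3 ∣ n := by
  by_contra h3
  have hcop : IsCoprime (n : ℤ) 3 := by
    have : Nat.Coprime n 3 := ((Nat.Prime.coprime_iff_not_dvd Nat.prime_three).mpr h3).symm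
    exact_mod_cast Nat.isCoprime_iff_coprime.mpr this
  exact h.not_dvd hn (hcop.dvd_of_dvd_mul_left (h.equally_spaced hn))

theorem eq_edgeMidpoints (h : IsRegularTriangle n a b c x y z u v w) (hn : 3 ≤ n) {k : ℕ}
    (hnk : n = 3 * k) : ∃ j < k,
      triangleTrace x y z = triangleTrace (edgeMidpoint n j) (edgeMidpoint n (j + k))
        (edgeMidpoint n (j + 2 * k)) ∧
      perimeter x y z = perimeter (edgeMidpoint n j) (edgeMidpoint n (j + k))
        (edgeMidpoint n (j + 2 * k)) := by
  have hk : (0 : ℤ) < k := by omega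
  have d1 := h.equally_spaced hn
  have d2 := h.rotate.equally_spaced hn
  have d3 := h.rotate.rotate.equally_spaced hn
  have hz := (h.dvd hn).2 d1
  have hx := (h.rotate.dvd hn).2 d2
  have hy := (h.rotate.rotate.dvd hn).2 d3
  have hnk' : (n : ℤ) = 3 * k := by exact_mod_cast hnk
  have nd1 := h.not_dvd hn
  have nd2 := h.rotate.not_dvd hn
  have nd3 := h.rotate.rotate.not_dvd hn
  rw [hnk', mul_dvd_mul_iff_left three_ne_zero] at d1 d2 d3
  obtain ⟨j, hj⟩ := Int.eq_ofNat_of_zero_le (Int.emod_nonneg a hk.ne')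
  have hjk := Int.emod_lt_of_pos a hk
  obtain ⟨l₀, ha⟩ : ∃ l : ℤ, a = j + k * l := ⟨a / k, by
    have := Int.emod_add_mul_ediv a k
    rw [hj] at this
    exact this.symm⟩
  obtain ⟨l₁, hb⟩ : ∃ l : ℤ, b = j + k * l := by
    obtain ⟨l, hl⟩ := d1
    exact ⟨l₀ + l, by rw [mul_add, ← hl, ha]; ring⟩
  obtain ⟨l₂, hc⟩ : ∃ l : ℤ, c = j + k * l := by
    obtain ⟨l, hl⟩ := d2
    exact ⟨l₁ + l, by rw [mul_add, ← hl, hb]; ring⟩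
  have hdist : ∀ l l' : ℤ, ¬ (n : ℤ) ∣ (j + k * l) - (j + k * l') → l % 3 ≠ l' % 3 := by
    intro l l' hnd heq
    apply hnd
    obtain ⟨m, hm⟩ := Int.ModEq.dvd (show l' ≡ l [ZMOD 3] from heq.symm)
    exact ⟨m, by rw [hnk']; linear_combination (k : ℤ) * hm⟩
  rw [ha, hb] at nd1
  rw [hb, hc] at nd2
  rw [hc, ha] at nd3
  have m1 := hdist _ _ nd1
  have m2 := hdist _ _ nd2
  have m3 := hdist _ _ nd3
  have hf : ∀ l : ℤ, apothem n • edgeNormal n (j + k * (l % 3)) =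
      apothem n • edgeNormal n (j + k * l) := by
    intro l
    congr 1
    apply edgeNormal_eq_of_dvd (by omega)
    refine ⟨-(l / 3), ?_⟩
    rw [hnk']
    linear_combination (k : ℤ) * Int.emod_add_mul_ediv l 3
  have h0 : apothem n • edgeNormal n (j + k * 0) = edgeMidpoint n j := by
    rw [edgeMidpoint_eq, mul_zero, add_zero]
  have h1 : apothem n • edgeNormal n (j + k * 1) = edgeMidpoint n (j + k) := by
    rw [edgeMidpoint_eq, mul_one]
    push_cast
    rfl
  have h2 : apothem n • edgeNormal n (j + k * 2) = edgeMidpoint n (j + 2 * k) := by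
    rw [edgeMidpoint_eq, mul_comm (k : ℤ) 2]
    push_cast
    rfl
  have hperm := triangle_eq_of_emod_three (f := fun l => apothem n • edgeNormal n (j + k * l)) hf
    (hdist _ _ nd1).symm (hdist _ _ nd2).symm
    (hdist _ _ nd3).symm
  rw [h0, h1, h2, ← ha, ← hb, ← hc, ← hx, ← hy, ← hz] at hperm
  exact ⟨j, by omega, hperm⟩

end IsRegularTriangle

theorem exists_isRegularTriangle {n : ℕ} (hn : 3 ≤ n) {q : ℤ → ℂ}
    (hq : q ∈ regularBounceOrbits (regularPolygon n) 3) :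
    3 ∈ periods q ∧ ∃ (a b c : ℤ) (u v w : ℂ),
      IsRegularTriangle n a b c (q 0) (q 1) (q 2) u v w := by
  obtain ⟨⟨⟨horb, hper⟩, hnum⟩, hreg⟩ := hq
  have h3 := bounceNumber_mem_periods hper
  rw [hnum] at h3
  refine ⟨h3, ?_⟩
  have touch : ∀ i, ∃ a : ℤ, inner ℝ (edgeNormal n a) (q i) = apothem n := fun i =>
    ((mem_frontier_iff hn).mp (horb i).1).2
  obtain ⟨a, ha⟩ := touch 0
  obtain ⟨b, hb⟩ := touch 1
  obtain ⟨c, hc⟩ := touch 2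
  have hside : ∀ i : ℤ, ∃ s : ℝ, 0 < s ∧ q (i + 1) - q i = s • direction q i := fun i =>
    ⟨_, norm_pos_iff.mpr (sub_ne_zero.mpr (horb i).2.1.symm),
      (norm_smul_direction (horb i).2.1).symm⟩
  have hbounce : ∀ (i a : ℤ), inner ℝ (edgeNormal n a) (q i) = apothem n →
      ∃ d : ℝ, 0 ≤ d ∧ direction q (i - 1) - direction q i = d • edgeNormal n a := by
    intro i a ha
    have h := (horb i).2.2
    rw [bounceVector_eq] at h
    exact (hreg i).exists_smul hn ha h
  have hb0 := hbounce 0 a ha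
  rw [← direction_add_period h3.2 (0 - 1)] at hb0
  have hs2 := hside 2
  have hq3 : q (2 + 1) = q 0 := h3.2 0
  rw [hq3] at hs2
  exact ⟨a, b, c, direction q 0, direction q 1, direction q 2, hreg 0, hreg 1, hreg 2, ha, hb, hc,
    norm_direction (horb 0).2.1, norm_direction (horb 1).2.1, norm_direction (horb 2).2.1,
    hside 0, hside 1, hs2, hb0, hbounce 1 b hb, hbounce 2 c hc⟩

/-! ### The Fagnano orbit of the equilateral triangle -/

theorem altitudeFoot_eq_midpoint {E : Type*} [NormedAddCommGroup E] [InnerProductSpace ℝ E]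
    {a b c : E} (h : dist a b = dist a c) : altitudeFoot a b c = midpoint ℝ b c := by
  rw [altitudeFoot, EuclideanGeometry.coe_orthogonalProjection_eq_iff_mem]
  refine ⟨AffineMap.lineMap_mem_affineSpan_pair _ b c, ?_⟩
  rw [direction_affineSpan, Submodule.mem_orthogonal]
  intro w hw
  rw [vectorSpan_pair, Submodule.mem_span_singleton] at hw
  obtain ⟨t, rfl⟩ := hw
  rw [dist_eq_norm, dist_eq_norm] at h
  have h1 : inner ℝ ((a - c) - (a - b)) ((a - c) + (a - b)) = 0 := by
    rw [real_inner_comm, real_inner_add_sub_eq_zero_iff, h]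
  have h2 : a -ᵥ midpoint ℝ b c = (2⁻¹ : ℝ) • ((a - c) + (a - b)) := by
    rw [midpoint_eq_smul_add, invOf_eq_inv, vsub_eq_sub]
    module
  rw [h2, inner_smul_left, inner_smul_right, vsub_eq_sub,
    show b - c = (a - c) - (a - b) by abel, h1, mul_zero, mul_zero]

theorem vertex_three_three : vertex 3 3 = vertex 3 0 := by
  rw [vertex_eq_dir, vertex_eq_dir]
  have := dir_add_two_mul_period (n := 3) (by omega) 0 1
  convert this using 2 <;> norm_num

theorem dist_vertex_three (i j : ℕ) (h : ¬ 3 ∣ (i : ℤ) - j) :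
    dist (vertex 3 i) (vertex 3 j) = Real.sqrt 3 := by
  have h1 : inner ℝ (vertex 3 i) (vertex 3 j) = -(1 / 2) := by
    rw [vertex_eq_dir, vertex_eq_dir, inner_dir]
    have h2 := Int.emod_add_mul_ediv ((i : ℤ) - j) 3
    have h3 : ((i : ℝ) - j) = (((i : ℤ) - j) % 3 : ℤ) + 3 * (((i : ℤ) - j) / 3 : ℤ) := by
      exact_mod_cast h2.symm
    have h4 : Real.pi * (2 * (i : ℝ) - 2 * j) / (3 : ℕ) =
        2 * Real.pi * (((i : ℤ) - j) % 3 : ℤ) / 3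
          + (((i : ℤ) - j) / 3 : ℤ) * (2 * Real.pi) := by
      rw [← mul_sub, h3]
      push_cast
      ring
    rw [h4, Real.cos_add_int_mul_two_pi]
    have h5 : ((i : ℤ) - j) % 3 = 1 ∨ ((i : ℤ) - j) % 3 = 2 := by omega
    rcases h5 with h5 | h5
    · rw [h5, Int.cast_one, mul_one, cos_two_pi_div_three]
    · rw [h5, Int.cast_ofNat, cos_four_pi_div_three]
  have h2 := norm_smul_sub_smul zero_le_one (norm_vertex 3 i) (norm_vertex 3 j) h1
  rwa [one_smul, one_smul, mul_one, ← dist_eq_norm] at h2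

theorem fagnanoOrbit_eq_midpointOrbit :
    fagnanoOrbit (vertex 3 0) (vertex 3 1) (vertex 3 2) = midpointOrbit 3 1 1 := by
  have h : ∀ i j k : ℕ, ¬ 3 ∣ (i : ℤ) - j → ¬ 3 ∣ (i : ℤ) - k →
      altitudeFoot (vertex 3 i) (vertex 3 j) (vertex 3 k) =
        midpoint ℝ (vertex 3 j) (vertex 3 k) := fun i j k hj hk =>
    altitudeFoot_eq_midpoint (by rw [dist_vertex_three i j hj, dist_vertex_three i k hk])
  have h4 : vertex 3 4 = vertex 3 1 := by
    rw [vertex_eq_dir, vertex_eq_dir]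
    have := dir_add_two_mul_period (n := 3) (by omega) 2 1
    convert this using 2 <;> norm_num
  rw [fagnanoOrbit, midpointOrbit, h 0 1 2 (by norm_num) (by norm_num),
    h 1 2 0 (by norm_num) (by norm_num), h 2 0 1 (by norm_num) (by norm_num), edgeMidpoint,
    edgeMidpoint, edgeMidpoint, ← vertex_three_three, ← h4]

theorem trace_fagnanoOrbit (a : ℤ) :
    triangleTrace (apothem 3 • edgeNormal 3 a) (apothem 3 • edgeNormal 3 (a + 1))
        (apothem 3 • edgeNormal 3 (a + 2)) =
      trace (fagnanoOrbit (vertex 3 0) (vertex 3 1) (vertex 3 2)) := by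
  have key := fun a : ℤ => (triangle_eq_of_emod_three (f := fun l => apothem 3 • edgeNormal 3 l)
    (fun l => by rw [← edgeNormal_emod (n := 3) (by omega) l]; rfl)
    (a := a) (b := a + 1) (c := a + 2) (by omega) (by omega) (by omega)).1
  rw [fagnanoOrbit_eq_midpointOrbit, trace_midpointOrbit, edgeMidpoint_eq, edgeMidpoint_eq,
    edgeMidpoint_eq, key a]
  exact (key 1).symm

/-! ### The orbits of minimal length -/

/-- The minimal orbits are those that attain a sharp lower bound for the length. -/
theorem mem_minOrbits_iff {T : Set ℂ} {L : ℝ} {q₀ : ℤ → ℂ}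
    (hlow : ∀ q ∈ closedOrbits T, L ≤ orbitLength q) (h₀ : q₀ ∈ closedOrbits T)
    (hL : orbitLength q₀ = L) {q : ℤ → ℂ} :
    q ∈ minOrbits T ↔ q ∈ closedOrbits T ∧ orbitLength q = L := by
  constructor
  · rintro ⟨hq, hmin⟩
    exact ⟨hq, le_antisymm (hL ▸ hmin q₀ h₀) (hlow q hq)⟩
  · rintro ⟨hq, h⟩
    exact ⟨hq, fun q' hq' => h ▸ hlow q' hq'⟩

theorem ncard_setOf_exists_lt {α : Type*} {n : ℕ} {f : ℕ → α}
    (hf : ∀ i < n, ∀ j < n, f i = f j → i = j) : {s | ∃ j < n, s = f j}.ncard = n := by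
  have h : {s | ∃ j < n, s = f j} = f '' (Finset.range n : Set ℕ) := by
    ext s
    simp [eq_comm]
  rw [h, Set.InjOn.ncard_image, Set.ncard_coe_finset, Finset.card_range]
  intro i hi j hj hij
  exact hf i (by simpa using hi) j (by simpa using hj) hij

theorem minOrbits_triangle :
    fagnanoOrbit (vertex 3 0) (vertex 3 1) (vertex 3 2) ∈ bounceOrbits (regularPolygon 3) 3 ∧
    trace '' minOrbits (regularPolygon 3) =
      {trace (fagnanoOrbit (vertex 3 0) (vertex 3 1) (vertex 3 2))} ∧
    fagnanoOrbit (vertex 3 0) (vertex 3 1) (vertex 3 2) ∈ minOrbits (regularPolygon 3) ∧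
    ∀ q ∈ minOrbits (regularPolygon 3), orbitLength q = 3 * Real.sqrt 3 / 2 := by
  have hF := midpointOrbit_mem_regularBounceOrbits one_ne_zero (n := 3) rfl le_rfl 1
  have hlen : orbitLength (midpointOrbit 3 1 1) = 3 * Real.sqrt 3 / 2 := by
    have h := orbitLength_of_bounceNumber_eq_three hF.1.2 (three_mem_periods_threeBounce _ _ _)
    have h' := perimeter_edgeMidpoint_third one_ne_zero (n := 3) rfl le_rfl 1
    rw [h]
    simp only [midpointOrbit, threeBounce]
    norm_num at h' ⊢
    rw [h', apothem_three]
    ring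
  rw [← fagnanoOrbit_eq_midpointOrbit] at hF hlen
  have hmin := fun q => mem_minOrbits_iff (fun q hq => (orbitLength_bound_triangle hq).1) hF.1.1
    hlen (q := q)
  have hFmin := (hmin _).mpr ⟨hF.1.1, hlen⟩
  refine ⟨hF.1, ?_, hFmin, fun q hq => ((hmin q).mp hq).2⟩
  apply Set.Subset.antisymm
  · rintro _ ⟨q, hq, rfl⟩
    obtain ⟨hq, hL⟩ := (hmin q).mp hq
    obtain ⟨a, ha⟩ := (orbitLength_bound_triangle hq).2 hL
    rw [ha, trace_fagnanoOrbit]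
    rfl
  · rintro _ rfl
    exact ⟨_, hFmin, rfl⟩

/-- The segment from an edge midpoint to the opposite vertex `-edgeNormal n a` is the trace of a
vertex orbit with index below `n`. -/
theorem exists_trace_vertexOrbit {n : ℕ} (hn : 3 ≤ n) (hodd : Odd n) (a : ℤ) :
    ∃ j < n, segment ℝ (apothem n • edgeNormal n a) (-edgeNormal n a) =
      trace (vertexOrbit n j) := by
  have h0 := Int.emod_nonneg (a + (n + 1) / 2) (b := n) (by omega)
  have h1 := Int.emod_lt_of_pos (a + (n + 1) / 2) (b := n) (by omega)
  obtain ⟨j, hj⟩ := Int.eq_ofNat_of_zero_le h0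
  rw [hj] at h1
  have hv : vertex n j = -edgeNormal n a := by
    have h2 := (dir_intCast_eq_iff (n := n) (by omega) (2 * j)
      (2 * (a + ((n : ℤ) + 1) / 2))).mpr (by
        rw [← mul_sub]
        refine mul_dvd_mul_left 2 ⟨-((a + (n + 1) / 2) / n), ?_⟩
        have := Int.emod_add_mul_ediv (a + (n + 1) / 2) n
        rw [hj] at this
        linear_combination this)
    rw [neg_edgeNormal_eq_dir hodd, vertex_eq_dir]
    push_cast at h2 ⊢
    exact h2
  refine ⟨j, by omega, ?_⟩
  rw [vertexOrbit, trace_twoBounce, edgeMidpoint_opposite hodd, hv, smul_neg, neg_neg,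
    segment_symm]

theorem minOrbits_of_odd {n : ℕ} (hn : 5 ≤ n) (hodd : Odd n) :
    (∀ j < n, vertexOrbit n j ∈ bounceOrbits (regularPolygon n) 2 ∧
      ¬ IsRegularOrbit (regularPolygon n) (vertexOrbit n j) ∧
      vertexOrbit n j ∈ minOrbits (regularPolygon n)) ∧
    trace '' minOrbits (regularPolygon n) = {s | ∃ j < n, s = trace (vertexOrbit n j)} ∧
    (trace '' minOrbits (regularPolygon n)).ncard = n ∧
    (∀ q ∈ minOrbits (regularPolygon n), orbitLength q = 2 * (1 + Real.cos (Real.pi / n))) ∧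
    2 * (1 + Real.cos (Real.pi / n)) = 2 * width (regularPolygon n) := by
  have hmem := fun j => vertexOrbit_mem_bounceOrbits (n := n) (by omega) hodd j
  have hlen := fun j => orbitLength_vertexOrbit (n := n) (by omega) hodd j
  have hmin := fun q => mem_minOrbits_iff
    (fun q hq => (orbitLength_bound_of_odd (n := n) (by omega) hodd hq).1) (hmem 0).1 (hlen 0)
    (q := q)
  have hmem' := fun j => (hmin _).mpr ⟨(hmem j).1, hlen j⟩
  have htrace : trace '' minOrbits (regularPolygon n) =
      {s | ∃ j < n, s = trace (vertexOrbit n j)} := by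
    apply Set.Subset.antisymm
    · rintro _ ⟨q, hq, rfl⟩
      obtain ⟨hq, hL⟩ := (hmin q).mp hq
      obtain ⟨a, ha⟩ := (orbitLength_bound_of_odd (by omega) hodd hq).2 hL
      rw [ha]
      exact exists_trace_vertexOrbit (by omega) hodd a
    · rintro _ ⟨j, _, rfl⟩
      exact ⟨_, hmem' j, rfl⟩
  refine ⟨fun j _ => ⟨hmem j, not_isRegularOrbit_vertexOrbit (by omega) j, hmem' j⟩, htrace, ?_,
    fun q hq => ((hmin q).mp hq).2, ?_⟩
  · rw [htrace]
    exact ncard_setOf_exists_lt fun i hi j hj h =>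
      vertexOrbit_trace_injective (by omega) hodd hi hj h
  · rw [width_regularPolygon_of_odd (by omega) hodd, apothem]

theorem minOrbits_of_even {n : ℕ} (hn : 3 ≤ n) (heven : Even n) :
    (∀ j < n / 2, (band n j).Nonempty ∧ band n j ⊆ bounceOrbits (regularPolygon n) 2 ∧
      band n j ⊆ minOrbits (regularPolygon n)) ∧
    (∀ i < n / 2, ∀ j < n / 2, i ≠ j → Disjoint (trace '' band n i) (trace '' band n j)) ∧
    trace '' minOrbits (regularPolygon n) = {s | ∃ j < n / 2, s ∈ trace '' band n j} ∧
    (∀ q ∈ minOrbits (regularPolygon n), orbitLength q = 4 * Real.cos (Real.pi / n)) ∧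
    4 * Real.cos (Real.pi / n) = 2 * width (regularPolygon n) := by
  have hn4 : 4 ≤ n := by
    obtain ⟨p, rfl⟩ := heven
    omega
  obtain ⟨q₀, hq₀⟩ := band_nonempty hn heven 0
  have hmin := fun q => mem_minOrbits_iff
    (fun q hq => (orbitLength_bound_of_even hn4 hq).1)
    (band_subset_bounceOrbits hn heven 0 hq₀).1 (orbitLength_of_mem_band hn heven hq₀) (q := q)
  have hsub : ∀ j, band n j ⊆ minOrbits (regularPolygon n) := fun j q hq =>
    (hmin q).mpr ⟨(band_subset_bounceOrbits hn heven j hq).1, orbitLength_of_mem_band hn heven hq⟩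
  refine ⟨fun j _ => ⟨band_nonempty hn heven j, band_subset_bounceOrbits hn heven j, hsub j⟩,
    fun i hi j hj hij => disjoint_trace_band hn heven hi hj hij, ?_,
    fun q hq => ((hmin q).mp hq).2, ?_⟩
  · apply Set.Subset.antisymm
    · rintro _ ⟨q, hq, rfl⟩
      obtain ⟨hq, hL⟩ := (hmin q).mp hq
      obtain ⟨a, x, y, hx, hy, hxa, hyx, htr⟩ := (orbitLength_bound_of_even hn4 hq).2 hL
      rw [htr]
      exact exists_segment_eq_trace_band hn heven hx hy hxa hyx
    · rintro _ ⟨j, _, q, hq, rfl⟩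
      exact ⟨q, hsub j hq, rfl⟩
  · rw [width_regularPolygon_of_even hn heven, apothem]
    ring

/-! ### Comparison of the equilateral orbits with the width -/

theorem two_mul_width_lt {n : ℕ} (hn : 6 ≤ n) :
    2 * width (regularPolygon n) < 3 * Real.sqrt 3 * apothem n := by
  have hr := apothem_pos (n := n) (by omega)
  have hpi := Real.pi_pos
  have h6 : (6 : ℝ) ≤ n := by exact_mod_cast hn
  have hr6 : Real.sqrt 3 / 2 ≤ apothem n := by
    rw [← Real.cos_pi_div_six]
    apply Real.cos_le_cos_of_nonneg_of_le_pi (by positivity) (by linarith)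
    gcongr
  have h3 : Real.sqrt 3 ^ 2 = 3 := Real.sq_sqrt (by norm_num)
  have hs : 5 / 3 < Real.sqrt 3 := by
    apply Real.lt_sqrt_of_sq_lt
    norm_num
  have hs2 : Real.sqrt 3 < 2 := by nlinarith
  rcases Nat.even_or_odd n with h | h
  · rw [width_regularPolygon_of_even (by omega) h]
    nlinarith
  · rw [width_regularPolygon_of_odd (by omega) h]
    nlinarith [mul_le_mul_of_nonneg_left hr6 (show (0 : ℝ) ≤ 3 * Real.sqrt 3 - 2 by linarith)]

theorem regularBounceOrbits_three {n k : ℕ} (hn : 3 ≤ n) (hnk : n = 3 * k) :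
    (∀ j < k, midpointOrbit n k j ∈ regularBounceOrbits (regularPolygon n) 3 ∧
      dist (edgeMidpoint n j) (edgeMidpoint n (j + k)) =
        dist (edgeMidpoint n (j + k)) (edgeMidpoint n (j + 2 * k)) ∧
      dist (edgeMidpoint n (j + k)) (edgeMidpoint n (j + 2 * k)) =
        dist (edgeMidpoint n (j + 2 * k)) (edgeMidpoint n j)) ∧
    trace '' regularBounceOrbits (regularPolygon n) 3 =
      {s | ∃ j < k, s = trace (midpointOrbit n k j)} ∧
    (trace '' regularBounceOrbits (regularPolygon n) 3).ncard = k ∧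
    (∀ q ∈ regularBounceOrbits (regularPolygon n) 3,
      orbitLength q = 3 * Real.sqrt 3 * Real.cos (Real.pi / n)) ∧
    (2 ≤ k → 2 * width (regularPolygon n) < 3 * Real.sqrt 3 * Real.cos (Real.pi / n)) := by
  have hk : k ≠ 0 := by omega
  have hmem := fun j => midpointOrbit_mem_regularBounceOrbits hk hnk hn j
  have htrace : trace '' regularBounceOrbits (regularPolygon n) 3 =
      {s | ∃ j < k, s = trace (midpointOrbit n k j)} := by
    apply Set.Subset.antisymm
    · rintro _ ⟨q, hq, rfl⟩
      obtain ⟨hper, a, b, c, u, v, w, h⟩ := exists_isRegularTriangle hn hq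
      obtain ⟨j, hj, htr, -⟩ := h.eq_edgeMidpoints hn hnk
      exact ⟨j, hj, by rw [trace_of_three_mem_periods hper, htr, trace_midpointOrbit]⟩
    · rintro _ ⟨j, _, rfl⟩
      exact ⟨_, hmem j, rfl⟩
  refine ⟨fun j _ => ?_, htrace, ?_, fun q hq => ?_, fun h2 => two_mul_width_lt (by omega)⟩
  · obtain ⟨h1, h2, h3⟩ := dist_edgeMidpoint_third hk hnk hn j
    exact ⟨hmem j, by rw [h1, h2], by rw [h2, h3]⟩
  · rw [htrace]
    exact ncard_setOf_exists_lt fun i hi j hj h =>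
      midpointOrbit_trace_injective hk hnk hn hi hj h
  · obtain ⟨hper, a, b, c, u, v, w, h⟩ := exists_isRegularTriangle hn hq
    obtain ⟨j, hj, -, hp⟩ := h.eq_edgeMidpoints hn hnk
    rw [orbitLength_of_bounceNumber_eq_three hq.1.2 hper, hp,
      perimeter_edgeMidpoint_third hk hnk hn, apothem]

end Billiard

theorem mainTheorem1 (n : ℕ) (hn : 3 ≤ n) :
    -- (i) the triangle
    (n = 3 →
      Billiard.fagnanoOrbit (Billiard.vertex n 0) (Billiard.vertex n 1) (Billiard.vertex n 2)
          ∈ Billiard.bounceOrbits (Billiard.regularPolygon n) 3 ∧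
      Billiard.trace '' Billiard.minOrbits (Billiard.regularPolygon n) =
        {Billiard.trace (Billiard.fagnanoOrbit
          (Billiard.vertex n 0) (Billiard.vertex n 1) (Billiard.vertex n 2))} ∧
      Billiard.fagnanoOrbit (Billiard.vertex n 0) (Billiard.vertex n 1) (Billiard.vertex n 2)
          ∈ Billiard.minOrbits (Billiard.regularPolygon n) ∧
      ∀ q ∈ Billiard.minOrbits (Billiard.regularPolygon n),
        Billiard.orbitLength q = 3 * Real.sqrt 3 / 2) ∧
    -- (ii) odd n
    (5 ≤ n → Odd n →
      (∀ j < n, Billiard.vertexOrbit n j ∈ Billiard.bounceOrbits (Billiard.regularPolygon n) 2 ∧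
        ¬ Billiard.IsRegularOrbit (Billiard.regularPolygon n) (Billiard.vertexOrbit n j) ∧
        Billiard.vertexOrbit n j ∈ Billiard.minOrbits (Billiard.regularPolygon n)) ∧
      Billiard.trace '' Billiard.minOrbits (Billiard.regularPolygon n) =
        {s | ∃ j < n, s = Billiard.trace (Billiard.vertexOrbit n j)} ∧
      (Billiard.trace '' Billiard.minOrbits (Billiard.regularPolygon n)).ncard = n ∧
      (∀ q ∈ Billiard.minOrbits (Billiard.regularPolygon n),
        Billiard.orbitLength q = 2 * (1 + Real.cos (Real.pi / n))) ∧
      2 * (1 + Real.cos (Real.pi / n)) = 2 * Billiard.width (Billiard.regularPolygon n)) ∧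
    -- (iii) even n
    (Even n →
      (∀ j < n / 2, (Billiard.band n j).Nonempty ∧
        Billiard.band n j ⊆ Billiard.bounceOrbits (Billiard.regularPolygon n) 2 ∧
        Billiard.band n j ⊆ Billiard.minOrbits (Billiard.regularPolygon n)) ∧
      (∀ i < n / 2, ∀ j < n / 2, i ≠ j →
        Disjoint (Billiard.trace '' Billiard.band n i) (Billiard.trace '' Billiard.band n j)) ∧
      Billiard.trace '' Billiard.minOrbits (Billiard.regularPolygon n) =
        {s | ∃ j < n / 2, s ∈ Billiard.trace '' Billiard.band n j} ∧
      (∀ q ∈ Billiard.minOrbits (Billiard.regularPolygon n),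
        Billiard.orbitLength q = 4 * Real.cos (Real.pi / n)) ∧
      4 * Real.cos (Real.pi / n) = 2 * Billiard.width (Billiard.regularPolygon n)) ∧
    -- (iv) regular 3-bounce orbits
    (∀ k : ℕ, n = 3 * k →
      (∀ j < k,
        Billiard.midpointOrbit n k j
          ∈ Billiard.regularBounceOrbits (Billiard.regularPolygon n) 3 ∧
        dist (Billiard.edgeMidpoint n j) (Billiard.edgeMidpoint n (j + k)) =
          dist (Billiard.edgeMidpoint n (j + k)) (Billiard.edgeMidpoint n (j + 2 * k)) ∧
        dist (Billiard.edgeMidpoint n (j + k)) (Billiard.edgeMidpoint n (j + 2 * k)) =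
          dist (Billiard.edgeMidpoint n (j + 2 * k)) (Billiard.edgeMidpoint n j)) ∧
      Billiard.trace '' Billiard.regularBounceOrbits (Billiard.regularPolygon n) 3 =
        {s | ∃ j < k, s = Billiard.trace (Billiard.midpointOrbit n k j)} ∧
      (Billiard.trace '' Billiard.regularBounceOrbits (Billiard.regularPolygon n) 3).ncard = k ∧
      (∀ q ∈ Billiard.regularBounceOrbits (Billiard.regularPolygon n) 3,
        Billiard.orbitLength q = 3 * Real.sqrt 3 * Real.cos (Real.pi / n)) ∧
      (2 ≤ k → 2 * Billiard.width (Billiard.regularPolygon n) <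
        3 * Real.sqrt 3 * Real.cos (Real.pi / n))) ∧
    (¬ 3 ∣ n → Billiard.regularBounceOrbits (Billiard.regularPolygon n) 3 = ∅) := by
  refine ⟨?_, fun h5 hodd => Billiard.minOrbits_of_odd h5 hodd,
    fun heven => Billiard.minOrbits_of_even hn heven,
    fun k hnk => Billiard.regularBounceOrbits_three hn hnk, fun h3 => ?_⟩
  · rintro rfl
    exact Billiard.minOrbits_triangle
  · rw [Set.eq_empty_iff_forall_notMem]
    intro q hq
    obtain ⟨-, a, b, c, u, v, w, h⟩ := Billiard.exists_isRegularTriangle hn hq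
    exact h3 (h.three_dvd hn)
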